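/- **Setting.** Let $L$ be a lattice of rank $n$, $L_{\mathbb R}=L\otimes\mathbb R$, $T=L_{\mathbb R}/L$, $L^*=\mathrm{Hom}(L,\mathbb Z)$, so that the character ring of $T$ is $R(T)=\mathbb Z[L^*]$ with basis $\{t^u\}_{u\in L^*}$. A simplicial multi-fan $\Delta=(\Sigma,C,w^\pm)$ in $L$ consists of a finite abstract simplicial complex $\Sigma$ (the empty simplex included; $\Sigma^{(k)}$ is the set of simplices with $k$ vertices, and $\Sigma^{(n)}\neq\emptyset$), of a map $C$ that assigns to each $I\in\Sigma$ a rational simplicial cone $C(I)\subset L_{\mathbb R}$ of dimension $|I|$ such that $J\mapsto C(J)$ matches the faces of $I$ with the faces of $C(I)$, and of functions $w^\pm:\Sigma^{(n)}\to\mathbb Z_{\ge0}$; put $w=w^+-w^-$. For $K\in\Sigma$ let $L^K_{\mathbb R}$ be the quotient of $L_{\mathbb R}$ by the span of $C(K)$, and for $J\supseteq K$ let $C_K(J)$ be the image of $C(J)$ in it. A vector $x\in L^K_{\mathbb R}$ is generic for $K$ if it lies in the span of no $C_K(J)$ with $J\supseteq K$, $|J|<n$. $\Delta$ is complete if for every $K\in\Sigma$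 the integer $\sum_{I\in\Sigma^{(n)},\,I\supseteq K,\,x\in C_K(I)}w(I)$ is the same for all $x$ that are generic for $K$. Let $\Delta$ be complete and let $\mathcal V=\{v_i\in L\}_{i\in\Sigma^{(1)}}$ be vectors, not necessarily primitive, such that $v_i$ generates the ray $C(i)$. For $I\in\Sigma^{(n)}$ let $\{u_i^I\}_{i\in I}$ be the basis of $L_{\mathbb R}^*$ dual to $\{v_i\}_{i\in I}$, let $L_{I,\mathcal V}$ be the sublattice generated by $\{v_i\}_{i\in I}$, and let $H_I=L/L_{I,\mathcal V}$; let $v(h)\in L$ denote a representative of $h\in H_I$. Put $L_{\mathcal V}=\bigcap_{I\in\Sigma^{(n)}}L_{I,\mathcal V}$ and $r=\mathrm{lcm}\{|H_I|: I\in\Sigma^{(n)}\}$. A vector $v\in L$ is generic if $\langle u_i^I,v\rangle\ne0$ for all $I\in\Sigma^{(n)}$, $i\in I$. For $z,\sigma\in\mathbb C$ and $\mathrm{Im}\,\tau>0$ put $t=e^{2\pi\sqrt{-1}z}$, $q=e^{2\pi\sqrt{-1}\tau}$, $\zeta^{a}=e^{2\pi\sqrt{-1}a\sigma}$ $(a\in\mathbb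 R)$, $$\Phi(z,\tau)=(t^{1/2}-t^{-1/2})\prod_{k\ge1}\frac{(1-tq^k)(1-t^{-1}q^k)}{(1-q^k)^2},\qquad \phi(z,\tau,\sigma)=\frac{\Phi(z+\sigma,\tau)}{\Phi(z,\tau)}.$$ For generic $v\in L_{\mathcal V}$ the equivariant elliptic genus and the equivariant orbifold elliptic genus along $v$ are $$\varphi^v(\Delta,\mathcal V)=\sum_{I\in\Sigma^{(n)}}\frac{w(I)}{|H_I|}\sum_{h\in H_I}\prod_{i\in I}\phi(\langle u_i^I,-zv-v(h)\rangle,\tau,\sigma),$$ $$\hat\varphi^v(\Delta,\mathcal V)=\sum_{I\in\Sigma^{(n)}}\frac{w(I)}{|H_I|}\sum_{(h_1,h_2)\in H_I\times H_I}\prod_{i\in I}\zeta^{\langle u_i^I,v(h_1)\rangle}\phi(\langle u_i^I,-zv+\tau v(h_1)-v(h_2)\rangle,\tau,\sigma).$$ For $N\ge1$ let $D_N(v)$ be the set of all $(z,\tau,\sigma)$ with $\mathrm{Im}\,\tau>0$ such that, for all $I\in\Sigma^{(n)}$ and $i\in I$, $\mathrm{Im}\,\tau>N\,|\mathrm{Im}(\langle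 u_i^I,v\rangle z)|$ and $\langle u_i^I,v\rangle z\notin\langle u_i^I,L\rangle$. **Proposition.** 1. For every generic $v\in L_{\mathcal V}$ there are unique $\psi_s\in\mathbb Z[t^{\pm1},\zeta^{\pm1}]$, $s=0,1,2,\dots$, such that $\zeta^{n/2}\varphi^v(\Delta,\mathcal V)=\sum_{s\ge0}\psi_s q^s$ on $D_1(v)$ (convergent series). 2. For every generic $v\in L_{\mathcal V}$ there are unique $\hat\psi_s\in\mathbb Z[t^{\pm1},\zeta^{\pm1/r}]$, $s=0,1,2,\dots$, such that $\zeta^{n/2}\hat\varphi^v(\Delta,\mathcal V)=\sum_{s\ge0}\hat\psi_s q^s$ on $D_r(v)$. 3. Consequently both genera are virtual characters of $T$: there are a unique $X\in(R(T)\otimes\mathbb Z[\zeta^{\pm1}])[[q]]$ and a unique $\hat X\in(R(T)\otimes\mathbb Z[\zeta^{\pm1/r}])[[q]]$ such that, for every generic $v\in L_{\mathcal V}$, the series obtained by applying $v^*:t^u\mapsto t^{\langle u,v\rangle}$ to the coefficients of $X$ and of $\hat X$ are the expansions of $\zeta^{n/2}\varphi^v(\Delta,\mathcal V)$ on $D_1(v)$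 and of $\zeta^{n/2}\hat\varphi^v(\Delta,\mathcal V)$ on $D_r(v)$, respectively. -/

import Mathlib

open scoped TensorProduct

noncomputable section

/-! ### Simplicial multi-fans -/

/-- The real vector space `L_ℝ = ℝ ⊗ L` of a lattice `L`. -/
abbrev RealExt (L : Type*) [AddCommGroup L] : Type _ := ℝ ⊗[ℤ] L

/-- The canonical map `L → L_ℝ`. -/
def latticeVec {L : Type*} [AddCommGroup L] (x : L) : RealExt L := (1 : ℝ) ⊗ₜ[ℤ] x

/-- A simplicial multi-fan `Δ = (Σ, C, w^±)` in the lattice `L`, of dimension `rank L`.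
`V` is the vertex set `Σ^(1)`, and `faces` is the (finite, abstract) simplicial complex `Σ` with
the empty simplex included. Only the values of `cone` on `faces`, and only the values of `wPlus`
and `wMinus` on the simplices with `rank L` vertices, are ever used. -/
structure SimplicialMultiFan (V L : Type*) [AddCommGroup L] where
  /-- the augmented simplicial complex `Σ` -/
  faces : Finset (Finset V)
  empty_mem : ∅ ∈ faces
  singleton_mem : ∀ i : V, {i} ∈ faces
  down_closed : ∀ I ∈ faces, ∀ J ⊆ I, J ∈ faces
  /-- the map `C` from simplices to cones in `L_ℝ` -/
  cone : Finset V → PointedCone ℝ (RealExt L)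
  /-- `C(I)` is a rational simplicial cone of dimension `|I|`, and `J ↦ C(J)` matches the faces
  `J` of the simplex `I` with the faces of the cone `C(I)`. -/
  cone_simplicial : ∀ I ∈ faces, ∃ b : V → L,
    LinearIndependent ℝ (fun i : I => latticeVec (b i)) ∧
      ∀ J ⊆ I, cone J = PointedCone.hull ℝ ((fun i => latticeVec (b i)) '' (J : Set V))
  /-- `Σ^(n)` is not empty, where `n` is the rank of `L` -/
  exists_top : ∃ I ∈ faces, I.card = Module.finrank ℤ L
  /-- the function `w^+` -/
  wPlus : Finset V → ℕ
  /-- the function `w^-` -/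
  wMinus : Finset V → ℕ

namespace SimplicialMultiFan

variable {V L : Type*} [AddCommGroup L] (Δ : SimplicialMultiFan V L)

/-- The set `Σ^(n)` of top dimensional simplices, `n = rank L`. -/
def topFaces : Finset (Finset V) := Δ.faces.filter fun I => I.card = Module.finrank ℤ L

/-- `w(I) = w^+(I) - w^-(I)`. -/
def w (I : Finset V) : ℤ := (Δ.wPlus I : ℤ) - (Δ.wMinus I : ℤ)

/-- The linear subspace `(L_K)_ℝ` of `L_ℝ` spanned by the cone `C(K)`. -/
def coneSpan (K : Finset V) : Submodule ℝ (RealExt L) :=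
  Submodule.span ℝ (Δ.cone K : Set (RealExt L))

/-- The vector space `(L^K)_ℝ = L_ℝ / (L_K)_ℝ` in which the projected multi-fan `Δ_K` lives. -/
abbrev ProjSpace (K : Finset V) : Type _ := RealExt L ⧸ Δ.coneSpan K

/-- For a simplex `J ⊇ K`, the cone `C_K(J)`: the image of `C(J)` in `(L^K)_ℝ`. -/
def projCone (K J : Finset V) : PointedCone ℝ (Δ.ProjSpace K) :=
  (Δ.cone J).map (Δ.coneSpan K).mkQ

/-- A vector of `(L^K)_ℝ` is generic for `Δ_K` if it lies on no linear subspace spanned by a cone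
`C_K(J)`, `J ⊇ K`, of dimension `|J| - |K|` less than `n - |K|`. -/
def IsGenericFor (K : Finset V) (x : Δ.ProjSpace K) : Prop :=
  ∀ J ∈ Δ.faces, K ⊆ J → J.card < Module.finrank ℤ L →
    x ∉ Submodule.span ℝ (Δ.projCone K J : Set (Δ.ProjSpace K))

open Classical in
/-- The number `d_x` of the projected multi-fan `Δ_K`: the sum of the `w(I)` over all
`I ∈ Σ^(n)` containing `K` with `x ∈ C_K(I)`. -/
def degreeAt (K : Finset V) (x : Δ.ProjSpace K) : ℤ :=
  ∑ I ∈ Δ.topFaces.filter (fun I => K ⊆ I ∧ x ∈ Δ.projCone K I), Δ.w I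

/-- The projected multi-fan `Δ_K` is pre-complete: `d_x` is the same for all generic `x`. -/
def IsPreCompleteAt (K : Finset V) : Prop :=
  ∀ x y : Δ.ProjSpace K, Δ.IsGenericFor K x → Δ.IsGenericFor K y →
    Δ.degreeAt K x = Δ.degreeAt K y

/-- `Δ` is complete: every projected multi-fan `Δ_K` (in particular `Δ_∅ = Δ`) is pre-complete. -/
def IsComplete : Prop := ∀ K ∈ Δ.faces, Δ.IsPreCompleteAt K

end SimplicialMultiFan

/-- A set of vectors `𝒱 = {v_i}` of `L` indexed by `Σ^(1)`, such that `v_i` (which need not be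
primitive) generates the ray `C(i)`. -/
structure GeneratingVectors {V L : Type*} [AddCommGroup L] (Δ : SimplicialMultiFan V L) where
  vec : V → L
  generates : ∀ i : V, Δ.cone {i} = PointedCone.hull ℝ {latticeVec (vec i)}

namespace GeneratingVectors

variable {V L : Type*} [AddCommGroup L] {Δ : SimplicialMultiFan V L} (𝒱 : GeneratingVectors Δ)

theorem linearIndependent {I : Finset V} (hI : I ∈ Δ.faces) :
    LinearIndependent ℝ (fun i : I => latticeVec (𝒱.vec i)) := by
  obtain ⟨b, hb, hc⟩ := Δ.cone_simplicial I hI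
  have key : ∀ i : I, ∃ c : ℝˣ, latticeVec (𝒱.vec i) = c • latticeVec (b i) := by
    intro i
    have h1 : PointedCone.hull ℝ {latticeVec (b i)}
        = PointedCone.hull ℝ {latticeVec (𝒱.vec i)} := by
      rw [← 𝒱.generates i, hc {i.1} (by simp)]
      simp
    have h2 : latticeVec (𝒱.vec i) ∈ PointedCone.hull ℝ {latticeVec (b i)} := by
      rw [h1]; exact Submodule.subset_span rfl
    have h3 : latticeVec (b i) ∈ PointedCone.hull ℝ {latticeVec (𝒱.vec i)} := by
      rw [← h1]; exact Submodule.subset_span rfl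
    obtain ⟨c, hc2⟩ := Submodule.mem_span_singleton.1 h2
    obtain ⟨d, hd⟩ := Submodule.mem_span_singleton.1 h3
    have hne : (c : ℝ) ≠ 0 := by
      intro h0
      have hc0 : c = 0 := Subtype.ext h0
      rw [hc0, zero_smul] at hc2
      have hd' : (d : ℝ) • latticeVec (𝒱.vec i) = latticeVec (b i) := hd
      rw [← hc2, smul_zero] at hd'
      exact hb.ne_zero i hd'.symm
    exact ⟨Units.mk0 (c : ℝ) hne, hc2.symm⟩
  choose c hc' using key
  have : (fun i : I => latticeVec (𝒱.vec i)) = c • (fun i : I => latticeVec (b i)) := by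
    funext i; exact hc' i
  rw [this]
  exact hb.units_smul c

section FreeLattice

variable [Module.Free ℤ L] [Module.Finite ℤ L]

/-- For `I ∈ Σ^(n)`, the basis `{v_i}_{i ∈ I}` of the vector space `L_ℝ`. -/
def basis (I : Δ.topFaces) : Module.Basis I.1 ℝ (RealExt L) :=
  Module.Basis.mk (𝒱.linearIndependent (Finset.mem_filter.1 I.2).1) <| by
    rw [(𝒱.linearIndependent (Finset.mem_filter.1 I.2).1).span_eq_top_of_card_eq_finrank']
    rw [Fintype.card_coe, (Finset.mem_filter.1 I.2).2, Module.finrank_baseChange]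

/-- The pairing `⟨u_i^I, x⟩` of `x ∈ L` with the basis `{u_i^I}_{i ∈ I}` dual to
`{v_i}_{i ∈ I}`. -/
def pairing (I : Δ.topFaces) (i : I.1) (x : L) : ℝ := (𝒱.basis I).coord i (latticeVec x)

/-- The sublattice `L_{I,𝒱}` of `L` generated by the `v_i`, `i ∈ I`. -/
def sublattice (I : Finset V) : Submodule ℤ L := Submodule.span ℤ (𝒱.vec '' (I : Set V))

/-- The group `H_I = L / L_{I,𝒱}`. -/
abbrev H (I : Finset V) : Type _ := L ⧸ 𝒱.sublattice I

instance (I : Δ.topFaces) : Finite (𝒱.H I.1) := by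
  have h1 : LinearIndependent ℤ (fun i : I.1 => 𝒱.vec i) := by
    have h := (𝒱.linearIndependent (Finset.mem_filter.1 I.2).1).restrict_scalars'
      (R := ℤ)
    exact LinearIndependent.of_comp (TensorProduct.mk ℤ ℝ L 1) h
  have h2 := finrank_span_eq_card h1
  refine (Submodule.finiteQuotient_iff _).2 ?_
  have h3 : Set.range (fun i : I.1 => 𝒱.vec i) = 𝒱.vec '' (I.1 : Set V) := by
    ext x; simp
  rw [h3, Fintype.card_coe, (Finset.mem_filter.1 I.2).2] at h2
  exact h2

instance (I : Δ.topFaces) : Fintype (𝒱.H I.1) := Fintype.ofFinite _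

/-- The lattice `L_𝒱`, the intersection of the `L_{I,𝒱}` over all `I ∈ Σ^(n)`. -/
def commonSublattice : Submodule ℤ L := ⨅ I : Δ.topFaces, 𝒱.sublattice I.1

/-- The least common multiple `r` of the orders `|H_I|`, `I ∈ Σ^(n)`. -/
def lcmOrder : ℕ := Finset.univ.lcm fun I : Δ.topFaces => Nat.card (𝒱.H I.1)

/-- A vector `v ∈ L` is generic if `⟨u_i^I, v⟩ ≠ 0` for all `I ∈ Σ^(n)` and `i ∈ I`. -/
def IsGeneric (v : L) : Prop := ∀ (I : Δ.topFaces) (i : I.1), 𝒱.pairing I i v ≠ 0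

end FreeLattice

end GeneratingVectors

/-! ### The Jacobi form and the elliptic genera -/

/-- `e(w) = exp(2π√-1 w)`. -/
def expTwoPiI (w : ℂ) : ℂ := Complex.exp (2 * Real.pi * Complex.I * w)

/-- `Φ(z,τ) = (t^{1/2} - t^{-1/2}) ∏_{k ≥ 1} (1 - t q^k)(1 - t⁻¹ q^k) / (1 - q^k)²`, where
`t = e(z)` and `q = e(τ)`. -/
def jacobiPhi (z τ : ℂ) : ℂ :=
  (expTwoPiI (z / 2) - expTwoPiI (-z / 2)) *
    ∏' k : ℕ, (1 - expTwoPiI z * expTwoPiI τ ^ (k + 1)) *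
      (1 - (expTwoPiI z)⁻¹ * expTwoPiI τ ^ (k + 1)) / (1 - expTwoPiI τ ^ (k + 1)) ^ 2

/-- `φ(z,τ,σ) = Φ(z + σ, τ) / Φ(z, τ)`. -/
def phiQuot (z τ σ : ℂ) : ℂ := jacobiPhi (z + σ) τ / jacobiPhi z τ

namespace GeneratingVectors

variable {V L : Type*} [AddCommGroup L] [Module.Free ℤ L] [Module.Finite ℤ L]
  {Δ : SimplicialMultiFan V L} (𝒱 : GeneratingVectors Δ)

/-- The equivariant elliptic genus `φ^v(Δ,𝒱; z,τ,σ)` along `v`. Here `h.out ∈ L` is a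
representative of `h ∈ H_I`; the value does not depend on the choice. -/
def ellipticGenus (v : L) (z τ σ : ℂ) : ℂ :=
  ∑ I : Δ.topFaces, (Δ.w I.1 : ℂ) / (Nat.card (𝒱.H I.1) : ℂ) *
    ∑ h : 𝒱.H I.1, ∏ i : I.1,
      phiQuot (-z * (𝒱.pairing I i v : ℂ) - (𝒱.pairing I i (Quotient.out h) : ℂ)) τ σ

/-- The equivariant orbifold elliptic genus `φ̂^v(Δ,𝒱; z,τ,σ)` along `v`, with
`ζ^a = e(a σ)` for real `a`. -/
def orbifoldEllipticGenus (v : L) (z τ σ : ℂ) : ℂ :=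
  ∑ I : Δ.topFaces, (Δ.w I.1 : ℂ) / (Nat.card (𝒱.H I.1) : ℂ) *
    ∑ h : 𝒱.H I.1 × 𝒱.H I.1, ∏ i : I.1,
      expTwoPiI ((𝒱.pairing I i (Quotient.out h.1) : ℂ) * σ) *
        phiQuot (-z * (𝒱.pairing I i v : ℂ) + τ * (𝒱.pairing I i (Quotient.out h.1) : ℂ)
          - (𝒱.pairing I i (Quotient.out h.2) : ℂ)) τ σ

end GeneratingVectors

/-! ### Expansions in `q` -/

/-- `e(w)` as a unit of `ℂ`. -/
def expUnit (w : ℂ) : ℂˣ := Units.mk0 (expTwoPiI w) (Complex.exp_ne_zero _)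

/-- Evaluation of an element of `ℤ[t^{±1}, ζ^{±1/r}] = R(S¹) ⊗ ℤ[ζ^{±1/r}]` at `t = e(z)`,
`ζ^{1/r} = e(σ/r)`. The outer Laurent variable is `ζ^{1/r}`, the inner one is `t`. -/
def evalCharacter (r : ℕ) (z σ : ℂ) : LaurentPolynomial (LaurentPolynomial ℤ) →+* ℂ :=
  LaurentPolynomial.eval₂ (LaurentPolynomial.eval₂ (Int.castRingHom ℂ) (expUnit z))
    (expUnit (σ / r))

/-- The homomorphism `v^* : R(T) = ℤ[L^*] → R(S¹) = ℤ[t^{±1}]`, `t^u ↦ t^⟨u,v⟩`. -/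
def vStar {L : Type*} [AddCommGroup L] (v : L) :
    AddMonoidAlgebra ℤ (Module.Dual ℤ L) →+* LaurentPolynomial ℤ :=
  AddMonoidAlgebra.mapDomainRingHom ℤ (Module.Dual.eval ℤ L v).toAddMonoidHom

/-- The homomorphism induced by `v^*` from `(R(T) ⊗ ℤ[ζ^{±1/r}])[[q]]` to
`(R(S¹) ⊗ ℤ[ζ^{±1/r}])[[q]]`, applied coefficientwise. -/
def vStarSeries {L : Type*} [AddCommGroup L] (v : L) :
    PowerSeries (LaurentPolynomial (AddMonoidAlgebra ℤ (Module.Dual ℤ L))) →+*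
      PowerSeries (LaurentPolynomial (LaurentPolynomial ℤ)) :=
  PowerSeries.map (AddMonoidAlgebra.mapRingHom ℤ (vStar v))

namespace GeneratingVectors

variable {V L : Type*} [AddCommGroup L] [Module.Free ℤ L] [Module.Finite ℤ L]
  {Δ : SimplicialMultiFan V L} (𝒱 : GeneratingVectors Δ)

/-- The domain of the expansions in powers of `q`: `Im τ > N |Im (⟨u_i^I,v⟩ z)|` for all
`I ∈ Σ^(n)`, `i ∈ I`, and `z` is not one of the (real) numbers with
`⟨u_i^I,v⟩ z ∈ ⟨u_i^I,L⟩` for some `I`, `i`, where a summand of the genus has a pole. -/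
def ExpansionDomain (N : ℕ) (v : L) (z τ : ℂ) : Prop :=
  0 < τ.im ∧ ∀ (I : Δ.topFaces) (i : I.1),
    (N : ℝ) * |((𝒱.pairing I i v : ℂ) * z).im| < τ.im ∧
      ∀ x : L, (𝒱.pairing I i v : ℂ) * z ≠ (𝒱.pairing I i x : ℂ)

/-- The power series `P` in `q`, with coefficients in `ℤ[t^{±1}, ζ^{±1/N}]`, is the expansion of
`ζ^{n/2} F(z,τ,σ)`, where `q = e(τ)`, `ζ^{n/2} = e(n σ / 2)` and `n = rank L`. -/
def IsQExpansion (N : ℕ) (v : L) (F : ℂ → ℂ → ℂ → ℂ)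
    (P : PowerSeries (LaurentPolynomial (LaurentPolynomial ℤ))) : Prop :=
  ∀ z τ σ : ℂ, 𝒱.ExpansionDomain N v z τ →
    HasSum (fun s : ℕ => evalCharacter N z σ (PowerSeries.coeff s P) * expTwoPiI τ ^ s)
      (expTwoPiI ((Module.finrank ℤ L : ℂ) * σ / 2) * F z τ σ)

end GeneratingVectors

end

/-! Put $p=e(\tau/N)$, with $N=1$ for the elliptic genus and $N=r$ for the orbifold genus. By
quasi-periodicity of theta, $\zeta^{\langle u_i^I,v(h_1)\rangle}\phi$ depends on $\langle
u_i^I,v(h_1)\rangle=a_i/N+k$ only through $a_i$, $0\le a_i<N$ (`phiQuot_eq_factorFun`). Each factor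
is then holomorphic in $p$ near $0$, and its Taylor coefficients are integral Laurent polynomials in
$T_i=e(-z\langle u_i^I,v\rangle-\langle u_i^I,v(h_2)\rangle)$ and $\zeta^{1/N}$, divided by $1-T_i$
when $a_i=0$. The classes $h_1\in H_I$ correspond to the boxes $a:V\to\mathbb N$ supported in $I$,
so the orbifold genus is a sum over boxes $a$, each contributing a sum over the $I\supseteq K=\{i:
a_i\ne0\}$ (`expTwoPiI_mul_orbifoldEllipticGenus`); the elliptic genus is the single box $0$ with
$N=1$.

Fix a box. For $\mathrm{Im}\,z<0$ expand each $1/(1-T_i)$ in the direction dictated by the sign of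
$\langle u_i^I,v\rangle$. Averaging over $H_I$ keeps exactly the exponents $m_i=u(v_i)$ with $u\in
L^*$ and cancels $1/|H_I|$, so the coefficient of $p^s$ becomes a series $\sum_u c_u\,t^{-\langle
u,v\rangle}$ with $c_u$ integral in $\zeta^{1/N}$ (`hasSum_genusSeries`).

The heart is that $c_u$ does not depend on $v$ (`starSeries_eq`). The expansions of $F(T)/(1-T)$ for
$|T|<1$ and $|T|>1$ differ by the same constant in every degree. Expanding the product over $i\in I$
accordingly, $v$ enters only through the degrees of the projected multi-fans $\Delta_J$ at the image
of $v$, which are constant by completeness. Comparing $v$ with $-v$ then bounds $\langle u,v\rangle$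
on the support of $c$ for every generic $v$, so the support is finite (`finite_support_starSeries`)
and the coefficient is a virtual character. Real $z$ are reached by continuity.

Multiplying $p$ by an $N$-th root of unity only translates the sum over $H_I$, so only powers of
$q=p^N$ survive (`coeff_genusSeries_of_not_dvd`). Uniqueness follows from the identity theorem in
$q$, $\zeta$ and $t$, and from a generic $v\in L_{\mathcal V}$ separating the finitely many
characters in a coefficient. -/

noncomputable section

/-! ### Taylor series at the origin as formal power series -/

/-- The Taylor series at `0` of a function of one complex variable. -/
def taylorAtZero (f : ℂ → ℂ) : PowerSeries ℂ :=
  PowerSeries.mk fun s => iteratedDeriv s f 0 / (s.factorial : ℂ)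

theorem taylorAtZero_congr {f g : ℂ → ℂ} (h : f =ᶠ[nhds 0] g) :
    taylorAtZero f = taylorAtZero g := by
  ext s
  simp only [taylorAtZero, PowerSeries.coeff_mk]
  rw [h.iteratedDeriv_eq]

theorem taylorAtZero_mul {f g : ℂ → ℂ} (hf : AnalyticAt ℂ f 0) (hg : AnalyticAt ℂ g 0) :
    taylorAtZero (f * g) = taylorAtZero f * taylorAtZero g := by
  ext s
  simp only [taylorAtZero, PowerSeries.coeff_mk, PowerSeries.coeff_mul]
  rw [iteratedDeriv_mul hf.contDiffAt hg.contDiffAt,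
    Finset.Nat.sum_antidiagonal_eq_sum_range_succ_mk, Finset.sum_div]
  refine Finset.sum_congr rfl fun i hi => ?_
  have hi' : i ≤ s := Nat.lt_succ_iff.1 (Finset.mem_range.1 hi)
  rw [Nat.cast_choose ℂ hi']
  have h1 : (s.factorial : ℂ) ≠ 0 := Nat.cast_ne_zero.2 s.factorial_ne_zero
  have h2 : (i.factorial : ℂ) ≠ 0 := Nat.cast_ne_zero.2 i.factorial_ne_zero
  have h3 : ((s - i).factorial : ℂ) ≠ 0 := Nat.cast_ne_zero.2 (s - i).factorial_ne_zero
  field_simp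

theorem taylorAtZero_add {f g : ℂ → ℂ} (hf : AnalyticAt ℂ f 0) (hg : AnalyticAt ℂ g 0) :
    taylorAtZero (f + g) = taylorAtZero f + taylorAtZero g := by
  ext s
  simp only [taylorAtZero, PowerSeries.coeff_mk, map_add]
  rw [iteratedDeriv_add hf.contDiffAt hg.contDiffAt, add_div]

theorem taylorAtZero_const (c : ℂ) : taylorAtZero (fun _ => c) = PowerSeries.C c := by
  ext s
  simp only [taylorAtZero, PowerSeries.coeff_mk, PowerSeries.coeff_C, iteratedDeriv_const]
  split_ifs with h <;> simp [h]

theorem taylorAtZero_id : taylorAtZero (fun p => p) = PowerSeries.X := by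
  ext s
  simp only [taylorAtZero, PowerSeries.coeff_mk, PowerSeries.coeff_X]
  rcases s with _ | _ | s
  · simp
  · simp
  · have : iteratedDeriv (s + 2) (fun p : ℂ => p) 0 = 0 := by
      rw [iteratedDeriv_succ', iteratedDeriv_succ']
      simp
    rw [this]; simp

theorem taylorAtZero_prod {ι : Type*} (S : Finset ι) {f : ι → ℂ → ℂ}
    (hf : ∀ i ∈ S, AnalyticAt ℂ (f i) 0) :
    taylorAtZero (∏ i ∈ S, f i) = ∏ i ∈ S, taylorAtZero (f i) := by
  classical
  induction S using Finset.induction_on with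
  | empty => simpa using! taylorAtZero_const 1
  | insert i S hi ih =>
    rw [Finset.prod_insert hi, Finset.prod_insert hi, taylorAtZero_mul, ih]
    · exact fun j hj => hf j (Finset.mem_insert_of_mem hj)
    · exact hf i (Finset.mem_insert_self i S)
    · exact Finset.analyticAt_prod _ fun j hj => hf j (Finset.mem_insert_of_mem hj)

theorem taylorAtZero_sum {ι : Type*} (S : Finset ι) {f : ι → ℂ → ℂ}
    (hf : ∀ i ∈ S, AnalyticAt ℂ (f i) 0) :
    taylorAtZero (∑ i ∈ S, f i) = ∑ i ∈ S, taylorAtZero (f i) := by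
  classical
  induction S using Finset.induction_on with
  | empty => simpa using! taylorAtZero_const 0
  | insert i S hi ih =>
    rw [Finset.sum_insert hi, Finset.sum_insert hi, taylorAtZero_add, ih]
    · exact fun j hj => hf j (Finset.mem_insert_of_mem hj)
    · exact hf i (Finset.mem_insert_self i S)
    · exact Finset.analyticAt_sum _ fun j hj => hf j (Finset.mem_insert_of_mem hj)

theorem taylorAtZero_pow (n : ℕ) : taylorAtZero (fun p => p ^ n) = PowerSeries.X ^ n := by
  have h := taylorAtZero_prod (Finset.range n) (f := fun _ p => p) fun _ _ => analyticAt_id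
  rw [Finset.prod_const, Finset.prod_const, taylorAtZero_id, Finset.card_range] at h
  rw [← h]; rfl

theorem taylorAtZero_const_mul (c : ℂ) {f : ℂ → ℂ} (hf : AnalyticAt ℂ f 0) :
    taylorAtZero (fun p => c * f p) = PowerSeries.C c * taylorAtZero f := by
  rw [← taylorAtZero_const, ← taylorAtZero_mul analyticAt_const hf]; rfl

theorem taylorAtZero_one_sub_mul_pow (x : ℂ) (n : ℕ) :
    taylorAtZero (fun p => 1 - x * p ^ n) = 1 - PowerSeries.C x * PowerSeries.X ^ n := by
  have h1 : AnalyticAt ℂ (fun p : ℂ => p ^ n) 0 := by fun_prop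
  have h2 : AnalyticAt ℂ (fun p : ℂ => -x * p ^ n) 0 := by fun_prop
  have h := taylorAtZero_add (f := fun _ => 1) analyticAt_const h2
  rw [taylorAtZero_const, taylorAtZero_const_mul _ h1, taylorAtZero_pow] at h
  rw [sub_eq_add_neg, ← neg_mul, ← map_neg, ← map_one PowerSeries.C, ← h]
  refine congrArg _ ?_
  funext p; simp [sub_eq_add_neg]

theorem coeff_zero_taylorAtZero (f : ℂ → ℂ) :
    PowerSeries.constantCoeff (taylorAtZero f) = f 0 := by
  rw [← PowerSeries.coeff_zero_eq_constantCoeff_apply]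
  simp [taylorAtZero]

theorem taylorAtZero_inv {f : ℂ → ℂ} (hf : AnalyticAt ℂ f 0) (h0 : f 0 ≠ 0) :
    taylorAtZero f⁻¹ = (taylorAtZero f)⁻¹ := by
  have h1 : PowerSeries.constantCoeff (taylorAtZero f) ≠ 0 := by
    rwa [coeff_zero_taylorAtZero]
  rw [PowerSeries.eq_inv_iff_mul_eq_one h1, ← taylorAtZero_mul (hf.inv h0) hf]
  have h2 : f⁻¹ * f =ᶠ[nhds 0] fun _ => (1 : ℂ) := by
    filter_upwards [hf.continuousAt.eventually_ne h0] with p hp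
    simp [hp]
  rw [taylorAtZero_congr h2, taylorAtZero_const, map_one]

theorem hasSum_taylorAtZero {f : ℂ → ℂ} {ρ : ℝ} (hf : DifferentiableOn ℂ f (Metric.ball 0 ρ))
    {p : ℂ} (hp : ‖p‖ < ρ) :
    HasSum (fun s : ℕ => PowerSeries.coeff s (taylorAtZero f) * p ^ s) (f p) := by
  have hρ : 0 < ρ := (norm_nonneg p).trans_lt hp
  have h := Complex.hasSum_taylorSeries_on_ball (c := 0) (f := f) hf (z := p) (by simpa using hp)
  refine h.congr_fun fun s => ?_
  simp only [taylorAtZero, PowerSeries.coeff_mk, sub_zero, smul_eq_mul]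
  ring

/-- Power series with the same values near the origin agree. -/
theorem PowerSeries.eq_of_hasSum {F G : PowerSeries ℂ} {ε : ℝ} (hε : 0 < ε) {f : ℂ → ℂ}
    (hF : ∀ p : ℂ, p ≠ 0 → ‖p‖ < ε → HasSum (fun s : ℕ => coeff s F * p ^ s) (f p))
    (hG : ∀ p : ℂ, p ≠ 0 → ‖p‖ < ε → HasSum (fun s : ℕ => coeff s G * p ^ s) (f p)) :
    F = G := by
  have key : ∀ p : ℂ, p ≠ 0 → ‖p‖ < ε →
      HasSum (fun s : ℕ => p ^ s * coeff s (F - G)) 0 := fun p h0 h1 => by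
    have := (hF p h0 h1).sub (hG p h0 h1)
    rw [sub_self] at this
    refine this.congr_fun fun s => ?_
    rw [map_sub]; ring
  -- The sums are known only for `p ≠ 0`, so the value at `0` is set by hand to the constant term;
  -- continuity at `0` shows afterwards that this term vanishes.
  have h : HasFPowerSeriesAt (fun p : ℂ => if p = 0 then coeff 0 (F - G) else 0)
      (FormalMultilinearSeries.ofScalars ℂ fun s => coeff s (F - G)) 0 := by
    rw [hasFPowerSeriesAt_iff]
    filter_upwards [Metric.ball_mem_nhds (0 : ℂ) hε] with p hp
    simp only [FormalMultilinearSeries.coeff_ofScalars, smul_eq_mul, zero_add]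
    split_ifs with h0
    · have h1 := hasSum_single (f := fun s : ℕ => p ^ s * coeff s (F - G)) 0
        fun s hs => by simp [h0, hs]
      simpa using h1
    · exact key p h0 (by simpa using hp)
  have hc : coeff 0 (F - G) = 0 := by
    have h1 := h.continuousAt.tendsto.mono_left (nhdsWithin_le_nhds (s := {0}ᶜ))
    rw [if_pos rfl] at h1
    refine tendsto_nhds_unique h1 (tendsto_const_nhds.congr' ?_)
    filter_upwards [self_mem_nhdsWithin] with p hp
    exact (if_neg hp).symm
  have h' : HasFPowerSeriesAt (0 : ℂ → ℂ)
      (FormalMultilinearSeries.ofScalars ℂ fun s => coeff s (F - G)) 0 := by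
    convert h using 1
    funext p
    rw [hc, ite_self, Pi.zero_apply]
  have h0 := h'.eq_zero
  rw [← sub_eq_zero]
  ext s
  have := congrArg (fun q => FormalMultilinearSeries.coeff q s) h0
  rw [FormalMultilinearSeries.coeff_ofScalars] at this
  rw [this]; rfl

/-! ### Infinite products -/

/-- The formal power series `∏_{k ≥ 0} (1 - x X^{b + N k})` (for `b, N ≥ 1`). -/
def powProd {B : Type*} [CommRing B] (N b : ℕ) (x : B) : PowerSeries B :=
  PowerSeries.mk fun s => PowerSeries.coeff s
    (∏ k ∈ Finset.range (s + 1), (1 - PowerSeries.C x * PowerSeries.X ^ (b + N * k)))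

/-- The function `p ↦ ∏_{k ≥ 0} (1 - x p^{b + N k})`. -/
def powProdFun (N b : ℕ) (x p : ℂ) : ℂ := ∏' k : ℕ, (1 - x * p ^ (b + N * k))

section PowProd

variable {B : Type*} [CommRing B] {N b : ℕ}

/-- The factors with `k > s` differ from `1` only in degrees above `s`, so every sufficiently long
partial product has the same coefficient. -/
theorem coeff_powProd (hN : 0 < N) (hb : 0 < b) (x : B) {s M : ℕ} (hM : s < M) :
    PowerSeries.coeff s (powProd N b x) = PowerSeries.coeff s
      (∏ k ∈ Finset.range M, (1 - PowerSeries.C x * PowerSeries.X ^ (b + N * k))) := by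
  induction M, hM using Nat.le_induction with
  | base => simp [powProd]
  | succ M hM ih =>
    rw [ih, Finset.prod_range_succ, mul_sub, mul_one, map_sub, ← mul_assoc,
      PowerSeries.coeff_mul_X_pow', if_neg, sub_zero]
    have : M ≤ N * M := Nat.le_mul_of_pos_left M hN
    omega

theorem constantCoeff_powProd (hN : 0 < N) (hb : 0 < b) (x : B) :
    PowerSeries.constantCoeff (powProd N b x) = 1 := by
  rw [← PowerSeries.coeff_zero_eq_constantCoeff_apply, coeff_powProd hN hb x zero_lt_one]
  simp [hb.ne']

theorem map_powProd {B' : Type*} [CommRing B'] (φ : B →+* B') (x : B) :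
    PowerSeries.map φ (powProd N b x) = powProd N b (φ x) := by
  ext s
  rw [PowerSeries.coeff_map, powProd, powProd, PowerSeries.coeff_mk, PowerSeries.coeff_mk,
    ← PowerSeries.coeff_map, map_prod]
  simp

/-- The exponents are all congruent to `b` modulo `N`, so an `N`-th root of unity contributes the
same factor `ω ^ b` in every term. -/
theorem rescale_powProd (x ω : B) (hω : ω ^ N = 1) :
    PowerSeries.rescale ω (powProd N b x) = powProd N b (x * ω ^ b) := by
  ext s
  rw [PowerSeries.coeff_rescale, powProd, powProd, PowerSeries.coeff_mk, PowerSeries.coeff_mk,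
    ← PowerSeries.coeff_rescale, map_prod]
  congr 1
  refine Finset.prod_congr rfl fun k _ => ?_
  have h : PowerSeries.rescale ω (PowerSeries.X : PowerSeries B)
      = PowerSeries.C ω * PowerSeries.X := PowerSeries.rescale_X ω
  have hC : PowerSeries.rescale ω (PowerSeries.C x) = PowerSeries.C x := by
    ext n; rw [PowerSeries.coeff_rescale, PowerSeries.coeff_C]; split_ifs with h <;> simp [h]
  rw [map_sub, map_one, map_mul, map_pow, h, hC, mul_pow, ← map_pow, ← mul_assoc, ← map_mul,
    pow_add, pow_mul, hω, one_pow, mul_one]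

end PowProd

theorem summable_powProd {N : ℕ} (hN : 0 < N) (b : ℕ) (x : ℂ) {p : ℂ} (hp : ‖p‖ < 1) :
    Summable fun k : ℕ => ‖-(x * p ^ (b + N * k))‖ := by
  have h : Summable fun k : ℕ => ‖x * p ^ b‖ * (‖p‖ ^ N) ^ k :=
    (summable_geometric_of_lt_one (by positivity)
      (pow_lt_one₀ (norm_nonneg _) hp hN.ne')).mul_left _
  refine h.congr fun k => ?_
  rw [norm_neg, pow_add, ← mul_assoc, norm_mul _ (p ^ (N * k)), norm_pow _ (N * k), pow_mul]

theorem multipliable_powProd {N : ℕ} (hN : 0 < N) (b : ℕ) (x : ℂ) {p : ℂ} (hp : ‖p‖ < 1) :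
    Multipliable fun k : ℕ => 1 - x * p ^ (b + N * k) := by
  simpa [sub_eq_add_neg] using multipliable_one_add_of_summable (summable_powProd hN b x hp)

theorem powProdFun_ne_zero {N : ℕ} (hN : 0 < N) (b : ℕ) {x p : ℂ} (hp : ‖p‖ < 1)
    (hx : ‖x‖ * ‖p‖ ^ b < 1) : powProdFun N b x p ≠ 0 := by
  have h := tprod_one_add_ne_zero_of_summable (f := fun k : ℕ => -(x * p ^ (b + N * k)))
    (fun k => ?_) (summable_powProd hN b x hp)
  · simpa [powProdFun, sub_eq_add_neg] using h
  · intro h0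
    have h1 : x * p ^ (b + N * k) = 1 := by linear_combination -h0
    have h2 : ‖x‖ * ‖p‖ ^ (b + N * k) = 1 := by rw [← norm_pow, ← norm_mul, h1, norm_one]
    rw [pow_add, ← mul_assoc] at h2
    have h3 : ‖p‖ ^ (N * k) ≤ 1 := pow_le_one₀ (norm_nonneg _) hp.le
    have h4 : ‖x‖ * ‖p‖ ^ b * ‖p‖ ^ (N * k) ≤ ‖x‖ * ‖p‖ ^ b :=
      mul_le_of_le_one_right (by positivity) h3
    linarith

theorem hasProdLocallyUniformlyOn_powProd {N : ℕ} (hN : 0 < N) (b : ℕ) (x : ℂ) :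
    HasProdLocallyUniformlyOn (fun (k : ℕ) (p : ℂ) => 1 - x * p ^ (b + N * k))
      (powProdFun N b x) (Metric.ball 0 1) := by
  unfold powProdFun
  simp_rw [sub_eq_add_neg]
  apply hasProdLocallyUniformlyOn_of_forall_compact Metric.isOpen_ball
  intro K hK hcK
  rcases K.eq_empty_or_nonempty with hE | hE
  · simpa [hasProdUniformlyOn_iff_tendstoUniformlyOn, hE] using tendstoUniformlyOn_empty
  -- A point of largest modulus in the compact set gives a summable majorant valid on all of it.
  · obtain ⟨q₀, hq₀, _, HB⟩ := hcK.exists_sSup_image_eq_and_ge hE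
      (show ContinuousOn (fun q : ℂ ↦ ‖q‖) K by fun_prop)
    refine (summable_powProd hN b x (p := q₀) (by simpa using hK hq₀)).hasProdUniformlyOn_nat_one_add
      hcK (.of_forall fun n y hy ↦ ?_) (fun _ ↦ by fun_prop)
    rw [norm_neg, norm_neg, norm_mul, norm_mul, norm_pow, norm_pow]
    have := HB y hy
    gcongr

theorem differentiableOn_powProdFun {N : ℕ} (hN : 0 < N) (b : ℕ) (x : ℂ) :
    DifferentiableOn ℂ (powProdFun N b x) (Metric.ball 0 1) :=
  (hasProdLocallyUniformlyOn_powProd hN b x).differentiableOn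
    (.of_forall fun _ ↦ by simpa [Finset.prod_fn] using
      DifferentiableOn.finsetProd (fun _ _ ↦ by fun_prop)) Metric.isOpen_ball

theorem tendsto_iteratedDeriv {F : ℕ → ℂ → ℂ} {f : ℂ → ℂ} {U : Set ℂ} (hU : IsOpen U)
    (hF : ∀ n, DifferentiableOn ℂ (F n) U)
    (h : TendstoLocallyUniformlyOn F f Filter.atTop U) (s : ℕ) :
    TendstoLocallyUniformlyOn (fun n => iteratedDeriv s (F n)) (iteratedDeriv s f)
      Filter.atTop U := by
  induction s with
  | zero => simpa using h
  | succ s ih =>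
    simp_rw [iteratedDeriv_succ]
    refine ih.deriv (.of_forall fun n => ?_) hU
    clear ih
    induction s with
    | zero => simpa using hF n
    | succ s ih => rw [iteratedDeriv_succ]; exact ih.deriv hU

/-- Locally uniform convergence of holomorphic functions passes to derivatives, while the Taylor
coefficient of order `s` of the partial products is eventually constant and equal to the formal one.
-/
theorem taylorAtZero_powProdFun {N b : ℕ} (hN : 0 < N) (hb : 0 < b) (x : ℂ) :
    taylorAtZero (powProdFun N b x) = powProd N b x := by
  ext s
  have h1 := (hasProdLocallyUniformlyOn_powProd hN b x).tendstoLocallyUniformlyOn_finsetRange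
  have h2 := tendsto_iteratedDeriv Metric.isOpen_ball (fun n => by
    simpa [Finset.prod_fn] using DifferentiableOn.finsetProd (fun _ _ ↦ by fun_prop)) h1 s
  have h3 := (h2.tendsto_at (Metric.mem_ball_self (x := (0 : ℂ)) zero_lt_one)).div_const
    (s.factorial : ℂ)
  rw [taylorAtZero, PowerSeries.coeff_mk]
  refine tendsto_nhds_unique h3 (tendsto_const_nhds.congr' ?_)
  filter_upwards [Filter.eventually_gt_atTop s] with M hM
  rw [coeff_powProd hN hb x hM]
  have h4 := taylorAtZero_prod (Finset.range M) (f := fun k p => 1 - x * p ^ (b + N * k))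
    fun k _ => by fun_prop
  simp_rw [taylorAtZero_one_sub_mul_pow] at h4
  rw [← h4, taylorAtZero, PowerSeries.coeff_mk, Finset.prod_fn]

/-! ### The expansion of the quotient of theta functions -/

theorem PowerSeries.map_invOfUnit {R S : Type*} [CommRing R] [CommRing S] (φ : R →+* S)
    (F : PowerSeries R) (hF : constantCoeff F = 1) :
    map φ (invOfUnit F 1) = invOfUnit (map φ F) 1 := by
  have h1 : map φ F * map φ (invOfUnit F 1) = 1 := by
    rw [← map_mul, mul_invOfUnit _ _ (by simpa using hF), map_one]
  have h2 : map φ F * invOfUnit (map φ F) 1 = 1 :=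
    mul_invOfUnit _ _ (by
      rw [← coeff_zero_eq_constantCoeff_apply, coeff_map, coeff_zero_eq_constantCoeff_apply, hF,
        map_one, Units.val_one])
  calc map φ (invOfUnit F 1) = map φ (invOfUnit F 1) * (map φ F * invOfUnit (map φ F) 1) := by
        rw [h2, mul_one]
    _ = (map φ F * map φ (invOfUnit F 1)) * invOfUnit (map φ F) 1 := by ring
    _ = _ := by rw [h1, one_mul]

theorem PowerSeries.invOfUnit_one_eq_inv {k : Type*} [Field k] (F : PowerSeries k)
    (hF : constantCoeff F = 1) : invOfUnit F 1 = F⁻¹ := by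
  rw [PowerSeries.eq_inv_iff_mul_eq_one (by rw [hF]; exact one_ne_zero)]
  exact invOfUnit_mul _ _ (by simpa using hF)

theorem PowerSeries.constantCoeff_rescale {R : Type*} [CommSemiring R] (ω : R)
    (F : PowerSeries R) : constantCoeff (rescale ω F) = constantCoeff F := by
  rw [← coeff_zero_eq_constantCoeff_apply, coeff_rescale]; simp

theorem PowerSeries.rescale_inv {k : Type*} [Field k] (ω : k) (F : PowerSeries k) :
    rescale ω F⁻¹ = (rescale ω F)⁻¹ := by
  by_cases h : constantCoeff F = 0
  · rw [PowerSeries.inv_eq_zero.2 h, map_zero, PowerSeries.inv_eq_zero.2]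
    rwa [constantCoeff_rescale]
  · rw [PowerSeries.eq_inv_iff_mul_eq_one (by rwa [constantCoeff_rescale]), ← map_mul,
      PowerSeries.inv_mul_cancel _ h, map_one]

theorem PowerSeries.rescale_C {R : Type*} [CommSemiring R] (ω x : R) :
    rescale ω (C x) = C x := by
  ext n; rw [coeff_rescale, coeff_C]; split_ifs with h <;> simp [h]

/-- `∏_{k ≥ 1} (1 - x X^{N k + a}) (1 - y X^{N k - a})`. -/
def thetaSeries {B : Type*} [CommRing B] (N a : ℕ) (x y : B) : PowerSeries B :=
  powProd N (N + a) x * powProd N (N - a) y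

/-- The function `p ↦ ∏_{k ≥ 1} (1 - x p^{N k + a}) (1 - y p^{N k - a})`. -/
def thetaFun (N a : ℕ) (x y p : ℂ) : ℂ := powProdFun N (N + a) x p * powProdFun N (N - a) y p

section Theta

variable {N a : ℕ}

theorem constantCoeff_thetaSeries {B : Type*} [CommRing B] (h : a < N) (x y : B) :
    PowerSeries.constantCoeff (thetaSeries N a x y) = 1 := by
  rw [thetaSeries, map_mul, constantCoeff_powProd (by omega) (by omega),
    constantCoeff_powProd (by omega) (by omega), one_mul]

theorem map_thetaSeries {B B' : Type*} [CommRing B] [CommRing B'] (φ : B →+* B') (x y : B) :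
    PowerSeries.map φ (thetaSeries N a x y) = thetaSeries N a (φ x) (φ y) := by
  rw [thetaSeries, map_mul, map_powProd, map_powProd, thetaSeries]

/-- Since `ω ^ (N - a)` is the inverse of `ω ^ a`, the relation between `x` and `y = x⁻¹` is
preserved: rescaling the series variable amounts to multiplying `x` by `ω ^ a`. -/
theorem rescale_thetaSeries {B : Type*} [CommRing B] (h : a < N) (x y ω ω' : B)
    (hω : ω ^ N = 1) (hω' : ω * ω' = 1) :
    PowerSeries.rescale ω (thetaSeries N a x y)
      = thetaSeries N a (x * ω ^ a) (y * ω' ^ a) := by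
  have h1 : ω ^ (N - a) = ω' ^ a := by
    calc ω ^ (N - a) = ω ^ (N - a) * (ω * ω') ^ a := by rw [hω', one_pow, mul_one]
      _ = (ω ^ (N - a) * ω ^ a) * ω' ^ a := by rw [mul_pow, mul_assoc]
      _ = ω' ^ a := by rw [← pow_add, Nat.sub_add_cancel h.le, hω, one_mul]
  rw [thetaSeries, map_mul, rescale_powProd _ _ hω, rescale_powProd _ _ hω, thetaSeries, h1,
    pow_add, hω, one_mul]

theorem differentiableOn_thetaFun (h : a < N) (x y : ℂ) :
    DifferentiableOn ℂ (thetaFun N a x y) (Metric.ball 0 1) :=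
  (differentiableOn_powProdFun (by omega) _ x).mul (differentiableOn_powProdFun (by omega) _ y)

theorem analyticAt_powProdFun {b : ℕ} (hN : 0 < N) (x : ℂ) :
    AnalyticAt ℂ (powProdFun N b x) 0 :=
  (differentiableOn_powProdFun hN b x).analyticAt (Metric.ball_mem_nhds 0 zero_lt_one)

theorem taylorAtZero_thetaFun (h : a < N) (x y : ℂ) :
    taylorAtZero (thetaFun N a x y) = thetaSeries N a x y := by
  rw [thetaSeries, ← taylorAtZero_powProdFun (by omega) (by omega),
    ← taylorAtZero_powProdFun (by omega) (by omega), ← taylorAtZero_mul]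
  · rfl
  · exact analyticAt_powProdFun (by omega) x
  · exact analyticAt_powProdFun (by omega) y

theorem thetaFun_ne_zero (h : a < N) {x y p : ℂ} (hp : ‖p‖ < 1) (hx : ‖x‖ * ‖p‖ < 1)
    (hy : ‖y‖ * ‖p‖ < 1) : thetaFun N a x y p ≠ 0 := by
  have key : ∀ b : ℕ, 0 < b → ∀ x : ℂ, ‖x‖ * ‖p‖ < 1 → ‖x‖ * ‖p‖ ^ b < 1 := fun b hb x hx =>
    (mul_le_mul_of_nonneg_left (pow_le_of_le_one (norm_nonneg _) hp.le hb.ne')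
      (norm_nonneg _)).trans_lt hx
  exact mul_ne_zero (powProdFun_ne_zero (by omega) _ hp (key _ (by omega) x hx))
    (powProdFun_ne_zero (by omega) _ hp (key _ (by omega) y hy))

end Theta

/-- `ℤ[Z^{±1}][T^{±1}]`. -/
abbrev BiLaurent : Type := LaurentPolynomial (LaurentPolynomial ℤ)

/-- Evaluation of Laurent polynomials with integral coefficients. -/
def evalLaurent (Z : ℂˣ) : LaurentPolynomial ℤ →+* ℂ :=
  LaurentPolynomial.eval₂ (Int.castRingHom ℂ) Z

/-- Evaluation of `ℤ[Z^{±1}][T^{±1}]` at a pair of nonzero complex numbers. -/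
def evalBi (T Z : ℂˣ) : BiLaurent →+* ℂ := LaurentPolynomial.eval₂ (evalLaurent Z) T

/-- The monomial `T^n` of `ℤ[Z^{±1}][T^{±1}]`. -/
def biT (n : ℤ) : BiLaurent := LaurentPolynomial.T n

/-- The monomial `Z^n` of `ℤ[Z^{±1}][T^{±1}]`. -/
def biZ (n : ℤ) : BiLaurent := LaurentPolynomial.C (LaurentPolynomial.T n)

/-- The series `Z^a (1 - T Z^N X^a) θ(T Z^N) / ((1 - T X^a) θ(T))`, where
`θ(x) = ∏_{k ≥ 1} (1 - x X^{N k + a}) (1 - x⁻¹ X^{N k - a})`; for `a = 0` the factor `1 - T` of the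
denominator is left out. -/
def charSeries (N a : ℕ) : PowerSeries BiLaurent :=
  PowerSeries.C (biZ a) * (1 - PowerSeries.C (biT 1 * biZ N) * PowerSeries.X ^ a) *
    thetaSeries N a (biT 1 * biZ N) (biT (-1) * biZ (-N)) *
    PowerSeries.invOfUnit (thetaSeries N a (biT 1) (biT (-1))) 1 *
    (if a = 0 then 1 else PowerSeries.invOfUnit (1 - PowerSeries.C (biT 1) * PowerSeries.X ^ a) 1)

/-- The expansion at `p = 0` of the function `factorFun`. -/
def factorSeries (N a : ℕ) (T Z : ℂˣ) : PowerSeries ℂ :=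
  PowerSeries.map (evalBi T Z) (charSeries N a) *
    (if a = 0 then PowerSeries.C (1 - (T : ℂ))⁻¹ else 1)

/-- The function
`p ↦ Z^a (1 - T Z^N p^a) θ(T Z^N) / ((1 - T p^a) θ(T))`. -/
def factorFun (N a : ℕ) (T Z : ℂˣ) (p : ℂ) : ℂ :=
  Z ^ a * (1 - T * Z ^ N * p ^ a) * thetaFun N a (T * Z ^ N) (T * Z ^ N : ℂ)⁻¹ p *
    (thetaFun N a T (T : ℂ)⁻¹ p)⁻¹ * (1 - T * p ^ a)⁻¹

section Factor

variable {N a : ℕ}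

theorem evalBi_biT (T Z : ℂˣ) (n : ℤ) : evalBi T Z (biT n) = (T ^ n : ℂˣ) := by
  simp [evalBi, biT]

theorem evalBi_biZ (T Z : ℂˣ) (n : ℤ) : evalBi T Z (biZ n) = (Z ^ n : ℂˣ) := by
  simp [evalBi, evalLaurent, biZ]

/-- `charSeries` shows the integrality of the coefficients, this form shows the function being
expanded. No condition `T ≠ 1` appears because for `a = 0` both sides use the inverse with `0⁻¹ =
0`. -/
theorem factorSeries_eq (h : a < N) (T Z : ℂˣ) :
    factorSeries N a T Z = PowerSeries.C ((Z : ℂ) ^ a) *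
      (1 - PowerSeries.C (T * Z ^ N : ℂ) * PowerSeries.X ^ a) *
      thetaSeries N a (T * Z ^ N : ℂ) (T * Z ^ N : ℂ)⁻¹ *
      (thetaSeries N a (T : ℂ) (T : ℂ)⁻¹)⁻¹ *
      (1 - PowerSeries.C (T : ℂ) * PowerSeries.X ^ a)⁻¹ := by
  have h1 : PowerSeries.map (evalBi T Z) (PowerSeries.X ^ a) = PowerSeries.X ^ a := by simp
  rw [factorSeries, charSeries]
  have h2 : evalBi T Z (biT 1 * biZ N) = (T ^ (1 : ℤ) : ℂˣ) * (Z ^ (N : ℤ) : ℂˣ) := by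
    rw [map_mul, evalBi_biT, evalBi_biZ]
  have h3 : evalBi T Z (biT (-1) * biZ (-N)) = (T ^ (-1 : ℤ) : ℂˣ) * (Z ^ (-N : ℤ) : ℂˣ) := by
    rw [map_mul, evalBi_biT, evalBi_biZ]
  rw [map_mul, map_mul, map_mul, map_mul, map_sub, map_mul, map_one, h1, map_thetaSeries,
    PowerSeries.map_invOfUnit _ _ (constantCoeff_thetaSeries h _ _), map_thetaSeries,
    PowerSeries.map_C, PowerSeries.map_C, h2, h3, evalBi_biT, evalBi_biT, evalBi_biZ,
    PowerSeries.invOfUnit_one_eq_inv _ (constantCoeff_thetaSeries h _ _)]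
  have e1 : ((T ^ (1 : ℤ) : ℂˣ) : ℂ) = T := by simp
  have e2 : ((T ^ (-1 : ℤ) : ℂˣ) : ℂ) = (T : ℂ)⁻¹ := by simp
  have e3 : ((Z ^ (N : ℤ) : ℂˣ) : ℂ) = (Z : ℂ) ^ N := by simp
  have e4 : ((Z ^ (-N : ℤ) : ℂˣ) : ℂ) = ((Z : ℂ) ^ N)⁻¹ := by simp
  have e5 : ((Z ^ (a : ℤ) : ℂˣ) : ℂ) = (Z : ℂ) ^ a := by simp
  rw [e1, e2, e3, e4, e5, ← mul_inv]
  rw [mul_assoc _ _ (ite _ _ _)]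
  congr 1
  split_ifs with h0
  · subst h0
    rw [map_one, one_mul, pow_zero, mul_one, ← map_one PowerSeries.C, ← map_sub,
      PowerSeries.C_inv]
  · have h2 : PowerSeries.constantCoeff
        (1 - PowerSeries.C (biT 1) * PowerSeries.X ^ a) = 1 := by
      simp [h0]
    have h3 : PowerSeries.constantCoeff
        (1 - PowerSeries.C (T : ℂ) * PowerSeries.X ^ a) = 1 := by
      simp [h0]
    rw [mul_one, PowerSeries.map_invOfUnit _ _ h2, map_sub, map_mul, map_one, h1,
      PowerSeries.map_C, evalBi_biT, e1, PowerSeries.invOfUnit_one_eq_inv _ h3]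

theorem rescale_factorSeries (h : a < N) (T Z ω : ℂˣ) (hω : ω ^ N = 1) :
    PowerSeries.rescale (ω : ℂ) (factorSeries N a T Z) = factorSeries N a (T * ω ^ a) Z := by
  have hω1 : (ω : ℂ) ^ N = 1 := by rw [← Units.val_pow_eq_pow_val, hω, Units.val_one]
  have hX : PowerSeries.rescale (ω : ℂ) (PowerSeries.X : PowerSeries ℂ)
      = PowerSeries.C (ω : ℂ) * PowerSeries.X := PowerSeries.rescale_X _
  have key : ∀ x : ℂ, PowerSeries.rescale (ω : ℂ) (1 - PowerSeries.C x * PowerSeries.X ^ a)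
      = 1 - PowerSeries.C (x * ω ^ a) * PowerSeries.X ^ a := fun x => by
    rw [map_sub, map_one, map_mul, map_pow, hX, PowerSeries.rescale_C, mul_pow, ← map_pow,
      ← mul_assoc, ← map_mul]
  have hωω : (ω : ℂ) * (ω : ℂ)⁻¹ = 1 := mul_inv_cancel₀ ω.ne_zero
  rw [factorSeries_eq h, factorSeries_eq h, map_mul, map_mul, map_mul, map_mul,
    PowerSeries.rescale_inv, PowerSeries.rescale_inv, key, key, PowerSeries.rescale_C,
    rescale_thetaSeries h _ _ _ _ hω1 hωω, rescale_thetaSeries h _ _ _ _ hω1 hωω]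
  simp only [Units.val_mul, Units.val_pow_eq_pow_val, mul_inv, inv_pow, mul_right_comm _ _ ((ω : ℂ) ^ a),
    mul_right_comm _ _ (((ω : ℂ) ^ a)⁻¹)]

/-- For `|p| < 1` each denominator factor contains `T` or `T⁻¹` times a positive power of `p`, apart
from `1 - T` when `a = 0`; hence no pole occurs for `|p| < min(1, |T|, |T|⁻¹)`. -/
theorem differentiableOn_factorFun (h : a < N) (T Z : ℂˣ) (hT : a = 0 → (T : ℂ) ≠ 1) {ρ : ℝ}
    (h1 : ρ ≤ 1) (h2 : ‖(T : ℂ)‖ * ρ ≤ 1) (h3 : ‖(T : ℂ)⁻¹‖ * ρ ≤ 1) :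
    DifferentiableOn ℂ (factorFun N a T Z) (Metric.ball 0 ρ) := by
  have hs : Metric.ball (0 : ℂ) ρ ⊆ Metric.ball 0 1 := Metric.ball_subset_ball h1
  have hT0 : 0 < ‖(T : ℂ)‖ := norm_pos_iff.2 T.ne_zero
  have hT1 : 0 < ‖(T : ℂ)⁻¹‖ := norm_pos_iff.2 (inv_ne_zero T.ne_zero)
  have hp1 : ∀ p ∈ Metric.ball (0 : ℂ) ρ, ‖p‖ < 1 := fun p hp => by simpa using hs hp
  have hp2 : ∀ p ∈ Metric.ball (0 : ℂ) ρ, ‖(T : ℂ)‖ * ‖p‖ < 1 := fun p hp =>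
    (mul_lt_mul_of_pos_left (by simpa using hp) hT0).trans_le h2
  have hp3 : ∀ p ∈ Metric.ball (0 : ℂ) ρ, ‖(T : ℂ)⁻¹‖ * ‖p‖ < 1 := fun p hp =>
    (mul_lt_mul_of_pos_left (by simpa using hp) hT1).trans_le h3
  unfold factorFun
  refine DifferentiableOn.mul (DifferentiableOn.mul (DifferentiableOn.mul ?_
    ((differentiableOn_thetaFun h _ _).mono hs)) (((differentiableOn_thetaFun h _ _).mono hs).inv
      fun p hp => thetaFun_ne_zero h (hp1 p hp) (hp2 p hp) (hp3 p hp)))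
      (DifferentiableOn.inv (by fun_prop) fun p hp h0 => ?_)
  · fun_prop
  · by_cases ha : a = 0
    · subst ha; rw [pow_zero, mul_one, sub_eq_zero] at h0; exact hT rfl h0.symm
    · have e1 : (T : ℂ) * p ^ a = 1 := (sub_eq_zero.1 h0).symm
      have e2 : ‖(T : ℂ)‖ * ‖p‖ ^ a = 1 := by rw [← norm_pow, ← norm_mul, e1, norm_one]
      have e3 := mul_le_mul_of_nonneg_left
        (pow_le_of_le_one (norm_nonneg _) (hp1 p hp).le ha) hT0.le
      linarith [hp2 p hp]

theorem taylorAtZero_factorFun (h : a < N) (T Z : ℂˣ) (hT : a = 0 → (T : ℂ) ≠ 1) :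
    taylorAtZero (factorFun N a T Z) = factorSeries N a T Z := by
  have hth : ∀ x y, AnalyticAt ℂ (thetaFun N a x y) 0 := fun x y =>
    (differentiableOn_thetaFun h x y).analyticAt (Metric.ball_mem_nhds 0 zero_lt_one)
  have hth0 : thetaFun N a T (T : ℂ)⁻¹ 0 ≠ 0 := thetaFun_ne_zero h (by simp) (by simp) (by simp)
  have hpol : ∀ x : ℂ, AnalyticAt ℂ (fun p => 1 - x * p ^ a) 0 := fun x => by fun_prop
  have h0 : (fun p => 1 - (T : ℂ) * p ^ a) 0 ≠ 0 := by
    by_cases ha : a = 0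
    · simpa [ha, sub_eq_zero] using (hT ha).symm
    · simp [ha]
  rw [factorSeries_eq h, ← taylorAtZero_thetaFun h, ← taylorAtZero_thetaFun h,
    ← taylorAtZero_inv (hth _ _) hth0, ← taylorAtZero_one_sub_mul_pow,
    ← taylorAtZero_one_sub_mul_pow, ← taylorAtZero_inv (hpol _) h0, ← taylorAtZero_const,
    ← taylorAtZero_mul analyticAt_const (hpol _),
    ← taylorAtZero_mul (analyticAt_const.mul (hpol _)) (hth _ _),
    ← taylorAtZero_mul ((analyticAt_const.mul (hpol _)).mul (hth _ _)) ((hth _ _).inv hth0),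
    ← taylorAtZero_mul (((analyticAt_const.mul (hpol _)).mul (hth _ _)).mul ((hth _ _).inv hth0))
      ((hpol _).inv h0)]
  rfl

end Factor

/-! ### Expansions of the coefficients in powers of `T` -/

section Cumulative

variable {R : Type*} [CommRing R]

/-- The sum of the coefficients of a Laurent polynomial. -/
def totalCoeff (F : LaurentPolynomial R) : R := ∑ k ∈ F.coeff.support, F.coeff k

/-- The sum of the coefficients of the powers `T^k`, `k ≤ m`, of a Laurent polynomial. -/
def cumCoeff (F : LaurentPolynomial R) (m : ℤ) : R :=
  ∑ k ∈ F.coeff.support, if k ≤ m then F.coeff k else 0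

theorem eval₂_eq_sum (φ : R →+* ℂ) (T : ℂˣ) (F : LaurentPolynomial R) :
    LaurentPolynomial.eval₂ φ T F = ∑ k ∈ F.coeff.support, φ (F.coeff k) * (T : ℂ) ^ k := by
  have h : F = ∑ k ∈ F.coeff.support,
      LaurentPolynomial.C (F.coeff k) * LaurentPolynomial.T k := by
    simp_rw [← LaurentPolynomial.single_eq_C_mul_T]
    exact (AddMonoidAlgebra.sum_coeff_single F).symm
  conv_lhs => rw [h]
  rw [map_sum]
  simp

theorem hasSum_eval₂ (φ : R →+* ℂ) (T : ℂˣ) (F : LaurentPolynomial R) :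
    HasSum (fun m : ℤ => φ (F.coeff m) * (T : ℂ) ^ m) (LaurentPolynomial.eval₂ φ T F) := by
  rw [eval₂_eq_sum]
  refine hasSum_sum_of_ne_finset_zero fun m hm => ?_
  rw [Finsupp.notMem_support_iff.1 hm, map_zero, zero_mul]

theorem hasSum_zpow_ge {T : ℂ} (h0 : T ≠ 0) (hT : ‖T‖ < 1) (k : ℤ) :
    HasSum (fun m : ℤ => if k ≤ m then T ^ m else 0) (T ^ k * (1 - T)⁻¹) := by
  have h1 := (hasSum_geometric_of_norm_lt_one hT).mul_left (T ^ k)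
  have hi : Function.Injective fun n : ℕ => k + (n : ℤ) := fun a b h => by simpa using h
  rw [← hi.hasSum_iff]
  · refine h1.congr_fun fun n => ?_
    simp [zpow_add₀ h0]
  · intro m hm
    rw [if_neg]
    intro hkm
    exact hm ⟨(m - k).toNat, by simp; omega⟩

theorem hasSum_zpow_lt {T : ℂ} (hT : 1 < ‖T‖) (k : ℤ) :
    HasSum (fun m : ℤ => if k ≤ m then 0 else -T ^ m) (T ^ k * (1 - T)⁻¹) := by
  have h0 : T ≠ 0 := by rintro rfl; simp at hT; linarith
  have h2 : ‖T⁻¹‖ < 1 := by rw [norm_inv]; exact inv_lt_one_of_one_lt₀ hT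
  have h3 : T ≠ 1 := by rintro rfl; simp at hT
  have h1 := (hasSum_geometric_of_norm_lt_one h2).mul_left (-T ^ (k - 1))
  have e : -T ^ (k - 1) * (1 - T⁻¹)⁻¹ = T ^ k * (1 - T)⁻¹ := by
    have h4 : 1 - T ≠ 0 := sub_ne_zero.2 h3.symm
    have h5 : 1 - T⁻¹ = -(1 - T) * T⁻¹ := by field_simp; ring
    rw [h5, zpow_sub_one₀ h0]
    field_simp
  rw [e] at h1
  have hi : Function.Injective fun n : ℕ => k - 1 - (n : ℤ) := fun a b h => by simpa using h
  rw [← hi.hasSum_iff]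
  · refine h1.congr_fun fun n => ?_
    have : ¬ k ≤ k - 1 - (n : ℤ) := by omega
    simp only [Function.comp, if_neg this]
    rw [zpow_sub₀ h0 (k - 1), zpow_natCast, inv_pow]
    ring
  · intro m hm
    rw [if_pos]
    by_contra hkm
    exact hm ⟨(k - 1 - m).toNat, by simp; omega⟩

/-- Multiplying by the geometric series replaces coefficients by their partial sums. -/
theorem hasSum_cumCoeff_of_lt (φ : R →+* ℂ) (T : ℂˣ) (F : LaurentPolynomial R)
    (hT : ‖(T : ℂ)‖ < 1) :
    HasSum (fun m : ℤ => φ (cumCoeff F m) * (T : ℂ) ^ m)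
      (LaurentPolynomial.eval₂ φ T F * (1 - (T : ℂ))⁻¹) := by
  rw [eval₂_eq_sum, Finset.sum_mul]
  have h : HasSum (fun m : ℤ => ∑ k ∈ F.coeff.support,
      φ (F.coeff k) * (if k ≤ m then (T : ℂ) ^ m else 0)) _ := hasSum_sum fun k _ =>
    (hasSum_zpow_ge T.ne_zero hT k).mul_left (φ (F.coeff k))
  simp_rw [mul_assoc]
  refine h.congr_fun fun m => ?_
  rw [cumCoeff, map_sum, Finset.sum_mul]
  refine Finset.sum_congr rfl fun k _ => ?_
  split_ifs <;> simp

/-- Compared with the expansion for `|T| < 1`, every coefficient drops by the same amount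
`totalCoeff F`, whatever the exponent `m`. This uniform jump is what allows completeness to be
applied later. -/
theorem hasSum_cumCoeff_of_gt (φ : R →+* ℂ) (T : ℂˣ) (F : LaurentPolynomial R)
    (hT : 1 < ‖(T : ℂ)‖) :
    HasSum (fun m : ℤ => φ (cumCoeff F m - totalCoeff F) * (T : ℂ) ^ m)
      (LaurentPolynomial.eval₂ φ T F * (1 - (T : ℂ))⁻¹) := by
  rw [eval₂_eq_sum, Finset.sum_mul]
  have h : HasSum (fun m : ℤ => ∑ k ∈ F.coeff.support,
      φ (F.coeff k) * (if k ≤ m then 0 else -(T : ℂ) ^ m)) _ := hasSum_sum fun k _ =>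
    (hasSum_zpow_lt hT k).mul_left (φ (F.coeff k))
  simp_rw [mul_assoc]
  refine h.congr_fun fun m => ?_
  rw [cumCoeff, totalCoeff, ← Finset.sum_sub_distrib, map_sum, Finset.sum_mul]
  refine Finset.sum_congr rfl fun k _ => ?_
  split_ifs <;> simp

theorem exists_bound_coeff (F : LaurentPolynomial R) : ∃ M : ℕ, ∀ m : ℤ,
    (m < -M → F.coeff m = 0 ∧ cumCoeff F m = 0) ∧
    (M < m → F.coeff m = 0 ∧ cumCoeff F m = totalCoeff F) := by
  refine ⟨F.coeff.support.sup Int.natAbs, fun m => ?_⟩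
  have key : ∀ k ∈ F.coeff.support, k.natAbs ≤ F.coeff.support.sup Int.natAbs := fun k hk =>
    Finset.le_sup (f := Int.natAbs) hk
  refine ⟨fun hm => ⟨?_, ?_⟩, fun hm => ⟨?_, ?_⟩⟩
  · by_contra h
    have := key m (Finsupp.mem_support_iff.2 h)
    omega
  · refine Finset.sum_eq_zero fun k hk => if_neg ?_
    have := key k hk
    omega
  · by_contra h
    have := key m (Finsupp.mem_support_iff.2 h)
    omega
  · refine Finset.sum_congr rfl fun k hk => if_pos ?_
    have := key k hk
    omega

end Cumulative

/-- The coefficient of `T^m` in the expansion of `factorSeries N a` for `|T| > 1`. -/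
def coefSeries (N a : ℕ) (m : ℤ) : PowerSeries (LaurentPolynomial ℤ) :=
  PowerSeries.mk fun s =>
    if a = 0 then
      cumCoeff (PowerSeries.coeff s (charSeries N a)) m
        - totalCoeff (PowerSeries.coeff s (charSeries N a))
    else (PowerSeries.coeff s (charSeries N a)).coeff m

/-- The residue of `factorSeries N a` at `T = 1`: the difference of the coefficients of `T^m` in
the expansions for `|T| < 1` and for `|T| > 1`. -/
def resSeries (N a : ℕ) : PowerSeries (LaurentPolynomial ℤ) :=
  PowerSeries.mk fun s => if a = 0 then totalCoeff (PowerSeries.coeff s (charSeries N a)) else 0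

theorem resSeries_of_ne_zero {N a : ℕ} (h : a ≠ 0) : resSeries N a = 0 := by
  ext1 s; simp [resSeries, h]

/-- The coefficient of `T^m` in the expansion of `factorSeries N a` for `|T| < 1` if `P` holds,
and for `|T| > 1` otherwise. -/
def branchSeries (N a : ℕ) (P : Prop) [Decidable P] (m : ℤ) : PowerSeries (LaurentPolynomial ℤ) :=
  coefSeries N a m + if P then resSeries N a else 0

theorem coeff_factorSeries (N a : ℕ) (T Z : ℂˣ) (s : ℕ) :
    PowerSeries.coeff s (factorSeries N a T Z) =
      evalBi T Z (PowerSeries.coeff s (charSeries N a)) * if a = 0 then (1 - (T : ℂ))⁻¹ else 1 := by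
  rw [factorSeries]
  split_ifs with h
  · rw [PowerSeries.coeff_mul_C, PowerSeries.coeff_map]
  · rw [mul_one, mul_one, PowerSeries.coeff_map]

theorem hasSum_branchSeries (N a : ℕ) (T Z : ℂˣ) (P : Prop) [Decidable P]
    (h1 : P → ‖(T : ℂ)‖ < 1) (h2 : ¬ P → 1 < ‖(T : ℂ)‖) (s : ℕ) :
    HasSum (fun m : ℤ => evalLaurent Z (PowerSeries.coeff s (branchSeries N a P m)) * (T : ℂ) ^ m)
      (PowerSeries.coeff s (factorSeries N a T Z)) := by
  rw [coeff_factorSeries]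
  by_cases ha : a = 0
  · simp only [branchSeries, coefSeries, resSeries, ha, if_true]
    by_cases hP : P
    · simpa [hP, evalBi] using hasSum_cumCoeff_of_lt (evalLaurent Z) T _ (h1 hP)
    · simpa [hP, evalBi] using hasSum_cumCoeff_of_gt (evalLaurent Z) T _ (h2 hP)
  · simp only [branchSeries, coefSeries, resSeries_of_ne_zero ha, ha, if_false, mul_one]
    simpa [evalBi] using hasSum_eval₂ (evalLaurent Z) T _

/-- Each expansion is one-sided: bounded below in `m` on the branch `|T| < 1`, bounded above on the
branch `|T| > 1`, and finite when there is no pole. One bound serves all orders up to `s`. -/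
theorem exists_bound_branchSeries (N a s : ℕ) : ∃ M : ℕ, ∀ l ≤ s, ∀ (m : ℤ) (P : Prop)
    [Decidable P], PowerSeries.coeff l (branchSeries N a P m) ≠ 0 →
      (P → -M ≤ m) ∧ (¬ P → m ≤ M) ∧ (a ≠ 0 → |m| ≤ M) := by
  choose M hM using fun l => exists_bound_coeff (PowerSeries.coeff l (charSeries N a))
  refine ⟨(Finset.range (s + 1)).sup M, fun l hl m P _ h => ?_⟩
  have hle : M l ≤ (Finset.range (s + 1)).sup M :=
    Finset.le_sup (f := M) (Finset.mem_range.2 (by omega))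
  have hl1 : ¬ m < -(M l) ∨ ¬ P ∧ a = 0 := by
    by_contra hc
    push Not at hc
    obtain ⟨hm, hP⟩ := hc
    obtain ⟨e1, e2⟩ := (hM l m).1 hm
    apply h
    by_cases ha : a = 0
    · have hP' : P := by by_contra hn; exact hP hn ha
      simp only [branchSeries, coefSeries, resSeries, ha, if_true, hP', map_add,
        PowerSeries.coeff_mk] at e2 ⊢
      rw [e2]; ring
    · simp [branchSeries, coefSeries, resSeries_of_ne_zero ha, ha, e1]
  have hl2 : ¬ M l < m ∨ P ∧ a = 0 := by
    by_contra hc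
    push Not at hc
    obtain ⟨hm, hP⟩ := hc
    obtain ⟨e1, e2⟩ := (hM l m).2 hm
    apply h
    by_cases ha : a = 0
    · have hP' : ¬ P := fun hn => hP hn ha
      simp only [branchSeries, coefSeries, ha, if_true, hP', if_false, add_zero,
        PowerSeries.coeff_mk] at e2 ⊢
      rw [e2]; ring
    · simp [branchSeries, coefSeries, resSeries_of_ne_zero ha, ha, e1]
  refine ⟨fun hP => ?_, fun hP => ?_, fun ha => ?_⟩
  · have := hl1.resolve_right fun h => h.1 hP
    omega
  · have := hl2.resolve_right fun h => hP h.1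
    omega
  · have h3 := hl1.resolve_right fun h => ha h.2
    have h4 := hl2.resolve_right fun h => ha h.2
    rw [abs_le]; omega

theorem expUnit_val (w : ℂ) : (expUnit w : ℂ) = expTwoPiI w := rfl

theorem continuous_expTwoPiI : Continuous expTwoPiI := by unfold expTwoPiI; fun_prop

theorem continuousAt_coeff_factorSeries (N a s : ℕ) (Z : ℂˣ) (w : ℂ)
    (hw : a = 0 → expTwoPiI w ≠ 1) :
    ContinuousAt (fun w => PowerSeries.coeff s (factorSeries N a (expUnit w) Z)) w := by
  simp_rw [coeff_factorSeries, evalBi, eval₂_eq_sum, expUnit_val]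
  have h1 : Continuous fun w => ∑ k ∈ (PowerSeries.coeff s (charSeries N a)).coeff.support,
      evalLaurent Z ((PowerSeries.coeff s (charSeries N a)).coeff k) * expTwoPiI w ^ k :=
    continuous_finsetSum _ fun k _ => continuous_const.mul
      (continuous_expTwoPiI.zpow₀ k fun w => Or.inl (Complex.exp_ne_zero _))
  refine h1.continuousAt.mul ?_
  split_ifs with ha
  · exact (continuousAt_const.sub continuous_expTwoPiI.continuousAt).inv₀
      (sub_ne_zero.2 (hw ha).symm)
  · exact continuousAt_const

/-! ### The function `φ` as a quotient of theta products -/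

theorem expTwoPiI_add (x y : ℂ) : expTwoPiI (x + y) = expTwoPiI x * expTwoPiI y := by
  rw [expTwoPiI, expTwoPiI, expTwoPiI, ← Complex.exp_add]; congr 1; ring

theorem expTwoPiI_zero : expTwoPiI 0 = 1 := by simp [expTwoPiI]

theorem expTwoPiI_ne_zero (x : ℂ) : expTwoPiI x ≠ 0 := Complex.exp_ne_zero _

theorem expTwoPiI_neg (x : ℂ) : expTwoPiI (-x) = (expTwoPiI x)⁻¹ := by
  refine eq_inv_of_mul_eq_one_left ?_
  rw [← expTwoPiI_add, neg_add_cancel, expTwoPiI_zero]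

theorem expTwoPiI_nat_mul (n : ℕ) (x : ℂ) : expTwoPiI (n * x) = expTwoPiI x ^ n := by
  rw [expTwoPiI, expTwoPiI, ← Complex.exp_nat_mul]; congr 1; ring

theorem expTwoPiI_int_mul (n : ℤ) (x : ℂ) : expTwoPiI (n * x) = expTwoPiI x ^ n := by
  rw [expTwoPiI, expTwoPiI, ← Complex.exp_int_mul]; congr 1; ring

theorem norm_expTwoPiI (x : ℂ) : ‖expTwoPiI x‖ = Real.exp (-(2 * Real.pi * x.im)) := by
  rw [expTwoPiI, Complex.norm_exp]
  congr 1
  simp [Complex.mul_re, Complex.mul_im]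

theorem norm_expTwoPiI_lt_one {x : ℂ} (hx : 0 < x.im) : ‖expTwoPiI x‖ < 1 := by
  rw [norm_expTwoPiI, Real.exp_lt_one_iff]
  have := Real.pi_pos
  have : 0 < 2 * Real.pi * x.im := by positivity
  linarith

theorem expTwoPiI_eq_one_iff {x : ℂ} : expTwoPiI x = 1 ↔ ∃ n : ℤ, x = n := by
  rw [expTwoPiI, Complex.exp_eq_one_iff]
  have h : (2 * Real.pi * Complex.I : ℂ) ≠ 0 := Complex.two_pi_I_ne_zero
  refine exists_congr fun n => ⟨fun hn => ?_, fun hn => ?_⟩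
  · apply mul_left_cancel₀ h; rw [hn]; ring
  · rw [hn]; ring

/-- `(1 - x) ∏_{k ≥ 1} (1 - x q^k) (1 - x⁻¹ q^k)`. -/
def thetaProduct (q x : ℂ) : ℂ := (1 - x) * (powProdFun 1 1 x q * powProdFun 1 1 x⁻¹ q)

theorem powProdFun_eq_mul {q : ℂ} (hq : ‖q‖ < 1) (x : ℂ) :
    powProdFun 1 1 x q = (1 - x * q) * powProdFun 1 1 (x * q) q := by
  have e : ∀ k : ℕ, 1 - x * q ^ (1 + 1 * (k + 1)) = 1 - x * q * q ^ (1 + 1 * k) := fun k => by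
    ring
  have h := tprod_eq_zero_mul' (f := fun k : ℕ => 1 - x * q ^ (1 + 1 * k)) (by
    simp_rw [e]; exact multipliable_powProd one_pos 1 (x * q) hq)
  simp_rw [e] at h
  rw [powProdFun, h, powProdFun]
  simp

/-- Replacing `x` by `x q` shifts the two products by one index in opposite directions; the boundary
factors left over combine to `-x⁻¹`. -/
theorem thetaProduct_mul {q : ℂ} (hq : ‖q‖ < 1) (hq0 : q ≠ 0) {x : ℂ} (hx : x ≠ 0) :
    thetaProduct q (x * q) = -x⁻¹ * thetaProduct q x := by
  have h1 := powProdFun_eq_mul hq x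
  have h2 := powProdFun_eq_mul hq (x * q)⁻¹
  have h3 : (x * q)⁻¹ * q = x⁻¹ := by field_simp
  rw [h3] at h2
  rw [thetaProduct, thetaProduct, h1, h2]
  field_simp
  ring

theorem jacobiPhi_eq {τ : ℂ} (hτ : 0 < τ.im) (u : ℂ) :
    jacobiPhi u τ = -expTwoPiI (-u / 2) * thetaProduct (expTwoPiI τ) (expTwoPiI u) /
      powProdFun 1 1 1 (expTwoPiI τ) ^ 2 := by
  set q := expTwoPiI τ with hq
  have hq1 : ‖q‖ < 1 := norm_expTwoPiI_lt_one hτ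
  have hm : ∀ x, Multipliable fun k : ℕ => 1 - x * q ^ (1 + 1 * k) := fun x =>
    multipliable_powProd one_pos 1 x hq1
  have h1 : powProdFun 1 1 1 q ≠ 0 := powProdFun_ne_zero one_pos 1 hq1 (by simpa using hq1)
  have hm2 := (hm 1).mul (hm 1)
  have hp2 : ∏' k : ℕ, (1 - 1 * q ^ (1 + 1 * k)) * (1 - 1 * q ^ (1 + 1 * k))
      = powProdFun 1 1 1 q * powProdFun 1 1 1 q := (hm 1).tprod_mul (hm 1)
  have key : ∏' k : ℕ, (1 - expTwoPiI u * q ^ (k + 1)) *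
      (1 - (expTwoPiI u)⁻¹ * q ^ (k + 1)) / (1 - q ^ (k + 1)) ^ 2 =
      powProdFun 1 1 (expTwoPiI u) q * powProdFun 1 1 (expTwoPiI u)⁻¹ q /
        powProdFun 1 1 1 q ^ 2 := by
    have hd := ((hm (expTwoPiI u)).mul (hm (expTwoPiI u)⁻¹)).hasProd.div₀ hm2.hasProd
      (by rw [hp2]; exact mul_ne_zero h1 h1)
    rw [hp2, (hm _).tprod_mul (hm _)] at hd
    rw [pow_two]
    refine Eq.trans (tprod_congr fun k => ?_) hd.tprod_eq
    rw [one_mul, one_mul, add_comm 1 k, pow_two]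
  rw [jacobiPhi, key, thetaProduct]
  have e : expTwoPiI (u / 2) = expTwoPiI (-u / 2) * expTwoPiI u := by
    rw [← expTwoPiI_add]; congr 1; ring
  rw [e]
  ring

/-- The square roots of `t` cancel in the quotient and the remaining half power of `ζ` is absorbed
on the left; this is the origin of the normalisation by `ζ^{n/2}`. -/
theorem phiQuot_eq {τ : ℂ} (hτ : 0 < τ.im) (u σ : ℂ) :
    expTwoPiI (σ / 2) * phiQuot u τ σ =
      thetaProduct (expTwoPiI τ) (expTwoPiI u * expTwoPiI σ) /
        thetaProduct (expTwoPiI τ) (expTwoPiI u) := by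
  have hq1 : ‖expTwoPiI τ‖ < 1 := norm_expTwoPiI_lt_one hτ
  have h1 : powProdFun 1 1 1 (expTwoPiI τ) ≠ 0 :=
    powProdFun_ne_zero one_pos 1 hq1 (by simpa using hq1)
  have e : expTwoPiI (-(u + σ) / 2) = expTwoPiI (-u / 2) * (expTwoPiI (σ / 2))⁻¹ := by
    rw [← expTwoPiI_neg, ← expTwoPiI_add]; congr 1; ring
  rw [phiQuot, jacobiPhi_eq hτ, jacobiPhi_eq hτ, expTwoPiI_add, e]
  have h2 := expTwoPiI_ne_zero (σ / 2)
  have h3 := expTwoPiI_ne_zero (-u / 2)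
  generalize expTwoPiI (-u / 2) = A at h3
  generalize expTwoPiI (σ / 2) = D at h2
  field_simp

/-- A shift by `q` multiplies numerator and denominator by `-(x y)⁻¹` and `-x⁻¹`, so the quotient
changes by `y⁻¹`, which the prefactor compensates. With `y = ζ` this makes the twisted factors
depend on the exponent only modulo integers. -/
theorem thetaProduct_div_mul_zpow {q : ℂ} (hq : ‖q‖ < 1) (hq0 : q ≠ 0) {x y : ℂ} (hx : x ≠ 0)
    (hy : y ≠ 0) (k : ℤ) :
    y ^ k * (thetaProduct q (x * q ^ k * y) / thetaProduct q (x * q ^ k)) =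
      thetaProduct q (x * y) / thetaProduct q x := by
  have step : ∀ x : ℂ, x ≠ 0 → y * (thetaProduct q (x * q * y) / thetaProduct q (x * q)) =
      thetaProduct q (x * y) / thetaProduct q x := fun x hx => by
    rw [mul_right_comm x q y, thetaProduct_mul hq hq0 (mul_ne_zero hx hy),
      thetaProduct_mul hq hq0 hx]
    field_simp
  have step' : ∀ k : ℤ, y ^ (k + 1) *
      (thetaProduct q (x * q ^ (k + 1) * y) / thetaProduct q (x * q ^ (k + 1))) =
      y ^ k * (thetaProduct q (x * q ^ k * y) / thetaProduct q (x * q ^ k)) := fun k => by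
    rw [← step (x * q ^ k) (mul_ne_zero hx (zpow_ne_zero k hq0)), zpow_add_one₀ hq0,
      zpow_add_one₀ hy]
    simp only [mul_assoc]
  induction k using Int.induction_on with
  | zero => simp
  | succ k ih => rw [step', ih]
  | pred k ih =>
    have := step' (-k - 1)
    rw [sub_add_cancel] at this
    rw [← this, ih]

/-- Write `x = a / N + k`: the integral part `k` disappears by quasi-periodicity, and the fractional
part turns `q ^ x` and `ζ ^ x` into the `a`-th powers of `e(τ/N)` and `e(σ/N)`. -/
theorem phiQuot_eq_factorFun {N a : ℕ} (ha : a < N) {τ : ℂ} (hτ : 0 < τ.im) (w σ x : ℂ) (k : ℤ)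
    (hx : N * x = a + N * k) :
    expTwoPiI (σ / 2) * (expTwoPiI (x * σ) * phiQuot (w + τ * x) τ σ) =
      factorFun N a (expUnit w) (expUnit (σ / N)) (expTwoPiI (τ / N)) := by
  have hN : (N : ℂ) ≠ 0 := Nat.cast_ne_zero.2 (by omega)
  set p := expTwoPiI (τ / N) with hp
  have hp0 : p ≠ 0 := expTwoPiI_ne_zero _
  have hτN : 0 < (τ / N).im := by
    rw [← Complex.ofReal_natCast, Complex.div_ofReal_im]
    exact div_pos hτ (Nat.cast_pos.2 (by omega))
  have hp1 : ‖p‖ < 1 := norm_expTwoPiI_lt_one hτN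
  have hq : expTwoPiI τ = p ^ N := by
    rw [hp, ← expTwoPiI_nat_mul]; congr 1; field_simp
  have hx' : x = a / N + k := by field_simp; linear_combination hx
  have e1 : expTwoPiI (w + τ * x) = expTwoPiI w * p ^ a * expTwoPiI τ ^ k := by
    rw [hp, ← expTwoPiI_nat_mul, ← expTwoPiI_int_mul, ← expTwoPiI_add, ← expTwoPiI_add, hx']
    congr 1; ring
  have e2 : expTwoPiI (x * σ) = expTwoPiI (σ / N) ^ a * expTwoPiI σ ^ k := by
    rw [← expTwoPiI_nat_mul, ← expTwoPiI_int_mul, ← expTwoPiI_add, hx']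
    congr 1; ring
  have e3 : expTwoPiI σ = expTwoPiI (σ / N) ^ N := by
    rw [← expTwoPiI_nat_mul]; congr 1; field_simp
  rw [mul_left_comm, phiQuot_eq hτ, e1, e2, mul_assoc, thetaProduct_div_mul_zpow
    (norm_expTwoPiI_lt_one hτ) (expTwoPiI_ne_zero _)
    (mul_ne_zero (expTwoPiI_ne_zero _) (pow_ne_zero _ hp0)) (expTwoPiI_ne_zero _)]
  have key : ∀ y : ℂ, y ≠ 0 → thetaProduct (p ^ N) (y * p ^ a) =
      (1 - y * p ^ a) * thetaFun N a y y⁻¹ p := fun y hy => by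
    rw [thetaProduct, thetaFun]
    congr 2
    · refine tprod_congr fun k => ?_
      rw [← pow_mul, mul_assoc, ← pow_add]; congr 3; ring
    · refine tprod_congr fun k => ?_
      rw [← pow_mul, mul_inv, mul_assoc]
      congr 2
      rw [inv_mul_eq_div, div_eq_iff (pow_ne_zero _ hp0), ← pow_add]
      congr 1
      have : N * (1 + 1 * k) = N + N * k := by ring
      omega
  have hw := expTwoPiI_ne_zero w
  rw [hq, mul_right_comm, key _ (mul_ne_zero hw (expTwoPiI_ne_zero σ)), key _ hw, factorFun, e3,
    expUnit_val, expUnit_val]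
  generalize expTwoPiI (σ / N) = Z
  rw [div_eq_mul_inv, mul_inv (1 - expTwoPiI w * p ^ a)]
  ring

/-! ### The degree of a complete multi-fan -/

/-- A vector can be moved off finitely many proper subspaces without changing the signs of finitely
many linear functionals. -/
theorem exists_avoiding_subspaces {E ι κ : Type*} [AddCommGroup E] [Module ℝ E] [Finite ι]
    (f : ι → E →ₗ[ℝ] ℝ) {x : E} (hx : ∀ i, f i x ≠ 0) (S : Finset κ) (W : κ → Submodule ℝ E)
    (hW : ∀ k ∈ S, W k ≠ ⊤) :
    ∃ y : E, (∀ i, 0 < f i x ↔ 0 < f i y) ∧ ∀ k ∈ S, y ∉ W k := by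
  classical
  obtain ⟨d, hd⟩ : ∃ d : E, ∀ k ∈ S, d ∉ W k := by
    have h := Subspace.biUnion_ne_univ_of_top_notMem (s := S.image W) (by
      intro h
      obtain ⟨k, hk, hk'⟩ := Finset.mem_image.1 h
      exact hW k hk hk')
    obtain ⟨d, hd⟩ := (Set.ne_univ_iff_exists_notMem _).1 h
    refine ⟨d, fun k hk hdk => hd ?_⟩
    simp only [Set.mem_iUnion]
    exact ⟨W k, Finset.mem_image_of_mem W hk, hdk⟩
  have h1 : ∀ i, ∀ᶠ ε : ℝ in nhdsWithin 0 (Set.Ioi 0), (0 < f i x ↔ 0 < f i (x + ε • d)) := by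
    intro i
    have hc : Continuous fun ε : ℝ => f i (x + ε • d) := by
      simp only [map_add, map_smul, smul_eq_mul]; fun_prop
    have ht : Filter.Tendsto (fun ε : ℝ => f i (x + ε • d)) (nhdsWithin 0 (Set.Ioi 0))
        (nhds (f i x)) := by
      have := (hc.tendsto 0).mono_left (nhdsWithin_le_nhds (s := Set.Ioi 0))
      simpa using this
    rcases lt_or_gt_of_ne (hx i) with h | h
    · filter_upwards [ht.eventually (gt_mem_nhds h)] with ε hε
      exact ⟨fun h' => absurd h' h.not_gt, fun h' => absurd h' hε.not_gt⟩
    · filter_upwards [ht.eventually (lt_mem_nhds h)] with ε hε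
      exact ⟨fun _ => hε, fun _ => h⟩
  have h2 : ∀ k ∈ S, ∀ᶠ ε : ℝ in nhdsWithin 0 (Set.Ioi 0), x + ε • d ∉ W k := by
    intro k hk
    -- A line whose direction `d` lies outside `W k` meets `W k` in at most one point.
    by_cases hex : ∃ ε₀ : ℝ, x + ε₀ • d ∈ W k
    · obtain ⟨ε₀, h0⟩ := hex
      have hne : ∀ᶠ ε : ℝ in nhdsWithin 0 (Set.Ioi 0), ε ≠ ε₀ := by
        by_cases he : ε₀ = 0
        · filter_upwards [self_mem_nhdsWithin] with ε hε
          rw [he]; exact (Set.mem_Ioi.1 hε).ne'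
        · exact nhdsWithin_le_nhds (isOpen_ne.mem_nhds (Ne.symm he))
      filter_upwards [hne] with ε hε hmem
      have h3 : (ε - ε₀) • d ∈ W k := by
        have := (W k).sub_mem hmem h0
        rwa [add_sub_add_left_eq_sub, ← sub_smul] at this
      exact hd k hk (((W k).smul_mem_iff (sub_ne_zero.2 hε)).1 h3)
    · push Not at hex
      exact Filter.Eventually.of_forall hex
  obtain ⟨ε, hε1, hε2⟩ := ((Filter.eventually_all.2 h1).and
    ((Filter.eventually_all_finset S).2 h2)).exists
  exact ⟨x + ε • d, hε1, hε2⟩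

namespace GeneratingVectors

variable {V L : Type*} [AddCommGroup L] {Δ : SimplicialMultiFan V L} (𝒱 : GeneratingVectors Δ)

theorem cone_eq {J : Finset V} (hJ : J ∈ Δ.faces) :
    Δ.cone J = PointedCone.hull ℝ ((fun i => latticeVec (𝒱.vec i)) '' (J : Set V)) := by
  obtain ⟨b, -, hb⟩ := Δ.cone_simplicial J hJ
  have h1 : ∀ i ∈ J, PointedCone.hull ℝ {latticeVec (b i)}
      = PointedCone.hull ℝ {latticeVec (𝒱.vec i)} := fun i hi => by
    rw [← 𝒱.generates i, hb {i} (by simpa using hi)]; simp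
  rw [hb J subset_rfl]
  apply le_antisymm
  · refine Submodule.span_le.2 ?_
    rintro _ ⟨i, hi, rfl⟩
    have h2 : latticeVec (b i) ∈ PointedCone.hull ℝ {latticeVec (𝒱.vec i)} := by
      rw [← h1 i hi]; exact Submodule.subset_span rfl
    exact Submodule.span_mono (Set.singleton_subset_iff.2 (Set.mem_image_of_mem _ hi)) h2
  · refine Submodule.span_le.2 ?_
    rintro _ ⟨i, hi, rfl⟩
    have h2 : latticeVec (𝒱.vec i) ∈ PointedCone.hull ℝ {latticeVec (b i)} := by
      rw [h1 i hi]; exact Submodule.subset_span rfl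
    exact Submodule.span_mono (Set.singleton_subset_iff.2 (Set.mem_image_of_mem _ hi)) h2

theorem coneSpan_eq {J : Finset V} (hJ : J ∈ Δ.faces) :
    Δ.coneSpan J = Submodule.span ℝ ((fun i => latticeVec (𝒱.vec i)) '' (J : Set V)) := by
  rw [SimplicialMultiFan.coneSpan, 𝒱.cone_eq hJ]
  apply le_antisymm
  · have h : PointedCone.hull ℝ ((fun i => latticeVec (𝒱.vec i)) '' (J : Set V)) ≤
        (Submodule.span ℝ ((fun i => latticeVec (𝒱.vec i)) '' (J : Set V))).restrictScalars
          {r : ℝ // 0 ≤ r} := Submodule.span_le.2 Submodule.subset_span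
    exact Submodule.span_le.2 fun x hx => h hx
  · exact Submodule.span_mono Submodule.subset_span

theorem top_mem_faces (I : Δ.topFaces) : I.1 ∈ Δ.faces := (Finset.mem_filter.1 I.2).1

theorem top_card (I : Δ.topFaces) : I.1.card = Module.finrank ℤ L := (Finset.mem_filter.1 I.2).2

theorem isGenericFor_mkQ (𝒱 : GeneratingVectors Δ) {K : Finset V} {x : RealExt L}
    (hx : ∀ J ∈ Δ.faces, J.card < Module.finrank ℤ L → x ∉ Δ.coneSpan J)
    (hKf : K ∈ Δ.faces) :
    Δ.IsGenericFor K ((Δ.coneSpan K).mkQ x) := by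
  intro J hJ hKJ hc hmem
  apply hx J hJ hc
  have h1 : Submodule.span ℝ (Δ.projCone K J : Set (Δ.ProjSpace K)) =
      (Δ.coneSpan J).map (Δ.coneSpan K).mkQ := by
    change _ = Submodule.map _ (Submodule.span ℝ (Δ.cone J : Set (RealExt L)))
    rw [Submodule.map_span]
    rfl
  rw [h1] at hmem
  obtain ⟨y, hy, hyx⟩ := hmem
  have h2 : y - x ∈ Δ.coneSpan K := by
    rw [← Submodule.ker_mkQ (Δ.coneSpan K), LinearMap.mem_ker, map_sub, sub_eq_zero]
    exact hyx
  have h3 : Δ.coneSpan K ≤ Δ.coneSpan J := by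
    rw [𝒱.coneSpan_eq hJ, 𝒱.coneSpan_eq hKf]
    exact Submodule.span_mono (Set.image_mono (by exact_mod_cast hKJ))
  have := (Δ.coneSpan J).sub_mem hy (h3 h2)
  rwa [sub_sub_cancel] at this

variable [Module.Free ℤ L] [Module.Finite ℤ L]

theorem coneSpan_ne_top (𝒱 : GeneratingVectors Δ) {J : Finset V} (hJ : J ∈ Δ.faces) (hc : J.card < Module.finrank ℤ L) :
    Δ.coneSpan J ≠ ⊤ := by
  classical
  intro h
  rw [𝒱.coneSpan_eq hJ] at h
  have h1 := finrank_span_finset_le_card (R := ℝ) (J.image fun i => latticeVec (𝒱.vec i))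
  rw [Finset.coe_image] at h1
  rw [Set.finrank, h, finrank_top, Module.finrank_baseChange] at h1
  exact absurd (h1.trans Finset.card_image_le) hc.not_ge

theorem basis_apply (I : Δ.topFaces) (i : I.1) : 𝒱.basis I i = latticeVec (𝒱.vec i) := by
  simp [basis]

/-- Modulo the span of `C(K)` the coordinates with index in `K` are arbitrary, so only the signs of
the others are constrained. -/
theorem mkQ_mem_projCone (I : Δ.topFaces) {K : Finset V} (hK : K ⊆ I.1) (x : RealExt L) :
    (Δ.coneSpan K).mkQ x ∈ Δ.projCone K I.1 ↔
      ∀ i : I.1, i.1 ∉ K → 0 ≤ (𝒱.basis I).coord i x := by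
  classical
  have hKf : K ∈ Δ.faces := Δ.down_closed _ (top_mem_faces I) _ hK
  rw [SimplicialMultiFan.projCone, PointedCone.mem_map]
  constructor
  · rintro ⟨c, hc, hcx⟩ i hi
    have h1 : c - x ∈ Δ.coneSpan K := by
      rw [← Submodule.ker_mkQ (Δ.coneSpan K), LinearMap.mem_ker, map_sub, sub_eq_zero]
      exact hcx
    have h2 : (𝒱.basis I).coord i (c - x) = 0 := by
      rw [𝒱.coneSpan_eq hKf] at h1
      have hle : Submodule.span ℝ ((fun i => latticeVec (𝒱.vec i)) '' (K : Set V)) ≤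
          LinearMap.ker ((𝒱.basis I).coord i) := by
        refine Submodule.span_le.2 ?_
        rintro _ ⟨j, hj, rfl⟩
        have hji : (⟨j, hK hj⟩ : I.1) ≠ i := fun h => hi (by rw [← h]; exact hj)
        have : latticeVec (𝒱.vec j) = 𝒱.basis I ⟨j, hK hj⟩ := (𝒱.basis_apply I ⟨j, hK hj⟩).symm
        simp only [SetLike.mem_coe, LinearMap.mem_ker]
        rw [this, Module.Basis.coord_apply, Module.Basis.repr_self, Finsupp.single_eq_of_ne hji.symm]
      exact hle h1
    have h3 : 0 ≤ (𝒱.basis I).coord i c := by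
      rw [𝒱.cone_eq (top_mem_faces I)] at hc
      clear hcx h1 h2
      induction hc using Submodule.span_induction with
      | mem y hy =>
        obtain ⟨j, hj, rfl⟩ := hy
        have : latticeVec (𝒱.vec j) = 𝒱.basis I ⟨j, hj⟩ := (𝒱.basis_apply I ⟨j, hj⟩).symm
        simp only
        rw [this, Module.Basis.coord_apply, Module.Basis.repr_self, Finsupp.single_apply]
        split_ifs <;> norm_num
      | zero => simp
      | add y z _ _ hy hz => rw [map_add]; exact add_nonneg hy hz
      | smul r y _ hy =>
        have : r • y = (r : ℝ) • y := rfl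
        rw [this, map_smul]
        exact mul_nonneg r.2 hy
    rw [map_sub] at h2
    linarith
  · intro h
    -- The lift into the cone keeps the coordinates outside `K` and sets those in `K` to zero.
    refine ⟨∑ i : I.1, (if i.1 ∈ K then 0 else (𝒱.basis I).coord i x) • latticeVec (𝒱.vec i),
      ?_, ?_⟩
    · rw [𝒱.cone_eq (top_mem_faces I)]
      refine Submodule.sum_mem _ fun i _ => ?_
      have h0 : 0 ≤ if i.1 ∈ K then 0 else (𝒱.basis I).coord i x := by
        split_ifs with hi
        · exact le_rfl
        · exact h i hi
      exact Submodule.smul_mem _ (⟨_, h0⟩ : {r : ℝ // 0 ≤ r})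
        (Submodule.subset_span ⟨i.1, i.2, rfl⟩)
    · rw [← sub_eq_zero]
      change (Δ.coneSpan K).mkQ _ - (Δ.coneSpan K).mkQ x = 0
      rw [← map_sub, ← LinearMap.mem_ker, Submodule.ker_mkQ, 𝒱.coneSpan_eq hKf]
      have hx : x = ∑ i : I.1, (𝒱.basis I).coord i x • latticeVec (𝒱.vec i) := by
        conv_lhs => rw [← (𝒱.basis I).sum_repr x]
        simp_rw [basis_apply]
        rfl
      nth_rewrite 2 [hx]
      rw [← Finset.sum_sub_distrib]
      refine Submodule.sum_mem _ fun i _ => ?_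
      rw [← sub_smul]
      split_ifs with hi
      · exact Submodule.smul_mem _ _ (Submodule.subset_span ⟨i.1, hi, rfl⟩)
      · rw [sub_self, zero_smul]; exact Submodule.zero_mem _

open Classical in
/-- The sum of the `w(I)` over the `I ∈ Σ^(n)` with `K ⊆ I` for which all the coordinates of `x`
outside `K` with respect to `{v_i}_{i ∈ I}` are positive. -/
def starDegree (K : Finset V) (x : RealExt L) : ℤ :=
  ∑ I : Δ.topFaces,
    if K ⊆ I.1 ∧ ∀ i : I.1, i.1 ∉ K → 0 < (𝒱.basis I).coord i x then Δ.w I.1 else 0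

theorem degreeAt_eq_starDegree (K : Finset V) {x : RealExt L}
    (hx : ∀ (I : Δ.topFaces) (i : I.1), (𝒱.basis I).coord i x ≠ 0) :
    Δ.degreeAt K ((Δ.coneSpan K).mkQ x) = 𝒱.starDegree K x := by
  classical
  rw [SimplicialMultiFan.degreeAt, starDegree, Finset.sum_filter, ← Finset.sum_coe_sort]
  refine Finset.sum_congr rfl fun I _ => if_congr ?_ rfl rfl
  refine and_congr_right fun hK => ?_
  rw [𝒱.mkQ_mem_projCone I hK]
  exact forall₂_congr fun i _ => ⟨fun h => h.lt_of_ne (hx I i).symm, fun h => h.le⟩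

/-- This is where completeness enters. Nonzero coordinates with respect to the top simplices do not
exclude the spans of simplices lying in no top simplex, so the vectors are first moved off all
proper spans without changing any sign. -/
theorem starDegree_eq (hΔ : Δ.IsComplete) {K : Finset V} (hK : K ∈ Δ.faces) {x y : RealExt L}
    (hx : ∀ (I : Δ.topFaces) (i : I.1), (𝒱.basis I).coord i x ≠ 0)
    (hy : ∀ (I : Δ.topFaces) (i : I.1), (𝒱.basis I).coord i y ≠ 0) :
    𝒱.starDegree K x = 𝒱.starDegree K y := by
  classical
  have key : ∀ x : RealExt L, (∀ (I : Δ.topFaces) (i : I.1), (𝒱.basis I).coord i x ≠ 0) →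
      ∃ x', (Δ.IsGenericFor K ((Δ.coneSpan K).mkQ x')) ∧
        Δ.degreeAt K ((Δ.coneSpan K).mkQ x') = 𝒱.starDegree K x := by
    intro x hx
    -- Both signs of each coordinate are included because `exists_avoiding_subspaces` only preserves
    -- positivity; together they keep the coordinates nonzero.
    let f : ((I : Δ.topFaces) × I.1) ⊕ ((I : Δ.topFaces) × I.1) → RealExt L →ₗ[ℝ] ℝ :=
      Sum.elim (fun j => (𝒱.basis j.1).coord j.2) (fun j => -(𝒱.basis j.1).coord j.2)
    obtain ⟨x', h1, h2⟩ := exists_avoiding_subspaces f (x := x)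
      (by rintro (j | j)
          · exact hx j.1 j.2
          · simpa [f] using hx j.1 j.2)
      (Δ.faces.filter fun J => J.card < Module.finrank ℤ L) Δ.coneSpan
      (fun J hJ => 𝒱.coneSpan_ne_top (Finset.mem_filter.1 hJ).1 (Finset.mem_filter.1 hJ).2)
    have h3 : ∀ (I : Δ.topFaces) (i : I.1), 0 < (𝒱.basis I).coord i x ↔
        0 < (𝒱.basis I).coord i x' := fun I i => h1 (Sum.inl ⟨I, i⟩)
    have h4 : ∀ (I : Δ.topFaces) (i : I.1), 0 < -(𝒱.basis I).coord i x ↔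
        0 < -(𝒱.basis I).coord i x' := fun I i => h1 (Sum.inr ⟨I, i⟩)
    have h5 : ∀ (I : Δ.topFaces) (i : I.1), (𝒱.basis I).coord i x' ≠ 0 := fun I i h0 => by
      have e3 := h3 I i
      have e4 := h4 I i
      rw [h0] at e3 e4
      rcases lt_or_gt_of_ne (hx I i) with h | h
      · have := e4.1 (by linarith); simp at this
      · exact lt_irrefl _ (e3.1 h)
    refine ⟨x', 𝒱.isGenericFor_mkQ (fun J hJ hc => h2 J (Finset.mem_filter.2 ⟨hJ, hc⟩)) hK, ?_⟩
    rw [𝒱.degreeAt_eq_starDegree K h5, starDegree, starDegree]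
    refine Finset.sum_congr rfl fun I _ => if_congr (and_congr_right fun _ => ?_) rfl rfl
    exact forall₂_congr fun i _ => (h3 I i).symm
  obtain ⟨x', hx1, hx2⟩ := key x hx
  obtain ⟨y', hy1, hy2⟩ := key y hy
  rw [← hx2, ← hy2]
  exact hΔ K hK _ _ hx1 hy1

end GeneratingVectors

/-! ### Avoiding zeros of functionals on a lattice -/

/-- Each functional rules out at most one value of `k`. -/
theorem exists_nsmul_add_ne_zero {L ι : Type*} [AddCommGroup L] [Finite ι] (f : ι → L →+ ℝ)
    {x : L} (hx : ∀ i, f i x ≠ 0) (y : L) : ∃ k : ℕ, ∀ i, f i (y + k • x) ≠ 0 := by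
  have hfin : (⋃ i, {k : ℕ | f i (y + k • x) = 0}).Finite := by
    refine Set.finite_iUnion fun i => Set.Subsingleton.finite fun k hk l hl => ?_
    simp only [Set.mem_ofPred_eq, map_add, map_nsmul, nsmul_eq_mul] at hk hl
    have : (k : ℝ) * f i x = l * f i x := by linarith
    exact_mod_cast mul_right_cancel₀ (hx i) this
  obtain ⟨k, hk⟩ := hfin.exists_notMem
  exact ⟨k, fun i h => hk (Set.mem_iUnion.2 ⟨i, h⟩)⟩

theorem exists_forall_ne_zero {L ι : Type*} [AddCommGroup L] [Finite ι] (f : ι → L →+ ℝ)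
    (hf : ∀ i, f i ≠ 0) : ∃ x : L, ∀ i, f i x ≠ 0 := by
  classical
  cases nonempty_fintype ι
  suffices h : ∀ S : Finset ι, ∃ x : L, ∀ i ∈ S, f i x ≠ 0 by
    obtain ⟨x, hx⟩ := h Finset.univ
    exact ⟨x, fun i => hx i (Finset.mem_univ i)⟩
  intro S
  induction S using Finset.induction_on with
  | empty => exact ⟨0, by simp⟩
  | insert j S _ ih =>
    obtain ⟨x, hx⟩ := ih
    by_cases hj : f j x = 0
    · obtain ⟨y, hy⟩ : ∃ y, f j y ≠ 0 := by
        by_contra h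
        push Not at h
        exact hf j (AddMonoidHom.ext h)
      obtain ⟨k, hk⟩ := exists_nsmul_add_ne_zero (fun i : S => f i) (x := x)
        (fun i => hx i.1 i.2) y
      refine ⟨y + k • x, fun i hi => ?_⟩
      rcases Finset.mem_insert.1 hi with rfl | hi
      · rw [map_add, map_nsmul, hj, smul_zero, add_zero]; exact hy
      · exact hk ⟨i, hi⟩
    · refine ⟨x, fun i hi => ?_⟩
      rcases Finset.mem_insert.1 hi with rfl | hi
      · exact hj
      · exact hx i hi

theorem latticeVec_add {L : Type*} [AddCommGroup L] (x y : L) :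
    latticeVec (x + y) = latticeVec x + latticeVec y := TensorProduct.tmul_add _ _ _

theorem latticeVec_injective {L : Type*} [AddCommGroup L] [Module.Free ℤ L] :
    Function.Injective (latticeVec : L → RealExt L) := by
  intro x y h
  let b := Module.Free.chooseBasis ℤ L
  apply b.repr.injective
  ext j
  have := congrArg (fun v => (b.baseChange ℝ).repr v j) h
  simpa [latticeVec] using this

/-- The extension of an element of `L^*` to a linear functional on `L_ℝ`. -/
def realDual {L : Type*} [AddCommGroup L] (u : Module.Dual ℤ L) : RealExt L →ₗ[ℝ] ℝ :=
  Module.Dual.baseChange ℝ u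

theorem realDual_latticeVec {L : Type*} [AddCommGroup L] (u : Module.Dual ℤ L) (x : L) :
    realDual u (latticeVec x) = u x := by
  simp [realDual, latticeVec]

/-! ### Pairings with the dual bases and the sublattices $L_{I,\mathcal V}$ -/

namespace GeneratingVectors

variable {V L : Type*} [AddCommGroup L] [Module.Free ℤ L] [Module.Finite ℤ L]
  {Δ : SimplicialMultiFan V L} (𝒱 : GeneratingVectors Δ)

/-- The pairing with `u_i^I` as an additive map. -/
def pairingHom (I : Δ.topFaces) (i : I.1) : L →+ ℝ where
  toFun := 𝒱.pairing I i
  map_zero' := by simp [pairing, latticeVec]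
  map_add' x y := by simp [pairing, latticeVec_add]

theorem pairing_add (I : Δ.topFaces) (i : I.1) (x y : L) :
    𝒱.pairing I i (x + y) = 𝒱.pairing I i x + 𝒱.pairing I i y := (𝒱.pairingHom I i).map_add x y

theorem pairing_neg (I : Δ.topFaces) (i : I.1) (x : L) :
    𝒱.pairing I i (-x) = -𝒱.pairing I i x := (𝒱.pairingHom I i).map_neg x

theorem pairing_zsmul (I : Δ.topFaces) (i : I.1) (n : ℤ) (x : L) :
    𝒱.pairing I i (n • x) = n * 𝒱.pairing I i x :=
  (map_zsmul (𝒱.pairingHom I i) n x).trans (zsmul_eq_mul _ _)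

theorem latticeVec_eq_sum (I : Δ.topFaces) (x : L) :
    latticeVec x = ∑ i : I.1, 𝒱.pairing I i x • latticeVec (𝒱.vec i) := by
  conv_lhs => rw [← (𝒱.basis I).sum_repr (latticeVec x)]
  simp_rw [basis_apply]
  rfl

open Classical in
theorem pairing_vec (I : Δ.topFaces) (i j : I.1) :
    𝒱.pairing I i (𝒱.vec j) = if j = i then 1 else 0 := by
  rw [pairing, ← basis_apply, Module.Basis.coord_apply, Module.Basis.repr_self,
    Finsupp.single_apply]

theorem dual_apply_eq_sum (I : Δ.topFaces) (u : Module.Dual ℤ L) (x : L) :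
    (u x : ℝ) = ∑ i : I.1, 𝒱.pairing I i x * (u (𝒱.vec i) : ℝ) := by
  rw [← realDual_latticeVec, 𝒱.latticeVec_eq_sum I x, map_sum]
  simp [realDual_latticeVec]

theorem eq_sum_of_pairing {I : Δ.topFaces} {x : L} {n : I.1 → ℤ}
    (hn : ∀ i, 𝒱.pairing I i x = n i) : x = ∑ i : I.1, n i • 𝒱.vec i := by
  apply latticeVec_injective
  rw [𝒱.latticeVec_eq_sum I x]
  have : latticeVec (∑ i : I.1, n i • 𝒱.vec i)
      = ∑ i : I.1, (n i : ℝ) • latticeVec (𝒱.vec i) := by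
    rw [latticeVec, TensorProduct.tmul_sum]
    refine Finset.sum_congr rfl fun i _ => ?_
    rw [TensorProduct.tmul_smul, latticeVec, Int.cast_smul_eq_zsmul]
  rw [this]
  simp_rw [hn]

open Classical in
theorem mem_sublattice_iff (I : Δ.topFaces) (x : L) :
    x ∈ 𝒱.sublattice I.1 ↔ ∀ i : I.1, ∃ n : ℤ, 𝒱.pairing I i x = n := by
  constructor
  · intro h i
    induction h using Submodule.span_induction with
    | mem y hy =>
      obtain ⟨j, hj, rfl⟩ := hy
      exact ⟨if (⟨j, hj⟩ : I.1) = i then 1 else 0, by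
        rw [𝒱.pairing_vec I i ⟨j, hj⟩]; split_ifs <;> simp⟩
    | zero => exact ⟨0, (𝒱.pairingHom I i).map_zero.trans Int.cast_zero.symm⟩
    | add y z _ _ hy hz =>
      obtain ⟨n, hn⟩ := hy
      obtain ⟨m, hm⟩ := hz
      exact ⟨n + m, by rw [pairing_add, hn, hm]; push_cast; rfl⟩
    | smul r y _ hy =>
      obtain ⟨n, hn⟩ := hy
      exact ⟨r * n, by rw [pairing_zsmul, hn]; push_cast; rfl⟩
  · intro h
    choose n hn using h
    rw [𝒱.eq_sum_of_pairing hn]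
    exact Submodule.sum_mem _ fun i _ => Submodule.smul_mem _ _
      (Submodule.subset_span ⟨i.1, i.2, rfl⟩)

theorem card_smul_mem_sublattice (I : Δ.topFaces) (x : L) :
    Nat.card (𝒱.H I.1) • x ∈ 𝒱.sublattice I.1 := by
  have h : Nat.card (𝒱.H I.1) • (Submodule.Quotient.mk x : 𝒱.H I.1) = 0 := card_nsmul_eq_zero'
  rwa [← Submodule.Quotient.mk_smul, Submodule.Quotient.mk_eq_zero] at h

theorem lcmOrder_pos : 0 < 𝒱.lcmOrder := by
  rw [Nat.pos_iff_ne_zero, lcmOrder, Ne, Finset.lcm_eq_zero_iff]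
  rintro ⟨I, -, hI⟩
  exact Nat.card_pos.ne' hI

theorem lcmOrder_smul_mem_sublattice (I : Δ.topFaces) (x : L) :
    𝒱.lcmOrder • x ∈ 𝒱.sublattice I.1 := by
  obtain ⟨k, hk⟩ : Nat.card (𝒱.H I.1) ∣ 𝒱.lcmOrder := Finset.dvd_lcm (Finset.mem_univ I)
  rw [hk, mul_comm, mul_smul]
  exact Submodule.smul_of_tower_mem _ k (𝒱.card_smul_mem_sublattice I x)

theorem lcmOrder_smul_mem_commonSublattice (x : L) :
    𝒱.lcmOrder • x ∈ 𝒱.commonSublattice :=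
  (Submodule.mem_iInf _).2 fun I => 𝒱.lcmOrder_smul_mem_sublattice I x

theorem pairingHom_ne_zero (I : Δ.topFaces) (i : I.1) : 𝒱.pairingHom I i ≠ 0 := by
  intro h
  have h1 : 𝒱.pairing I i (𝒱.vec i) = 0 := DFunLike.congr_fun h (𝒱.vec i)
  rw [𝒱.pairing_vec I i i, if_pos rfl] at h1
  exact one_ne_zero h1

/-- A lattice vector avoiding finitely many kernels exists, and its multiple by `lcmOrder` lies in
every $L_{I,\mathcal V}$ and avoids the same kernels. -/
theorem exists_isGeneric_separating {ι : Type*} [Finite ι] (f : ι → Module.Dual ℤ L)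
    (hf : ∀ j, f j ≠ 0) :
    ∃ v ∈ 𝒱.commonSublattice, 𝒱.IsGeneric v ∧ ∀ j, f j v ≠ 0 := by
  let g : ((I : Δ.topFaces) × I.1) ⊕ ι → L →+ ℝ := Sum.elim (fun j => 𝒱.pairingHom j.1 j.2)
    (fun j => (Int.castAddHom ℝ).comp (f j).toAddMonoidHom)
  obtain ⟨x, hx⟩ := exists_forall_ne_zero g (by
    rintro (j | j)
    · exact 𝒱.pairingHom_ne_zero j.1 j.2
    · intro h
      apply hf j
      ext x
      have : ((f j x : ℤ) : ℝ) = 0 := DFunLike.congr_fun h x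
      simpa using this)
  have hM := 𝒱.lcmOrder_pos.ne'
  refine ⟨_, 𝒱.lcmOrder_smul_mem_commonSublattice x, fun I i => ?_, fun j => ?_⟩
  · have h1 : 𝒱.pairing I i x ≠ 0 := hx (Sum.inl ⟨I, i⟩)
    rw [← natCast_zsmul, pairing_zsmul]
    exact mul_ne_zero (by exact_mod_cast hM) h1
  · have h1 : ((f j x : ℤ) : ℝ) ≠ 0 := hx (Sum.inr j)
    rw [map_nsmul, nsmul_eq_mul]
    exact mul_ne_zero (by exact_mod_cast hM) (by exact_mod_cast h1)

/-! ### The coefficients of the expansion -/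

open Classical in
/-- The sum over `I ∈ Σ^(n)` of the contributions of `u ∈ L^*` to the expansions of the genus, in
the region where `|T_i| < 1` if and only if `⟨u_i^I, v⟩ > 0`. -/
def starSeries (N : ℕ) (a : V → ℕ) (K : Finset V) (v : L) (u : Module.Dual ℤ L) :
    PowerSeries (LaurentPolynomial ℤ) :=
  ∑ I : Δ.topFaces, if K ⊆ I.1 then
    (Δ.w I.1 : PowerSeries (LaurentPolynomial ℤ)) *
      ∏ i : I.1, branchSeries N (a i) (0 < 𝒱.pairing I i v) (u (𝒱.vec i)) else 0

-- Expand the product over subsets `T` of `I`, with `T` the indices contributing `β`. A term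
-- survives only if the coordinates outside `T` are positive and `K ⊆ T`. After exchanging the sums,
-- the weights attached to a fixed `T` add up to the degree of the projected multi-fan at `T`.
open Classical in
theorem sum_prod_eq_sum_starDegree {S : Type*} [CommRing S] (β : V → S) (R : S) (K : Finset V)
    (x : RealExt L) :
    (∑ I : Δ.topFaces, if K ⊆ I.1 then (Δ.w I.1 : S) *
      ∏ i : I.1, (β i + if 0 < (𝒱.basis I).coord i x then (if i.1 ∈ K then 0 else R) else 0)
      else 0) =
    ∑ T ∈ Δ.faces, if K ⊆ T then
      (∏ i ∈ T, β i) * R ^ (Module.finrank ℤ L - T.card) * (𝒱.starDegree T x : S) else 0 := by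
  have hI : ∀ I : Δ.topFaces, (if K ⊆ I.1 then (Δ.w I.1 : S) *
      ∏ i : I.1, (β i + if 0 < (𝒱.basis I).coord i x then (if i.1 ∈ K then 0 else R) else 0)
      else 0) = ∑ T ∈ Δ.faces, if K ⊆ T then (∏ i ∈ T, β i) * R ^ (Module.finrank ℤ L - T.card) *
        (if T ⊆ I.1 ∧ ∀ i : I.1, i.1 ∉ T → 0 < (𝒱.basis I).coord i x then (Δ.w I.1 : S) else 0)
        else 0 := by
    intro I
    let r : V → S := fun i => if h : i ∈ I.1 then
      (if 0 < (𝒱.basis I).coord ⟨i, h⟩ x then (if i ∈ K then 0 else R) else 0) else 0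
    have h1 : ∏ i : I.1, (β i + if 0 < (𝒱.basis I).coord i x then (if i.1 ∈ K then 0 else R)
        else 0) = ∏ i ∈ I.1, (β i + r i) := by
      rw [← Finset.prod_coe_sort I.1 fun i => β i + r i]
      refine Finset.prod_congr rfl fun i _ => ?_
      simp [r]
    have h2 : ∀ T ⊆ I.1, ∏ i ∈ I.1 \ T, r i = if K ⊆ T then
        (if ∀ i : I.1, i.1 ∉ T → 0 < (𝒱.basis I).coord i x then
          R ^ (Module.finrank ℤ L - T.card) else 0) else (if K ⊆ I.1 then 0 else
            ∏ i ∈ I.1 \ T, r i) := by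
      intro T hT
      split_ifs with hKT hpos hKI
      · rw [← top_card I, ← Finset.card_sdiff_of_subset hT]
        refine Finset.prod_eq_pow_card fun i hi => ?_
        obtain ⟨hi1, hi2⟩ := Finset.mem_sdiff.1 hi
        simp only [r, dif_pos hi1, if_pos (hpos ⟨i, hi1⟩ hi2), if_neg fun h => hi2 (hKT h)]
      · push Not at hpos
        obtain ⟨i, hi, hle⟩ := hpos
        refine Finset.prod_eq_zero (Finset.mem_sdiff.2 ⟨i.2, hi⟩) ?_
        simp only [r, dif_pos i.2, if_neg hle.not_gt]
      · obtain ⟨i, hi, hiT⟩ := Finset.not_subset.1 hKT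
        refine Finset.prod_eq_zero (Finset.mem_sdiff.2 ⟨hKI hi, hiT⟩) ?_
        simp only [r, dif_pos (hKI hi), if_pos hi, ite_self]
      · rfl
    split_ifs with hK
    · rw [h1, Finset.prod_add, Finset.mul_sum]
      have h3 : I.1.powerset = Δ.faces.filter fun T => T ⊆ I.1 := by
        ext T
        simp only [Finset.mem_powerset, Finset.mem_filter]
        exact ⟨fun h => ⟨Δ.down_closed _ (top_mem_faces I) _ h, h⟩, fun h => h.2⟩
      rw [h3, Finset.sum_filter]
      refine Finset.sum_congr rfl fun T _ => ?_
      by_cases hT : T ⊆ I.1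
      · rw [if_pos hT, h2 T hT, if_pos hK]
        simp only [hT, true_and]
        split_ifs <;> ring
      · simp [hT]
    · refine (Finset.sum_eq_zero fun T _ => ?_).symm
      split_ifs with hKT hT
      · exact absurd (hKT.trans hT.1) hK
      · ring
      · rfl
  rw [Finset.sum_congr rfl fun I _ => hI I, Finset.sum_comm]
  refine Finset.sum_congr rfl fun T _ => ?_
  split_ifs with hKT
  · rw [← Finset.mul_sum, starDegree]
    push_cast
    rfl
  · simp

/-- The jump between the two branches is one series `resSeries N 0` for all `i` outside `K` and zero
for `i` in `K`, and it involves neither `u` nor `i`. So `sum_prod_eq_sum_starDegree` applies, and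
`v` is left only in the degrees `starDegree`. -/
theorem starSeries_eq (hΔ : Δ.IsComplete) (N : ℕ) (a : V → ℕ) {K : Finset V}
    (hK : ∀ i, i ∈ K ↔ a i ≠ 0) {v v' : L} (hv : 𝒱.IsGeneric v) (hv' : 𝒱.IsGeneric v')
    (u : Module.Dual ℤ L) : 𝒱.starSeries N a K v u = 𝒱.starSeries N a K v' u := by
  classical
  have key : ∀ v : L, 𝒱.starSeries N a K v u = ∑ T ∈ Δ.faces, if K ⊆ T then
      (∏ i ∈ T, coefSeries N (a i) (u (𝒱.vec i))) *
        resSeries N 0 ^ (Module.finrank ℤ L - T.card) *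
        (𝒱.starDegree T (latticeVec v) : PowerSeries (LaurentPolynomial ℤ)) else 0 := by
    intro v
    rw [← 𝒱.sum_prod_eq_sum_starDegree, starSeries]
    refine Finset.sum_congr rfl fun I _ => ?_
    congr 2
    refine Finset.prod_congr rfl fun i _ => ?_
    rw [branchSeries]
    congr 1
    have hr : resSeries N (a i) = if i.1 ∈ K then 0 else resSeries N 0 := by
      split_ifs with hi
      · exact resSeries_of_ne_zero ((hK i).1 hi)
      · rw [hK, not_not] at hi; rw [hi]
    rw [hr]
    rfl
  rw [key, key]
  refine Finset.sum_congr rfl fun T hT => ?_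
  rw [𝒱.starDegree_eq hΔ hT (x := latticeVec v) (y := latticeVec v') hv hv']

theorem IsGeneric.neg {v : L} (hv : 𝒱.IsGeneric v) : 𝒱.IsGeneric (-v) := fun I i => by
  rw [pairing_neg]; exact neg_ne_zero.2 (hv I i)

/-- In $\langle u,v\rangle=\sum_i\langle u_i^I,v\rangle\,u(v_i)$ the branch at `i` was chosen by the
sign of the first factor, and bounds the second on the side that makes the product bounded below. -/
theorem exists_lower_bound (N : ℕ) (a : V → ℕ) (K : Finset V) (v : L) (s : ℕ) :
    ∃ C : ℝ, ∀ u : Module.Dual ℤ L, PowerSeries.coeff s (𝒱.starSeries N a K v u) ≠ 0 →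
      -C ≤ (u v : ℝ) := by
  classical
  choose M hM using fun b => exists_bound_branchSeries N b s
  have hnn : ∀ I : Δ.topFaces, 0 ≤ ∑ i : I.1, |𝒱.pairing I i v| * (M (a i) : ℝ) := fun I =>
    Finset.sum_nonneg fun i _ => by positivity
  refine ⟨∑ I : Δ.topFaces, ∑ i : I.1, |𝒱.pairing I i v| * (M (a i) : ℝ), fun u hu => ?_⟩
  rw [starSeries, map_sum] at hu
  obtain ⟨I, -, hI⟩ := Finset.exists_ne_zero_of_sum_ne_zero hu
  have h1 : PowerSeries.coeff s (∏ i : I.1,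
      branchSeries N (a i) (0 < 𝒱.pairing I i v) (u (𝒱.vec i))) ≠ 0 := by
    intro h
    apply hI
    split_ifs
    · rw [← map_intCast (PowerSeries.C (R := LaurentPolynomial ℤ)), PowerSeries.coeff_C_mul, h, mul_zero]
    · simp
  rw [PowerSeries.coeff_prod] at h1
  obtain ⟨l, hl, hl'⟩ := Finset.exists_ne_zero_of_sum_ne_zero h1
  have h2 : ∀ i : I.1, l i ≤ s := fun i => by
    have := (Finset.mem_finsuppAntidiag.1 hl).1
    rw [← this]
    exact Finset.single_le_sum (f := fun i => l i) (fun _ _ => Nat.zero_le _) (Finset.mem_univ i)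
  have h3 : ∀ i : I.1, -(|𝒱.pairing I i v| * (M (a i) : ℝ)) ≤
      𝒱.pairing I i v * (u (𝒱.vec i) : ℝ) := fun i => by
    have hne : PowerSeries.coeff (l i)
        (branchSeries N (a i) (0 < 𝒱.pairing I i v) (u (𝒱.vec i))) ≠ 0 := fun h =>
      hl' (Finset.prod_eq_zero (Finset.mem_univ i) h)
    obtain ⟨hp, hn, -⟩ := hM (a i) (l i) (h2 i) _ _ hne
    rcases lt_or_ge 0 (𝒱.pairing I i v) with h | h
    · rw [abs_of_pos h]
      have : (-(M (a i)) : ℝ) ≤ u (𝒱.vec i) := by exact_mod_cast hp h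
      nlinarith
    · rw [abs_of_nonpos h]
      have : (u (𝒱.vec i) : ℝ) ≤ M (a i) := by exact_mod_cast hn h.not_gt
      nlinarith
  rw [𝒱.dual_apply_eq_sum I u v]
  calc _ ≤ -∑ i : I.1, |𝒱.pairing I i v| * (M (a i) : ℝ) :=
        neg_le_neg (Finset.single_le_sum (f := fun I : Δ.topFaces =>
          ∑ i : I.1, |𝒱.pairing I i v| * (M (a i) : ℝ)) (fun I _ => hnn I) (Finset.mem_univ I))
    _ ≤ _ := by rw [← Finset.sum_neg_distrib]; exact Finset.sum_le_sum fun i _ => h3 i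

/-- Since the coefficients do not change with the generic vector, the lower bounds for `v'` and
`-v'` apply to the same support, and $\langle u,v'\rangle$ is bounded on it. Every lattice vector is
a combination of two generic ones, so all values of `u` on a basis are bounded. -/
theorem finite_support_starSeries (hΔ : Δ.IsComplete) (N : ℕ) (a : V → ℕ) {K : Finset V}
    (hK : ∀ i, i ∈ K ↔ a i ≠ 0) {v : L} (hv : 𝒱.IsGeneric v) (s : ℕ) :
    {u : Module.Dual ℤ L | PowerSeries.coeff s (𝒱.starSeries N a K v u) ≠ 0}.Finite := by
  have h1 : ∀ v' : L, 𝒱.IsGeneric v' → ∃ C : ℝ, ∀ u : Module.Dual ℤ L,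
      PowerSeries.coeff s (𝒱.starSeries N a K v u) ≠ 0 → |(u v' : ℝ)| ≤ C := by
    intro v' hv'
    obtain ⟨C₁, h1⟩ := 𝒱.exists_lower_bound N a K v' s
    obtain ⟨C₂, h2⟩ := 𝒱.exists_lower_bound N a K (-v') s
    refine ⟨max C₁ C₂, fun u hu => abs_le.2 ⟨?_, ?_⟩⟩
    · rw [𝒱.starSeries_eq hΔ N a hK hv hv'] at hu
      linarith [h1 u hu, le_max_left C₁ C₂]
    · rw [𝒱.starSeries_eq hΔ N a hK hv (IsGeneric.neg 𝒱 hv')] at hu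
      have := h2 u hu
      rw [map_neg] at this
      push_cast at this
      linarith [le_max_right C₁ C₂]
  have h2 : ∀ e : L, ∃ C : ℕ, ∀ u : Module.Dual ℤ L,
      PowerSeries.coeff s (𝒱.starSeries N a K v u) ≠ 0 → |u e| ≤ C := by
    intro e
    -- Write `e = (e + k • v) - k • v` with both `e + k • v` and `v` generic.
    obtain ⟨k, hk⟩ := exists_nsmul_add_ne_zero
      (fun j : (I : Δ.topFaces) × I.1 => 𝒱.pairingHom j.1 j.2) (x := v) (fun j => hv j.1 j.2) e
    obtain ⟨C₁, hC₁⟩ := h1 v hv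
    obtain ⟨C₂, hC₂⟩ := h1 (e + k • v) fun I i => hk ⟨I, i⟩
    obtain ⟨C, hC⟩ := exists_nat_ge (C₂ + k * C₁)
    refine ⟨C, fun u hu => ?_⟩
    have e1 : (u e : ℝ) = u (e + k • v) - k * u v := by
      rw [map_add, map_nsmul]; push_cast [nsmul_eq_mul]; ring
    have e2 : |(u e : ℝ)| ≤ C₂ + k * C₁ := by
      rw [e1]
      refine (abs_sub _ _).trans (add_le_add (hC₂ u hu) ?_)
      rw [abs_mul, Nat.abs_cast]
      exact mul_le_mul_of_nonneg_left (hC₁ u hu) (Nat.cast_nonneg k)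
    exact_mod_cast e2.trans hC
  let b := Module.Free.chooseBasis ℤ L
  choose C hC using fun j => h2 (b j)
  have h3 : (Set.Icc (fun j => -(C j : ℤ)) (fun j => (C j : ℤ))).Finite := Set.finite_Icc _ _
  refine Set.Finite.of_injOn (f := fun (u : Module.Dual ℤ L) j => u (b j)) ?_ ?_ h3
  · intro u hu
    exact ⟨fun j => (abs_le.1 (hC j u hu)).1, fun j => (abs_le.1 (hC j u hu)).2⟩
  · intro u _ u' _ h
    exact b.ext fun j => congrFun h j

end GeneratingVectors

/-! ### Lattice point expansions -/

theorem HasSum.mul_complex {α β : Type*} {f : α → ℂ} {g : β → ℂ} {s t : ℂ} (hf : HasSum f s)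
    (hg : HasSum g t) : HasSum (fun x : α × β => f x.1 * g x.2) (s * t) :=
  hf.mul hg (summable_mul_of_summable_norm hf.summable.norm hg.summable.norm)

theorem HasSum.fintype_prod {κ : Type*} (ι : Type*) [Finite ι] :
    ∀ [Fintype ι] (f : ι → κ → ℂ) (s : ι → ℂ), (∀ i, HasSum (f i) (s i)) →
      HasSum (fun m : ι → κ => ∏ i, f i (m i)) (∏ i, s i) := by
  induction ι using Finite.induction_empty_option with
  | of_equiv e ih =>
    intro hι f s h
    let _ := Fintype.ofEquiv _ e.symm
    have h1 := ih (fun i => f (e i)) (fun i => s (e i)) fun i => h (e i)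
    have h2 := (Equiv.hasSum_iff (e.arrowCongr (Equiv.refl κ)).symm).2 h1
    rw [e.prod_comp s] at h2
    refine h2.congr_fun fun m => ?_
    exact (e.prod_comp fun i => f i (m i)).symm
  | h_empty =>
    intro hι f s _
    simp
  | h_option ih =>
    intro hι f s h
    rw [Subsingleton.elim hι instFintypeOption]
    have h1 := ih (fun i => f (some i)) (fun i => s (some i)) fun i => h (some i)
    have h2 := (h none).mul_complex h1
    have h3 := (Equiv.hasSum_iff (Equiv.piOptionEquivProd (β := fun _ : Option _ => κ))).2 h2
    simp only [Fintype.prod_option]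
    exact h3

namespace GeneratingVectors

variable {V L : Type*} [AddCommGroup L] [Module.Free ℤ L] [Module.Finite ℤ L]
  {Δ : SimplicialMultiFan V L} (𝒱 : GeneratingVectors Δ)

/-- The expansion of the product of the functions `factorFun` at the fixed point `I`, twisted by
`x ∈ L`. -/
def localSeries (N : ℕ) (a : V → ℕ) (I : Δ.topFaces) (v : L) (z σ : ℂ) (x : L) : PowerSeries ℂ :=
  ∏ i : I.1, factorSeries N (a i)
    (expUnit (-z * (𝒱.pairing I i v : ℂ) - (𝒱.pairing I i x : ℂ))) (expUnit (σ / N))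

open Classical in
/-- The sum of the contributions of the simplices `I ∈ Σ^(n)` that contain `K`. -/
def genusSeries (N : ℕ) (a : V → ℕ) (K : Finset V) (v : L) (z σ : ℂ) : PowerSeries ℂ :=
  ∑ I : Δ.topFaces, if K ⊆ I.1 then
    PowerSeries.C ((Δ.w I.1 : ℂ) / (Nat.card (𝒱.H I.1) : ℂ)) *
      ∑ h : 𝒱.H I.1, 𝒱.localSeries N a I v z σ (Quotient.out h) else 0

theorem dual_ext (I : Δ.topFaces) {u u' : Module.Dual ℤ L}
    (h : ∀ i : I.1, u (𝒱.vec i) = u' (𝒱.vec i)) : u = u' := by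
  ext x
  have : (u x : ℝ) = u' x := by
    rw [𝒱.dual_apply_eq_sum I u, 𝒱.dual_apply_eq_sum I u']
    simp_rw [h]
  exact_mod_cast this

theorem exists_int_pairing_sub (I : Δ.topFaces) {x y : L}
    (h : (Submodule.Quotient.mk x : 𝒱.H I.1) = Submodule.Quotient.mk y) (i : I.1) :
    ∃ n : ℤ, 𝒱.pairing I i x = 𝒱.pairing I i y + n := by
  obtain ⟨n, hn⟩ := (𝒱.mem_sublattice_iff I _).1 ((Submodule.Quotient.eq _).1 h) i
  refine ⟨n, ?_⟩
  rw [← hn, ← pairing_add]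
  congr 1; abel

/-- Orthogonality of characters on the finite group $H_I$: the summand is a character of $H_I$,
trivial exactly when $\sum_i m_iu_i^I$ takes integral values on $L$, that is, comes from $L^*$. -/
theorem sum_character (I : Δ.topFaces) (m : I.1 → ℤ)
    [Decidable (∃ u : Module.Dual ℤ L, ∀ i : I.1, u (𝒱.vec i) = m i)] :
    ∑ h : 𝒱.H I.1, expTwoPiI (-∑ i : I.1, (m i : ℂ) * (𝒱.pairing I i (Quotient.out h) : ℂ)) =
      if ∃ u : Module.Dual ℤ L, ∀ i : I.1, u (𝒱.vec i) = m i
      then (Nat.card (𝒱.H I.1) : ℂ) else 0 := by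
  set ψ : L → ℂ := fun x => expTwoPiI (-∑ i : I.1, (m i : ℂ) * (𝒱.pairing I i x : ℂ)) with hψ
  have hadd : ∀ x y, ψ (x + y) = ψ x * ψ y := fun x y => by
    simp only [hψ]
    rw [← expTwoPiI_add, ← neg_add, ← Finset.sum_add_distrib]
    congr 2
    refine Finset.sum_congr rfl fun i _ => ?_
    rw [pairing_add]; push_cast; ring
  have hone : ∀ x y : L, (Submodule.Quotient.mk x : 𝒱.H I.1) = Submodule.Quotient.mk y →
      ψ x = ψ y := fun x y hxy => by
    choose n hn using 𝒱.exists_int_pairing_sub I hxy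
    have : ψ x = ψ y * expTwoPiI (((-∑ i : I.1, m i * n i : ℤ) : ℂ)) := by
      simp only [hψ]
      rw [← expTwoPiI_add]
      congr 1
      push_cast
      rw [← neg_add, ← Finset.sum_add_distrib]
      congr 1
      refine Finset.sum_congr rfl fun i _ => ?_
      rw [hn]; push_cast; ring
    rw [this, expTwoPiI_eq_one_iff.2 ⟨_, rfl⟩, mul_one]
  by_cases htriv : ∀ x, ψ x = 1
  · have hint : ∀ x : L, ∃ n : ℤ, ∑ i : I.1, (m i : ℝ) * 𝒱.pairing I i x = n := fun x => by
      obtain ⟨n, hn⟩ := expTwoPiI_eq_one_iff.1 (htriv x)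
      refine ⟨-n, ?_⟩
      have h2 : ((∑ i : I.1, (m i : ℝ) * 𝒱.pairing I i x : ℝ) : ℂ) = ((-n : ℤ) : ℂ) := by
        push_cast
        rw [← hn]; ring
      exact_mod_cast h2
    choose u hu using hint
    -- For the trivial character the integral values of $\sum_i m_iu_i^I$ themselves define the
    -- required element of $L^*$.
    let U : Module.Dual ℤ L := (AddMonoidHom.mk' u fun x y => by
      have : ((u (x + y) : ℤ) : ℝ) = ((u x + u y : ℤ) : ℝ) := by
        push_cast
        rw [← hu, ← hu, ← hu, ← Finset.sum_add_distrib]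
        refine Finset.sum_congr rfl fun i _ => ?_
        rw [pairing_add]; ring
      exact_mod_cast this).toIntLinearMap
    have hU : ∃ u : Module.Dual ℤ L, ∀ i : I.1, u (𝒱.vec i) = m i := by
      classical
      refine ⟨U, fun i => ?_⟩
      have h1 : ((u (𝒱.vec i) : ℤ) : ℝ) = m i := by
        rw [← hu]
        simp_rw [𝒱.pairing_vec I _ i]
        simp
      exact_mod_cast h1
    change ∑ h : 𝒱.H I.1, ψ (Quotient.out h) = _
    rw [if_pos hU]
    refine (Finset.sum_congr rfl fun h _ => htriv _).trans ?_
    simp [Nat.card_eq_fintype_card]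
  · push Not at htriv
    obtain ⟨x₀, hx₀⟩ := htriv
    rw [if_neg]
    -- Translation by the class of `x₀` permutes $H_I$ and multiplies the sum by `ψ x₀ ≠ 1`, so the
    -- sum vanishes.
    · have h1 : ∑ h : 𝒱.H I.1, ψ (Quotient.out h) = ψ x₀ * ∑ h : 𝒱.H I.1, ψ (Quotient.out h) := by
        rw [Finset.mul_sum]
        refine Fintype.sum_equiv (Equiv.addRight (-(Submodule.Quotient.mk x₀ : 𝒱.H I.1))) _ _
          fun h => ?_
        rw [← hadd]
        refine hone _ _ ?_
        rw [Submodule.Quotient.mk_add]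
        have e : ∀ h : 𝒱.H I.1, Submodule.Quotient.mk (Quotient.out h) = h := fun h =>
          Quotient.out_eq h
        rw [e, e]
        simp
      have h2 : (1 - ψ x₀) * ∑ h : 𝒱.H I.1, ψ (Quotient.out h) = 0 := by
        rw [sub_mul, one_mul, ← h1, sub_self]
      exact (mul_eq_zero.1 h2).resolve_left (sub_ne_zero.2 hx₀.symm)
    · rintro ⟨u, hu⟩
      apply hx₀
      simp only [hψ]
      rw [expTwoPiI_eq_one_iff]
      refine ⟨-u x₀, ?_⟩
      have := 𝒱.dual_apply_eq_sum I u x₀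
      simp_rw [hu] at this
      have h2 : ((u x₀ : ℝ) : ℂ) = ((∑ i : I.1, 𝒱.pairing I i x₀ * (m i : ℝ) : ℝ) : ℂ) := by
        rw [this]
      push_cast at h2 ⊢
      rw [h2]
      congr 1
      exact Finset.sum_congr rfl fun i _ => mul_comm _ _

open Classical in
theorem hasSum_localSeries (N : ℕ) (a : V → ℕ) (I : Δ.topFaces) {v : L} (hv : 𝒱.IsGeneric v)
    {z : ℂ} (hz : z.im < 0) (σ : ℂ) (x : L) (s : ℕ) :
    HasSum (fun m : I.1 → ℤ => evalLaurent (expUnit (σ / N)) (PowerSeries.coeff s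
        (∏ i : I.1, branchSeries N (a i) (0 < 𝒱.pairing I i v) (m i))) *
      (expTwoPiI (-z * ∑ i : I.1, (m i : ℂ) * (𝒱.pairing I i v : ℂ)) *
        expTwoPiI (-∑ i : I.1, (m i : ℂ) * (𝒱.pairing I i x : ℂ))))
      (PowerSeries.coeff s (𝒱.localSeries N a I v z σ x)) := by
  set T : I.1 → ℂˣ := fun i =>
    expUnit (-z * (𝒱.pairing I i v : ℂ) - (𝒱.pairing I i x : ℂ)) with hT
  have hnorm : ∀ i, ‖(T i : ℂ)‖ = Real.exp (2 * Real.pi * z.im * 𝒱.pairing I i v) := fun i => by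
    rw [hT, expUnit_val, norm_expTwoPiI]
    congr 1
    simp [Complex.mul_im]
    ring
  have hpi := Real.pi_pos
  have hT1 : ∀ i, 0 < 𝒱.pairing I i v → ‖(T i : ℂ)‖ < 1 := fun i hi => by
    rw [hnorm, Real.exp_lt_one_iff]
    have : 2 * Real.pi * z.im < 0 := by nlinarith
    exact mul_neg_of_neg_of_pos this hi
  have hT2 : ∀ i, ¬ 0 < 𝒱.pairing I i v → 1 < ‖(T i : ℂ)‖ := fun i hi => by
    rw [hnorm, Real.one_lt_exp_iff]
    have : 2 * Real.pi * z.im < 0 := by nlinarith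
    exact mul_pos_of_neg_of_neg this (lt_of_le_of_ne (not_lt.1 hi) (hv I i))
  rw [localSeries, PowerSeries.coeff_prod]
  have h1 := hasSum_sum (s := Finset.finsuppAntidiag (Finset.univ : Finset I.1) s)
    fun l _ => HasSum.fintype_prod I.1 _ _ fun i : I.1 =>
      hasSum_branchSeries N (a i) (T i) (expUnit (σ / N)) _ (hT1 i) (hT2 i) (l i)
  refine h1.congr_fun fun m => ?_
  rw [PowerSeries.coeff_prod, map_sum, Finset.sum_mul]
  refine Finset.sum_congr rfl fun l _ => ?_
  rw [map_prod, Finset.prod_mul_distrib]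
  congr 1
  have hsum : ∀ S : Finset I.1, ∏ i ∈ S, (T i : ℂ) ^ m i = expTwoPiI (∑ i ∈ S, (m i : ℂ) *
      (-z * (𝒱.pairing I i v : ℂ) - (𝒱.pairing I i x : ℂ))) := fun S => by
    induction S using Finset.induction_on with
    | empty => simp [expTwoPiI_zero]
    | insert i S hi ih =>
      rw [Finset.prod_insert hi, Finset.sum_insert hi, expTwoPiI_add, ih, expTwoPiI_int_mul]
      rfl
  rw [hsum, ← expTwoPiI_add]
  congr 1
  rw [Finset.mul_sum, ← Finset.sum_neg_distrib, ← Finset.sum_add_distrib]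
  exact Finset.sum_congr rfl fun i _ => by ring

-- Summing over $H_I$ kills all exponent vectors outside the image of $L^*$ under `u ↦ (u(v_i))`.
-- The factor $|H_I|$ that appears cancels the denominator of the genus, which gives integrality.
open Classical in
theorem hasSum_sum_localSeries (N : ℕ) (a : V → ℕ) (I : Δ.topFaces) {v : L}
    (hv : 𝒱.IsGeneric v) {z : ℂ} (hz : z.im < 0) (σ : ℂ) (s : ℕ) :
    HasSum (fun u : Module.Dual ℤ L => (Nat.card (𝒱.H I.1) : ℂ) *
      (evalLaurent (expUnit (σ / N)) (PowerSeries.coeff s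
        (∏ i : I.1, branchSeries N (a i) (0 < 𝒱.pairing I i v) (u (𝒱.vec i)))) *
      expTwoPiI (-z * (u v : ℂ))))
      (PowerSeries.coeff s (∑ h : 𝒱.H I.1, 𝒱.localSeries N a I v z σ (Quotient.out h))) := by
  have h1 := hasSum_sum (s := (Finset.univ : Finset (𝒱.H I.1)))
    fun h _ => 𝒱.hasSum_localSeries N a I hv hz σ (Quotient.out h) s
  simp_rw [← Finset.mul_sum, 𝒱.sum_character I] at h1
  have hinj : Function.Injective fun (u : Module.Dual ℤ L) (i : I.1) => u (𝒱.vec i) :=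
    fun u u' h => 𝒱.dual_ext I fun i => congrFun h i
  rw [map_sum]
  refine ((hinj.hasSum_iff ?_).2 h1).congr_fun fun u => ?_
  · intro m hm
    rw [if_neg, mul_zero, mul_zero]
    rintro ⟨u, hu⟩
    exact hm ⟨u, funext hu⟩
  · simp only [Function.comp]
    rw [if_pos ⟨u, fun i => rfl⟩]
    have h2 : ∑ i : I.1, ((u (𝒱.vec i) : ℤ) : ℂ) * (𝒱.pairing I i v : ℂ) = (u v : ℂ) := by
      have h3 : ((u v : ℝ) : ℂ) = _ := congrArg _ (𝒱.dual_apply_eq_sum I u v)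
      push_cast at h3
      rw [h3]
      exact Finset.sum_congr rfl fun i _ => mul_comm _ _
    rw [h2]
    ring

theorem hasSum_genusSeries (N : ℕ) (a : V → ℕ) (K : Finset V) {v : L}
    (hv : 𝒱.IsGeneric v) {z : ℂ} (hz : z.im < 0) (σ : ℂ) (s : ℕ) :
    HasSum (fun u : Module.Dual ℤ L =>
      evalLaurent (expUnit (σ / N)) (PowerSeries.coeff s (𝒱.starSeries N a K v u)) *
        expTwoPiI (-z * (u v : ℂ)))
      (PowerSeries.coeff s (𝒱.genusSeries N a K v z σ)) := by
  classical
  rw [genusSeries, map_sum]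
  simp_rw [starSeries, map_sum, Finset.sum_mul]
  refine hasSum_sum fun I _ => ?_
  split_ifs with hK
  · rw [PowerSeries.coeff_C_mul]
    refine ((𝒱.hasSum_sum_localSeries N a I hv hz σ s).mul_left _).congr_fun fun u => ?_
    rw [← map_intCast (PowerSeries.C (R := LaurentPolynomial ℤ)), PowerSeries.coeff_C_mul,
      map_mul, map_intCast]
    have : (Nat.card (𝒱.H I.1) : ℂ) ≠ 0 := by exact_mod_cast Nat.card_pos.ne'
    field_simp
  · simp

theorem genusSeries_neg (N : ℕ) (a : V → ℕ) (K : Finset V) (v : L) (z σ : ℂ) :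
    𝒱.genusSeries N a K (-v) (-z) σ = 𝒱.genusSeries N a K v z σ := by
  have : ∀ (I : Δ.topFaces) (i : I.1), -(-z) * (𝒱.pairing I i (-v) : ℂ)
      = -z * (𝒱.pairing I i v : ℂ) := fun I i => by
    rw [pairing_neg]; push_cast; ring
  simp only [genusSeries, localSeries, this]

/-- The finite set of `u` and the coefficients are taken from one reference vector `v₀`, so the
formula is uniform in `v`. The half plane `Im z > 0` is reached because `(v, z)` and `(-v, -z)` give
the same series. -/
theorem coeff_genusSeries_of_im_ne_zero (hΔ : Δ.IsComplete) (N : ℕ) (a : V → ℕ) {K : Finset V}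
    (hK : ∀ i, i ∈ K ↔ a i ≠ 0) {v₀ v : L} (hv₀ : 𝒱.IsGeneric v₀) (hv : 𝒱.IsGeneric v) {z : ℂ}
    (hz : z.im ≠ 0) (σ : ℂ) (s : ℕ) :
    PowerSeries.coeff s (𝒱.genusSeries N a K v z σ) =
      ∑ u ∈ (𝒱.finite_support_starSeries hΔ N a hK hv₀ s).toFinset,
        evalLaurent (expUnit (σ / N)) (PowerSeries.coeff s (𝒱.starSeries N a K v₀ u)) *
          expTwoPiI (-z * (u v : ℂ)) := by
  have key : ∀ v : L, 𝒱.IsGeneric v → ∀ z : ℂ, z.im < 0 →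
      PowerSeries.coeff s (𝒱.genusSeries N a K v z σ) =
        ∑ u ∈ (𝒱.finite_support_starSeries hΔ N a hK hv₀ s).toFinset,
          evalLaurent (expUnit (σ / N)) (PowerSeries.coeff s (𝒱.starSeries N a K v₀ u)) *
            expTwoPiI (-z * (u v : ℂ)) := fun v hv z hz => by
    refine (𝒱.hasSum_genusSeries N a K hv hz σ s).unique ?_
    simp_rw [𝒱.starSeries_eq hΔ N a hK hv hv₀]
    refine hasSum_sum_of_ne_finset_zero fun u hu => ?_
    rw [Set.Finite.mem_toFinset, Set.mem_ofPred_eq, not_not] at hu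
    rw [hu, map_zero, zero_mul]
  rcases lt_or_gt_of_ne hz with h | h
  · exact key v hv z h
  · rw [← 𝒱.genusSeries_neg, key (-v) (IsGeneric.neg 𝒱 hv) (-z) (by simpa using h)]
    refine Finset.sum_congr rfl fun u _ => ?_
    congr 2
    rw [map_neg]; push_cast; ring

/-- `z` is not a pole of any of the summands of the genus along `v`. -/
def IsRegular (v : L) (z : ℂ) : Prop :=
  ∀ (I : Δ.topFaces) (i : I.1) (x : L), (𝒱.pairing I i v : ℂ) * z ≠ (𝒱.pairing I i x : ℂ)

theorem IsRegular.expTwoPiI_ne_one {v : L} {z : ℂ} (hz : 𝒱.IsRegular v z) (I : Δ.topFaces)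
    (i : I.1) (x : L) :
    expTwoPiI (-z * (𝒱.pairing I i v : ℂ) - (𝒱.pairing I i x : ℂ)) ≠ 1 := by
  classical
  intro h
  obtain ⟨n, hn⟩ := expTwoPiI_eq_one_iff.1 h
  apply hz I i (-(n • 𝒱.vec i + x))
  rw [pairing_neg, pairing_add, pairing_zsmul, 𝒱.pairing_vec I i i, if_pos rfl]
  push_cast
  linear_combination -hn

theorem isRegular_of_im_ne_zero {v : L} (hv : 𝒱.IsGeneric v) {z : ℂ} (hz : z.im ≠ 0) :
    𝒱.IsRegular v z := fun I i x h => by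
  have := congrArg Complex.im h
  simp [Complex.mul_im, hz, hv I i] at this

/-- For real `z` the expansions in powers of `T` need not converge, but both sides are continuous at
a regular point and agree for nearby `z + ε i`. -/
theorem coeff_genusSeries (hΔ : Δ.IsComplete) (N : ℕ) (a : V → ℕ) {K : Finset V}
    (hK : ∀ i, i ∈ K ↔ a i ≠ 0) {v₀ v : L} (hv₀ : 𝒱.IsGeneric v₀) (hv : 𝒱.IsGeneric v) {z : ℂ}
    (hz : 𝒱.IsRegular v z) (σ : ℂ) (s : ℕ) :
    PowerSeries.coeff s (𝒱.genusSeries N a K v z σ) =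
      ∑ u ∈ (𝒱.finite_support_starSeries hΔ N a hK hv₀ s).toFinset,
        evalLaurent (expUnit (σ / N)) (PowerSeries.coeff s (𝒱.starSeries N a K v₀ u)) *
          expTwoPiI (-z * (u v : ℂ)) := by
  by_cases hzim : z.im ≠ 0
  · exact 𝒱.coeff_genusSeries_of_im_ne_zero hΔ N a hK hv₀ hv hzim σ s
  rw [not_not] at hzim
  have hc : ContinuousAt (fun z => PowerSeries.coeff s (𝒱.genusSeries N a K v z σ)) z := by
    classical
    simp only [genusSeries, localSeries, map_sum, apply_ite (PowerSeries.coeff s), map_zero,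
      PowerSeries.coeff_C_mul, PowerSeries.coeff_prod]
    refine tendsto_finsetSum _ fun I _ => ?_
    split_ifs
    · refine Filter.Tendsto.const_mul _ (tendsto_finsetSum _ fun h _ =>
        tendsto_finsetSum _ fun l _ => tendsto_finsetProd _ fun i _ => ?_)
      have h1 := continuousAt_coeff_factorSeries N (a i) (l i) (expUnit (σ / N)) _
        fun _ => hz.expTwoPiI_ne_one 𝒱 I i (Quotient.out h)
      have h2 : ContinuousAt (fun z : ℂ => -z * (𝒱.pairing I i v : ℂ)
        - (𝒱.pairing I i (Quotient.out h) : ℂ)) z := by fun_prop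
      exact ContinuousAt.comp (f := fun z : ℂ => -z * (𝒱.pairing I i v : ℂ)
        - (𝒱.pairing I i (Quotient.out h) : ℂ)) h1 h2
    · exact tendsto_const_nhds
  have hc' : Continuous fun z => ∑ u ∈ (𝒱.finite_support_starSeries hΔ N a hK hv₀ s).toFinset,
        evalLaurent (expUnit (σ / N)) (PowerSeries.coeff s (𝒱.starSeries N a K v₀ u)) *
          expTwoPiI (-z * (u v : ℂ)) :=
    continuous_finsetSum _ fun u _ => continuous_const.mul
      (continuous_expTwoPiI.comp (by fun_prop))
  have hpath : Filter.Tendsto (fun ε : ℝ => z + ε * Complex.I) (nhdsWithin 0 (Set.Ioi 0))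
      (nhds z) := by
    have h1 : Continuous fun ε : ℝ => z + ε * Complex.I := by fun_prop
    have := (h1.tendsto 0).mono_left (nhdsWithin_le_nhds (s := Set.Ioi 0))
    simpa using this
  refine tendsto_nhds_unique (hc.tendsto.comp hpath) (((hc'.tendsto z).comp hpath).congr' ?_)
  filter_upwards [self_mem_nhdsWithin] with ε hε
  refine (𝒱.coeff_genusSeries_of_im_ne_zero hΔ N a hK hv₀ hv ?_ σ s).symm
  simp only [Complex.add_im, Complex.mul_im, hzim]
  simpa using (Set.mem_Ioi.1 hε).ne'

end GeneratingVectors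

namespace GeneratingVectors

variable {V L : Type*} [AddCommGroup L] [Module.Free ℤ L] [Module.Finite ℤ L]
  {Δ : SimplicialMultiFan V L} (𝒱 : GeneratingVectors Δ)

/-! ### Power series expansion of the genus -/

/-- The product of the functions `factorFun` at `I`, twisted by `x ∈ L`. -/
def localFun (N : ℕ) (a : V → ℕ) (I : Δ.topFaces) (v : L) (z σ : ℂ) (x : L) : ℂ → ℂ :=
  ∏ i : I.1, factorFun N (a i)
    (expUnit (-z * (𝒱.pairing I i v : ℂ) - (𝒱.pairing I i x : ℂ))) (expUnit (σ / N))

open Classical in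
/-- The sum of the contributions of the simplices `I ∈ Σ^(n)` that contain `K`, as a function of
`p = e(τ/N)`. -/
def genusFun (N : ℕ) (a : V → ℕ) (K : Finset V) (v : L) (z σ : ℂ) : ℂ → ℂ :=
  ∑ I : Δ.topFaces, if K ⊆ I.1 then
    (fun _ => (Δ.w I.1 : ℂ) / (Nat.card (𝒱.H I.1) : ℂ)) *
      ∑ h : 𝒱.H I.1, 𝒱.localFun N a I v z σ (Quotient.out h) else 0

theorem exists_lt_of_forall_lt {ι : Type*} [Finite ι] (g : ι → ℝ) {M : ℝ} (hM : 0 < M)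
    (hg : ∀ j, g j < M) : ∃ m, 0 ≤ m ∧ (∀ j, g j ≤ m) ∧ m < M := by
  obtain ⟨o, ho⟩ := Finite.exists_max (fun o : Option ι => o.elim 0 g)
  refine ⟨o.elim 0 g, ho none, fun j => ho (some j), ?_⟩
  cases o with
  | none => exact hM
  | some j => exact hg j

/-- Here $|T_i|=e^{2\pi\,\mathrm{Im}(\langle u_i^I,v\rangle z)}$, so the radius $e^{-2\pi m}$ is at
most $1$, $|T_i|$ and $|T_i|^{-1}$ for all simplices at once. -/
theorem differentiableOn_genusFun {N : ℕ} {a : V → ℕ} (ha : ∀ i, a i < N) (K : Finset V) {v : L}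
    {z : ℂ} (hz : 𝒱.IsRegular v z) (σ : ℂ) {m : ℝ} (hm : 0 ≤ m)
    (hm' : ∀ (I : Δ.topFaces) (i : I.1), |((𝒱.pairing I i v : ℂ) * z).im| ≤ m) :
    DifferentiableOn ℂ (𝒱.genusFun N a K v z σ)
      (Metric.ball 0 (Real.exp (-(2 * Real.pi * m)))) := by
  classical
  have hpi := Real.pi_pos
  have hnorm : ∀ (I : Δ.topFaces) (i : I.1) (x : L),
      ‖(expUnit (-z * (𝒱.pairing I i v : ℂ) - (𝒱.pairing I i x : ℂ)) : ℂ)‖ =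
        Real.exp (2 * Real.pi * ((𝒱.pairing I i v : ℂ) * z).im) := fun I i x => by
    rw [expUnit_val, norm_expTwoPiI]
    congr 1
    simp [Complex.mul_im]
    ring
  unfold genusFun
  refine DifferentiableOn.sum fun I _ => ?_
  split_ifs
  · refine (differentiableOn_const _).mul (DifferentiableOn.sum fun h _ => ?_)
    unfold localFun
    refine DifferentiableOn.finsetProd fun i _ => ?_
    refine differentiableOn_factorFun (ha i) _ _
      (fun _ => hz.expTwoPiI_ne_one 𝒱 I i (Quotient.out h)) ?_ ?_ ?_
    · rw [Real.exp_le_one_iff]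
      have : 0 ≤ 2 * Real.pi * m := by positivity
      linarith
    · rw [hnorm, ← Real.exp_add, Real.exp_le_one_iff]
      have := (abs_le.1 (hm' I i)).2
      nlinarith
    · rw [norm_inv, hnorm, ← Real.exp_neg, ← Real.exp_add, Real.exp_le_one_iff]
      have := (abs_le.1 (hm' I i)).1
      nlinarith
  · exact differentiableOn_const 0

theorem analyticAt_factorFun {N a : ℕ} (h : a < N) (T Z : ℂˣ) (hT : a = 0 → (T : ℂ) ≠ 1) :
    AnalyticAt ℂ (factorFun N a T Z) 0 := by
  have hT0 : 0 < ‖(T : ℂ)‖ := norm_pos_iff.2 T.ne_zero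
  have hT1 : 0 < ‖(T : ℂ)⁻¹‖ := norm_pos_iff.2 (inv_ne_zero T.ne_zero)
  have h1 : 0 < min 1 (min ‖(T : ℂ)‖⁻¹ ‖(T : ℂ)⁻¹‖⁻¹) := by positivity
  refine (differentiableOn_factorFun h T Z hT (min_le_left _ _) ?_ ?_).analyticAt
    (Metric.ball_mem_nhds 0 h1)
  · rw [← le_inv_mul_iff₀ hT0, mul_one]
    exact (min_le_right _ _).trans (min_le_left _ _)
  · rw [← le_inv_mul_iff₀ hT1, mul_one]
    exact (min_le_right _ _).trans (min_le_right _ _)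

theorem taylorAtZero_genusFun {N : ℕ} {a : V → ℕ} (ha : ∀ i, a i < N) (K : Finset V) {v : L}
    {z : ℂ} (hz : 𝒱.IsRegular v z) (σ : ℂ) :
    taylorAtZero (𝒱.genusFun N a K v z σ) = 𝒱.genusSeries N a K v z σ := by
  classical
  have h1 : ∀ (I : Δ.topFaces) (h : 𝒱.H I.1) (i : I.1), AnalyticAt ℂ (factorFun N (a i)
      (expUnit (-z * (𝒱.pairing I i v : ℂ) - (𝒱.pairing I i (Quotient.out h) : ℂ)))
        (expUnit (σ / N))) 0 := fun I h i => analyticAt_factorFun (ha i) _ _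
      fun _ => hz.expTwoPiI_ne_one 𝒱 I i (Quotient.out h)
  have h2 : ∀ (I : Δ.topFaces) (h : 𝒱.H I.1),
      AnalyticAt ℂ (𝒱.localFun N a I v z σ (Quotient.out h)) 0 := fun I h =>
    Finset.analyticAt_prod _ fun i _ => h1 I h i
  have h3 : ∀ I : Δ.topFaces, AnalyticAt ℂ
      (∑ h : 𝒱.H I.1, 𝒱.localFun N a I v z σ (Quotient.out h)) 0 := fun I =>
    Finset.analyticAt_sum _ fun h _ => h2 I h
  rw [genusFun, genusSeries, taylorAtZero_sum]
  · refine Finset.sum_congr rfl fun I _ => ?_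
    split_ifs
    · rw [taylorAtZero_mul analyticAt_const (h3 I), taylorAtZero_const, taylorAtZero_sum _
        fun h _ => h2 I h]
      congr 1
      refine Finset.sum_congr rfl fun h _ => ?_
      rw [localFun, localSeries, taylorAtZero_prod _ fun i _ => h1 I h i]
      exact Finset.prod_congr rfl fun i _ => taylorAtZero_factorFun (ha i) _ _
        fun _ => hz.expTwoPiI_ne_one 𝒱 I i (Quotient.out h)
    · exact (taylorAtZero_const 0).trans (map_zero _)
  · intro I _
    split_ifs
    · exact analyticAt_const.mul (h3 I)
    · exact analyticAt_const (v := (0 : ℂ))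

theorem localSeries_congr (N : ℕ) (a : V → ℕ) (I : Δ.topFaces) (v : L) (z σ : ℂ) {x y : L}
    (h : (Submodule.Quotient.mk x : 𝒱.H I.1) = Submodule.Quotient.mk y) :
    𝒱.localSeries N a I v z σ x = 𝒱.localSeries N a I v z σ y := by
  refine Finset.prod_congr rfl fun i _ => ?_
  obtain ⟨n, hn⟩ := 𝒱.exists_int_pairing_sub I h i
  congr 1
  ext
  rw [expUnit_val, expUnit_val, hn]
  have e : -z * (𝒱.pairing I i v : ℂ) - ((𝒱.pairing I i y + n : ℝ) : ℂ) =
      (-z * (𝒱.pairing I i v : ℂ) - (𝒱.pairing I i y : ℂ)) + ((-n : ℤ) : ℂ) := by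
    push_cast; ring
  rw [e, expTwoPiI_add, expTwoPiI_eq_one_iff.2 ⟨_, rfl⟩, mul_one]

/-! ### Boxes and the restriction to integral powers of $q$ -/

variable [Fintype V]

/-- `Σ (a_i / N) v_i` is a lattice point, and `0 ≤ a_i < N`. -/
def IsBox (N : ℕ) (a : V → ℕ) : Prop :=
  (∀ i, a i < N) ∧ ∃ y : L, N • y = ∑ i, a i • 𝒱.vec i

theorem pairing_of_isBox {N : ℕ} {a : V → ℕ} {y : L} (hy : N • y = ∑ i, a i • 𝒱.vec i)
    {I : Δ.topFaces} (hI : ∀ i, a i ≠ 0 → i ∈ I.1) (i : I.1) :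
    (N : ℝ) * 𝒱.pairing I i y = a i := by
  classical
  have h1 : N • y = ∑ j : I.1, a j • 𝒱.vec j := by
    rw [hy, Finset.sum_coe_sort I.1 fun j => a j • 𝒱.vec j]
    refine (Finset.sum_subset (Finset.subset_univ _) fun j _ hj => ?_).symm
    have : a j = 0 := by by_contra h; exact hj (hI j h)
    rw [this, zero_smul]
  have h2 := congrArg (𝒱.pairingHom I i) h1
  rw [map_nsmul, map_sum] at h2
  simp_rw [map_nsmul] at h2
  have h3 : ∀ j : I.1, 𝒱.pairingHom I i (𝒱.vec j) = if j = i then 1 else 0 :=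
    𝒱.pairing_vec I i
  simp_rw [h3] at h2
  have h4 : (N : ℝ) * 𝒱.pairingHom I i y = a i := by simpa using h2
  exact h4

/-- Let `y` be the lattice point of the box. Replacing `p` by `e(1/N) p` multiplies `T_i` by
`e(a_i/N) = e(⟨u_i^I, y⟩)`, which translates the sum over $H_I$ by `-y` for every `I` containing
`K`. The series is therefore invariant, and only exponents divisible by `N` survive. -/
theorem coeff_genusSeries_of_not_dvd {N : ℕ} (hN : 0 < N) {a : V → ℕ} (ha : 𝒱.IsBox N a) {K : Finset V}
    (hK : ∀ i, i ∈ K ↔ a i ≠ 0) (v : L) (z σ : ℂ) {s : ℕ} (hs : ¬ N ∣ s) :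
    PowerSeries.coeff s (𝒱.genusSeries N a K v z σ) = 0 := by
  classical
  obtain ⟨ha, y, hy⟩ := ha
  have hN' : (N : ℂ) ≠ 0 := Nat.cast_ne_zero.2 hN.ne'
  set ω : ℂˣ := expUnit (1 / N) with hω
  have hωpow : ∀ k : ℕ, (ω : ℂ) ^ k = expTwoPiI (k / N) := fun k => by
    rw [hω, expUnit_val, ← expTwoPiI_nat_mul]; congr 1; ring
  have hωN : ω ^ N = 1 := by
    ext
    rw [Units.val_pow_eq_pow_val, hωpow, div_self hN', Units.val_one, expTwoPiI_eq_one_iff]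
    exact ⟨1, by simp⟩
  have hωs : (ω : ℂ) ^ s ≠ 1 := by
    rw [hωpow, Ne, expTwoPiI_eq_one_iff]
    rintro ⟨n, hn⟩
    rw [div_eq_iff hN'] at hn
    apply hs
    have : (s : ℤ) = n * N := by exact_mod_cast hn
    exact Int.natCast_dvd_natCast.1 ⟨n, by rw [this, mul_comm]⟩
  have hres : PowerSeries.rescale (ω : ℂ) (𝒱.genusSeries N a K v z σ) =
      𝒱.genusSeries N a K v z σ := by
    rw [genusSeries, map_sum]
    refine Finset.sum_congr rfl fun I _ => ?_
    split_ifs with hKI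
    · rw [map_mul, PowerSeries.rescale_C, map_sum]
      congr 1
      have hloc : ∀ x : L, PowerSeries.rescale (ω : ℂ) (𝒱.localSeries N a I v z σ x) =
          𝒱.localSeries N a I v z σ (x - y) := fun x => by
        rw [localSeries, localSeries, map_prod]
        refine Finset.prod_congr rfl fun i _ => ?_
        rw [rescale_factorSeries (ha i) _ _ _ hωN]
        congr 1
        ext
        rw [Units.val_mul, Units.val_pow_eq_pow_val, hωpow, expUnit_val, expUnit_val,
          ← expTwoPiI_add]
        congr 1
        have h1 := 𝒱.pairing_of_isBox hy (fun i hi => hKI ((hK i).2 hi)) i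
        have h2 : ((a i : ℕ) : ℂ) = N * (𝒱.pairing I i y : ℂ) := by exact_mod_cast h1.symm
        rw [h2, mul_div_cancel_left₀ _ hN', sub_eq_add_neg x, pairing_add, pairing_neg]
        push_cast; ring
      simp_rw [hloc]
      refine Fintype.sum_equiv (Equiv.addRight (-(Submodule.Quotient.mk y : 𝒱.H I.1))) _ _
        fun h => ?_
      refine 𝒱.localSeries_congr N a I v z σ ?_
      have e : ∀ h : 𝒱.H I.1, Submodule.Quotient.mk (Quotient.out h) = h := fun h =>
        Quotient.out_eq h
      rw [Submodule.Quotient.mk_sub, e, e]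
      simp [sub_eq_add_neg]
    · rw [map_zero]
  have h1 := congrArg (PowerSeries.coeff s) hres
  rw [PowerSeries.coeff_rescale] at h1
  have h2 : ((ω : ℂ) ^ s - 1) * PowerSeries.coeff s (𝒱.genusSeries N a K v z σ) = 0 := by
    rw [sub_mul, h1, one_mul, sub_self]
  exact (mul_eq_zero.1 h2).resolve_left (sub_ne_zero.2 hωs)

/-- The condition $\mathrm{Im}\,\tau>N|\mathrm{Im}(\langle u_i^I,v\rangle z)|$ says precisely that
`p = e(τ/N)` satisfies $|p|<\min(|T_i|,|T_i|^{-1})$ for all `i`. The Taylor series in `p` then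
converges, and only its exponents `N * k` contribute. -/
theorem hasSum_genusFun {N : ℕ} (hN : 0 < N) {a : V → ℕ} (ha : 𝒱.IsBox N a) {K : Finset V}
    (hK : ∀ i, i ∈ K ↔ a i ≠ 0) {v : L} {z τ : ℂ} (h : 𝒱.ExpansionDomain N v z τ) (σ : ℂ) :
    HasSum (fun k : ℕ => PowerSeries.coeff (N * k) (𝒱.genusSeries N a K v z σ) *
      expTwoPiI τ ^ k) (𝒱.genusFun N a K v z σ (expTwoPiI (τ / N))) := by
  have hN' : (0 : ℝ) < N := Nat.cast_pos.2 hN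
  have hpi := Real.pi_pos
  have hz : 𝒱.IsRegular v z := fun I i => (h.2 I i).2
  obtain ⟨m, hm0, hm, hmM⟩ := exists_lt_of_forall_lt
    (fun j : (I : Δ.topFaces) × I.1 => |((𝒱.pairing j.1 j.2 v : ℂ) * z).im|)
    (div_pos h.1 hN') fun j => by
      rw [lt_div_iff₀' hN']; exact (h.2 j.1 j.2).1
  have hp : ‖expTwoPiI (τ / N)‖ < Real.exp (-(2 * Real.pi * m)) := by
    rw [norm_expTwoPiI, Real.exp_lt_exp, ← Complex.ofReal_natCast, Complex.div_ofReal_im]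
    have : 2 * Real.pi * m < 2 * Real.pi * (τ.im / N) :=
      mul_lt_mul_of_pos_left hmM (by positivity)
    linarith
  have h1 := hasSum_taylorAtZero
    (𝒱.differentiableOn_genusFun ha.1 K hz σ hm0 fun I i => hm ⟨I, i⟩) hp
  rw [𝒱.taylorAtZero_genusFun ha.1 K hz σ] at h1
  have hinj : Function.Injective fun k : ℕ => N * k := fun k l hkl =>
    Nat.eq_of_mul_eq_mul_left hN hkl
  have hpN : expTwoPiI (τ / N) ^ N = expTwoPiI τ := by
    rw [← expTwoPiI_nat_mul]; congr 1
    exact mul_div_cancel₀ _ (Nat.cast_ne_zero.2 hN.ne')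
  refine ((hinj.hasSum_iff fun s hs => ?_).2 h1).congr_fun fun k => ?_
  · rw [𝒱.coeff_genusSeries_of_not_dvd hN ha hK v z σ fun ⟨k, hk⟩ => hs ⟨k, hk.symm⟩, zero_mul]
  · simp only [Function.comp]
    rw [pow_mul, hpN]

end GeneratingVectors

/-! ### Characters -/

/-- The extension of scalars from `ℤ` to `R` for Laurent polynomials. -/
def intLaurent (R : Type*) [CommRing R] : LaurentPolynomial ℤ →+* LaurentPolynomial R :=
  AddMonoidAlgebra.mapRingHom ℤ (Int.castRingHom R)

theorem evalCharacter_intLaurent {L : Type*} [AddCommGroup L] (N : ℕ) (v : L) (z σ : ℂ)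
    (f : LaurentPolynomial ℤ) :
    evalCharacter N z σ (AddMonoidAlgebra.mapRingHom ℤ (vStar v) (intLaurent _ f)) =
      evalLaurent (expUnit (σ / N)) f := by
  refine LaurentPolynomial.induction_on' f (fun p q hp hq => ?_) fun n a => ?_
  · rw [map_add, map_add, map_add, hp, hq, map_add]
  · rw [← LaurentPolynomial.single_eq_C_mul_T, intLaurent, AddMonoidAlgebra.mapRingHom_single,
      AddMonoidAlgebra.mapRingHom_single, LaurentPolynomial.single_eq_C_mul_T,
      LaurentPolynomial.single_eq_C_mul_T, evalCharacter, evalLaurent]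
    simp

theorem evalCharacter_C_single {L : Type*} [AddCommGroup L] (N : ℕ) (v : L) (z σ : ℂ)
    (u : Module.Dual ℤ L) :
    evalCharacter N z σ (AddMonoidAlgebra.mapRingHom ℤ (vStar v)
      (LaurentPolynomial.C (AddMonoidAlgebra.single u 1))) = expTwoPiI (z * (u v : ℂ)) := by
  have h1 : vStar v (AddMonoidAlgebra.single u 1) = LaurentPolynomial.T (u v) :=
    AddMonoidAlgebra.mapDomain_single
  rw [← LaurentPolynomial.single_eq_C, AddMonoidAlgebra.mapRingHom_single, h1,
    LaurentPolynomial.single_eq_C, evalCharacter, LaurentPolynomial.eval₂_C,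
    LaurentPolynomial.eval₂_T, Units.val_zpow_eq_zpow_val, expUnit_val, ← expTwoPiI_int_mul,
    mul_comm]

namespace GeneratingVectors

variable {V L : Type*} [AddCommGroup L] [Module.Free ℤ L] [Module.Finite ℤ L]
  {Δ : SimplicialMultiFan V L} (𝒱 : GeneratingVectors Δ)

/-- The coefficient of `p^s`, `p = e(τ/N)`, of the sum of the contributions to the genus of the
simplices `I ∈ Σ^(n)` that contain `K`, as an equivariant character. -/
def coeffCharacter (hΔ : Δ.IsComplete) (N : ℕ) (a : V → ℕ) {K : Finset V}
    (hK : ∀ i, i ∈ K ↔ a i ≠ 0) {v : L} (hv : 𝒱.IsGeneric v) (s : ℕ) :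
    LaurentPolynomial (AddMonoidAlgebra ℤ (Module.Dual ℤ L)) :=
  -- The sign in `-u` comes from the argument `-z v` of the genus: the contribution of `u` is
  -- $t^{-\langle u,v\rangle}$.
  ∑ u ∈ (𝒱.finite_support_starSeries hΔ N a hK hv s).toFinset,
    intLaurent (AddMonoidAlgebra ℤ (Module.Dual ℤ L)) (PowerSeries.coeff s (𝒱.starSeries N a K v u)) *
      LaurentPolynomial.C (AddMonoidAlgebra.single (-u) 1)

theorem evalCharacter_coeffCharacter (hΔ : Δ.IsComplete) (N : ℕ) (a : V → ℕ) {K : Finset V}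
    (hK : ∀ i, i ∈ K ↔ a i ≠ 0) {v₀ v : L} (hv₀ : 𝒱.IsGeneric v₀) (hv : 𝒱.IsGeneric v) {z : ℂ}
    (hz : 𝒱.IsRegular v z) (σ : ℂ) (s : ℕ) :
    evalCharacter N z σ (AddMonoidAlgebra.mapRingHom ℤ (vStar v)
      (𝒱.coeffCharacter hΔ N a hK hv₀ s)) =
        PowerSeries.coeff s (𝒱.genusSeries N a K v z σ) := by
  rw [𝒱.coeff_genusSeries hΔ N a hK hv₀ hv hz, coeffCharacter, map_sum, map_sum]
  refine Finset.sum_congr rfl fun u _ => ?_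
  rw [map_mul, map_mul, evalCharacter_intLaurent, evalCharacter_C_single]
  congr 2
  rw [LinearMap.neg_apply]; push_cast; ring

theorem exists_isQExpansion [Fintype V] (hΔ : Δ.IsComplete) {N : ℕ} (hN : 0 < N)
    (F : L → ℂ → ℂ → ℂ → ℂ) (A : Finset (V → ℕ)) (hA : ∀ a ∈ A, 𝒱.IsBox N a)
    (hF : ∀ (v : L) (z τ σ : ℂ), 0 < τ.im →
      expTwoPiI ((Module.finrank ℤ L : ℂ) * σ / 2) * F v z τ σ =
        ∑ a ∈ A, 𝒱.genusFun N a {i | a i ≠ 0} v z σ (expTwoPiI (τ / N))) :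
    ∃ X : PowerSeries (LaurentPolynomial (AddMonoidAlgebra ℤ (Module.Dual ℤ L))),
      ∀ v : L, 𝒱.IsGeneric v → 𝒱.IsQExpansion N v (F v) (vStarSeries v X) := by
  -- Only some generic vector is needed here, so the family to be separated is empty.
  obtain ⟨v₀, -, hv₀, -⟩ := 𝒱.exists_isGeneric_separating
    (Empty.elim : Empty → Module.Dual ℤ L) (fun j => j.elim)
  have hK : ∀ (a : V → ℕ) (i : V), i ∈ ({i | a i ≠ 0} : Finset V) ↔ a i ≠ 0 := fun a i => by simp
  refine ⟨∑ a ∈ A, PowerSeries.mk fun k => 𝒱.coeffCharacter hΔ N a (hK a) hv₀ (N * k),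
    fun v hv z τ σ h => ?_⟩
  rw [hF v z τ σ h.1]
  refine (hasSum_sum fun a ha => 𝒱.hasSum_genusFun hN (hA a ha) (hK a) h σ).congr_fun fun k => ?_
  rw [vStarSeries, PowerSeries.coeff_map, map_sum, map_sum, map_sum, Finset.sum_mul]
  refine Finset.sum_congr rfl fun a _ => ?_
  rw [PowerSeries.coeff_mk,
    𝒱.evalCharacter_coeffCharacter hΔ N a (hK a) hv₀ hv fun I i => (h.2 I i).2]

end GeneratingVectors

namespace GeneratingVectors

variable {V L : Type*} [AddCommGroup L] [Module.Free ℤ L] [Module.Finite ℤ L]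
  {Δ : SimplicialMultiFan V L} (𝒱 : GeneratingVectors Δ)

/-! ### The genera as sums over boxes -/

theorem prod_phiQuot_eq_localFun {N : ℕ} {a : V → ℕ} (ha : ∀ i, a i < N) (I : Δ.topFaces)
    (v x y : L) (z : ℂ) {τ : ℂ} (hτ : 0 < τ.im) (σ : ℂ)
    (hy : ∀ i : I.1, ∃ k : ℤ, (N : ℝ) * 𝒱.pairing I i y = a i + N * k) :
    expTwoPiI ((Module.finrank ℤ L : ℂ) * σ / 2) * ∏ i : I.1,
      expTwoPiI ((𝒱.pairing I i y : ℂ) * σ) *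
        phiQuot (-z * (𝒱.pairing I i v : ℂ) + τ * (𝒱.pairing I i y : ℂ)
          - (𝒱.pairing I i x : ℂ)) τ σ =
      𝒱.localFun N a I v z σ x (expTwoPiI (τ / N)) := by
  have h1 : expTwoPiI ((Module.finrank ℤ L : ℂ) * σ / 2) = ∏ _i : I.1, expTwoPiI (σ / 2) := by
    rw [Finset.prod_const, Finset.card_univ, Fintype.card_coe, top_card, ← expTwoPiI_nat_mul,
      mul_div_assoc]
  rw [h1, ← Finset.prod_mul_distrib, localFun, Finset.prod_apply]
  refine Finset.prod_congr rfl fun i _ => ?_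
  obtain ⟨k, hk⟩ := hy i
  rw [← phiQuot_eq_factorFun (ha i) hτ _ σ (𝒱.pairing I i y : ℂ) k (by exact_mod_cast hk)]
  congr 4
  ring

theorem expTwoPiI_mul_ellipticGenus (v : L) (z : ℂ) {τ : ℂ} (hτ : 0 < τ.im) (σ : ℂ) :
    expTwoPiI ((Module.finrank ℤ L : ℂ) * σ / 2) * 𝒱.ellipticGenus v z τ σ =
      𝒱.genusFun 1 0 ∅ v z σ (expTwoPiI τ) := by
  rw [ellipticGenus, genusFun, Finset.mul_sum, Finset.sum_apply]
  refine Finset.sum_congr rfl fun I _ => ?_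
  rw [if_pos (Finset.empty_subset _), Pi.mul_apply, Finset.sum_apply, mul_left_comm,
    Finset.mul_sum]
  congr 1
  refine Finset.sum_congr rfl fun h _ => ?_
  have h0 : ∀ i : I.1, 𝒱.pairing I i 0 = 0 := fun i => (𝒱.pairingHom I i).map_zero
  have h1 := 𝒱.prod_phiQuot_eq_localFun (N := 1) (a := 0) (fun _ => one_pos) I v (Quotient.out h)
    0 z hτ σ fun i => ⟨0, by simp [h0]⟩
  rw [Nat.cast_one, div_one] at h1
  rw [← h1]
  simp_rw [h0]
  simp [expTwoPiI_zero]

variable [Fintype V]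

/-- The numbers $r\langle u_i^I,y\rangle$ are integers. Their remainders modulo `r` form the box,
and subtracting the quotients times $v_i$ from `y` gives its lattice point. -/
theorem exists_isBox (I : Δ.topFaces) (y : L) : ∃ a : V → ℕ, 𝒱.IsBox 𝒱.lcmOrder a ∧
    (∀ i, a i ≠ 0 → i ∈ I.1) ∧
    ∀ i : I.1, ∃ k : ℤ, (𝒱.lcmOrder : ℝ) * 𝒱.pairing I i y = a i + 𝒱.lcmOrder * k := by
  classical
  have hN : (0 : ℤ) < 𝒱.lcmOrder := Int.natCast_pos.2 𝒱.lcmOrder_pos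
  have h1 := (𝒱.mem_sublattice_iff I _).1 (𝒱.lcmOrder_smul_mem_sublattice I y)
  choose n hn using h1
  have hm : ∀ i, ((n i % 𝒱.lcmOrder).toNat : ℤ) = n i % 𝒱.lcmOrder := fun i =>
    Int.toNat_of_nonneg (Int.emod_nonneg _ hN.ne')
  let a : V → ℕ := fun i => if hi : i ∈ I.1 then (n ⟨i, hi⟩ % 𝒱.lcmOrder).toNat else 0
  have ha : ∀ i : I.1, (a i : ℤ) = n i % 𝒱.lcmOrder := fun i => by
    simp only [a, dif_pos i.2]; exact hm i
  have ha' : ∀ i, i ∉ I.1 → a i = 0 := fun i hi => dif_neg hi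
  refine ⟨a, ⟨fun i => ?_, y - ∑ i : I.1, (n i / 𝒱.lcmOrder) • 𝒱.vec i, ?_⟩, fun i hi => ?_,
    fun i => ⟨n i / 𝒱.lcmOrder, ?_⟩⟩
  · by_cases hi : i ∈ I.1
    · have := Int.emod_lt_of_pos (n ⟨i, hi⟩) hN
      rw [← ha ⟨i, hi⟩] at this
      exact_mod_cast this
    · rw [ha' i hi]; exact 𝒱.lcmOrder_pos
  · rw [smul_sub, 𝒱.eq_sum_of_pairing hn, Finset.smul_sum, ← Finset.sum_sub_distrib]
    have h2 : ∑ i, a i • 𝒱.vec i = ∑ i : I.1, a i • 𝒱.vec i := by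
      rw [Finset.sum_coe_sort I.1 fun j => a j • 𝒱.vec j]
      refine (Finset.sum_subset (Finset.subset_univ _) fun j _ hj => ?_).symm
      rw [ha' j hj, zero_smul]
    rw [h2]
    refine Finset.sum_congr rfl fun i _ => ?_
    rw [← natCast_zsmul, ← natCast_zsmul, smul_smul, ← sub_smul, ha, Int.emod_def]
  · by_contra h
    exact hi (ha' i h)
  · have h2 : ((a i : ℤ) : ℝ) + (𝒱.lcmOrder : ℤ) * ((n i / 𝒱.lcmOrder : ℤ) : ℝ) = n i := by
      rw [ha i]; exact_mod_cast Int.emod_add_mul_ediv (n i) 𝒱.lcmOrder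
    have h3 := hn i
    rw [← natCast_zsmul, pairing_zsmul, ← h2] at h3
    exact_mod_cast h3

theorem finite_isBox (N : ℕ) : {a | 𝒱.IsBox N a}.Finite :=
  (Set.Finite.pi' fun _ : V => Set.finite_Iio N).subset fun _ ha i => ha.1 i

-- Sending a class of $H_I$ to its fractional coordinates is a bijection onto the boxes supported in
-- `I`: equal fractional parts mean that representatives differ by $L_{I,\mathcal V}$, and the
-- lattice point of a box gives the preimage.
open Classical in
theorem sum_H_eq_sum_isBox {M : Type*} [AddCommMonoid M] (I : Δ.topFaces) {b : 𝒱.H I.1 → V → ℕ}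
    (hb : ∀ h, 𝒱.IsBox 𝒱.lcmOrder (b h)) (hbI : ∀ h i, b h i ≠ 0 → i ∈ I.1)
    (hbk : ∀ h (i : I.1), ∃ k : ℤ,
      (𝒱.lcmOrder : ℝ) * 𝒱.pairing I i (Quotient.out h) = b h i + 𝒱.lcmOrder * k)
    (G : (V → ℕ) → M) :
    ∑ h, G (b h) = ∑ a ∈ (𝒱.finite_isBox 𝒱.lcmOrder).toFinset,
      if ({i | a i ≠ 0} : Finset V) ⊆ I.1 then G a else 0 := by
  have hN : (𝒱.lcmOrder : ℝ) ≠ 0 := Nat.cast_ne_zero.2 𝒱.lcmOrder_pos.ne'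
  rw [← Finset.sum_filter]
  refine Finset.sum_nbij b (fun h _ => ?_) (fun h _ h' _ hh => ?_) (fun a ha => ?_) fun _ _ => rfl
  · simp only [Finset.mem_filter, Set.Finite.mem_toFinset, Set.mem_ofPred_eq]
    exact ⟨hb h, fun i hi => hbI h i (by simpa using hi)⟩
  · rw [← Quotient.out_eq h, ← Quotient.out_eq h']
    refine (Submodule.Quotient.eq _).2 ((𝒱.mem_sublattice_iff I _).2 fun i => ?_)
    obtain ⟨k, hk⟩ := hbk h i
    obtain ⟨k', hk'⟩ := hbk h' i
    refine ⟨k - k', mul_left_cancel₀ hN ?_⟩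
    rw [sub_eq_add_neg, pairing_add, pairing_neg]
    push_cast
    rw [hh] at hk
    linear_combination hk - hk'
  · simp only [Finset.coe_filter, Set.Finite.mem_toFinset, Set.mem_ofPred_eq] at ha
    obtain ⟨⟨haN, y, hy⟩, haI⟩ := ha
    have haI' : ∀ i, a i ≠ 0 → i ∈ I.1 := fun i hi => haI (by simpa using hi)
    refine ⟨Submodule.Quotient.mk y, by simp, funext fun i => ?_⟩
    by_cases hi : i ∈ I.1
    · obtain ⟨k, hk⟩ := hbk (Submodule.Quotient.mk y) ⟨i, hi⟩
      have h1 := 𝒱.pairing_of_isBox hy haI' ⟨i, hi⟩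
      obtain ⟨n, hn⟩ := 𝒱.exists_int_pairing_sub I (x := Quotient.out
        (Submodule.Quotient.mk y : 𝒱.H I.1)) (y := y) (Quotient.out_eq _) ⟨i, hi⟩
      have h2 : (a i : ℝ) + 𝒱.lcmOrder * n =
          b (Submodule.Quotient.mk y) i + 𝒱.lcmOrder * k := by
        rw [← hk, hn, ← h1]; ring
      have h3 : (a i : ℤ) + 𝒱.lcmOrder * n =
          b (Submodule.Quotient.mk y) i + 𝒱.lcmOrder * k := by exact_mod_cast h2
      have h4 := congrArg (· % (𝒱.lcmOrder : ℤ)) h3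
      simp only [Int.add_mul_emod_self_left] at h4
      rw [Int.emod_eq_of_lt (by positivity) (by exact_mod_cast haN i),
        Int.emod_eq_of_lt (by positivity) (by exact_mod_cast (hb _).1 i)] at h4
      exact_mod_cast h4.symm
    · have h1 : a i = 0 := by by_contra h; exact hi (haI' i h)
      have h2 : b (Submodule.Quotient.mk y) i = 0 := by by_contra h; exact hi (hbI _ i h)
      rw [h1, h2]

/-- Boxes are indexed independently of `I`, so the sums over `I` and over $h_1$ can be exchanged; a
box then collects all top simplices containing its support. -/
theorem expTwoPiI_mul_orbifoldEllipticGenus (v : L) (z : ℂ) {τ : ℂ} (hτ : 0 < τ.im) (σ : ℂ) :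
    expTwoPiI ((Module.finrank ℤ L : ℂ) * σ / 2) * 𝒱.orbifoldEllipticGenus v z τ σ =
      ∑ a ∈ (𝒱.finite_isBox 𝒱.lcmOrder).toFinset,
        𝒱.genusFun 𝒱.lcmOrder a {i | a i ≠ 0} v z σ (expTwoPiI (τ / 𝒱.lcmOrder)) := by
  classical
  simp only [genusFun, Finset.sum_apply]
  rw [orbifoldEllipticGenus, Finset.mul_sum, Finset.sum_comm]
  refine Finset.sum_congr rfl fun I _ => ?_
  choose b hb hbI hbk using fun h : 𝒱.H I.1 => 𝒱.exists_isBox I (Quotient.out h)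
  have h1 := 𝒱.sum_H_eq_sum_isBox I hb hbI hbk fun a => (Δ.w I.1 : ℂ) / (Nat.card (𝒱.H I.1) : ℂ) *
    ∑ h : 𝒱.H I.1, 𝒱.localFun 𝒱.lcmOrder a I v z σ (Quotient.out h)
      (expTwoPiI (τ / 𝒱.lcmOrder))
  rw [mul_left_comm, Finset.mul_sum, Fintype.sum_prod_type, Finset.mul_sum]
  refine Eq.trans (Finset.sum_congr rfl fun h _ => ?_) (h1.trans (Finset.sum_congr rfl
    fun a _ => ?_))
  · congr 1
    refine Finset.sum_congr rfl fun h' _ => ?_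
    exact 𝒱.prod_phiQuot_eq_localFun (hb h).1 I v (Quotient.out h') (Quotient.out h) z hτ σ (hbk h)
  · split_ifs
    · rw [Pi.mul_apply, Finset.sum_apply]
    · rfl

end GeneratingVectors

/-! ### Uniqueness of the expansions -/

theorem exists_expTwoPiI_eq {q : ℂ} (hq : q ≠ 0) : ∃ τ, expTwoPiI τ = q := by
  refine ⟨Complex.log q / (2 * Real.pi * Complex.I), ?_⟩
  rw [expTwoPiI, mul_div_cancel₀ _ Complex.two_pi_I_ne_zero, Complex.exp_log hq]

theorem infinite_range_expUnit :
    (Set.range fun n : ℕ => expUnit ((n + 1 : ℕ) * Complex.I)).Infinite :=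
  Set.infinite_range_of_injective fun m n hmn => by
    have h1 := congrArg (fun T : ℂˣ => ‖(T : ℂ)‖) hmn
    simp only [expUnit_val, norm_expTwoPiI, Real.exp_eq_exp, neg_inj] at h1
    simpa using mul_left_cancel₀ Real.two_pi_pos.ne' h1

theorem LaurentPolynomial.map_coeff_eq_zero_of_infinite {R : Type*} [CommRing R] (φ : R →+* ℂ)
    (f : LaurentPolynomial R) {S : Set ℂˣ} (hS : S.Infinite)
    (h : ∀ T ∈ S, LaurentPolynomial.eval₂ φ T f = 0) (k : ℤ) : φ (f.coeff k) = 0 := by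
  obtain ⟨n, p, hp⟩ := f.exists_T_pow
  have h1 : p.map φ = 0 := by
    refine Polynomial.eq_zero_of_infinite_isRoot _ ((hS.image Units.val_injective.injOn).mono ?_)
    rintro _ ⟨T, hT, rfl⟩
    rw [Set.mem_ofPred_eq, Polynomial.IsRoot, Polynomial.eval_map, ← eval₂_toLaurent, hp, map_mul,
      h T hT, zero_mul]
  have h2 : ∀ p : Polynomial R, AddMonoidAlgebra.mapRingHom ℤ φ (Polynomial.toLaurent p) =
      Polynomial.toLaurent (p.map φ) := fun p => by
    induction p using Polynomial.induction_on' with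
    | add p q hp hq => rw [map_add, map_add, hp, hq, Polynomial.map_add, map_add]
    | monomial m r =>
      rw [Polynomial.map_monomial, ← Polynomial.C_mul_X_pow_eq_monomial,
        ← Polynomial.C_mul_X_pow_eq_monomial, Polynomial.toLaurent_C_mul_X_pow,
        Polynomial.toLaurent_C_mul_X_pow, ← single_eq_C_mul_T, ← single_eq_C_mul_T,
        AddMonoidAlgebra.mapRingHom_single]
  have h3 : f = Polynomial.toLaurent p * T (-n) := by
    rw [hp, mul_T_assoc, add_neg_cancel, T_zero, mul_one]
  rw [← AddMonoidAlgebra.coeff_mapRingHom, h3, map_mul, h2, h1, map_zero, zero_mul]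
  rfl

theorem eq_zero_of_evalCharacter_eq_zero {N : ℕ} (hN : 0 < N)
    (f : LaurentPolynomial (LaurentPolynomial ℤ))
    (h : ∀ z σ : ℂ, z.im ≠ 0 → evalCharacter N z σ f = 0) : f = 0 := by
  have hN' : (N : ℂ) ≠ 0 := Nat.cast_ne_zero.2 hN.ne'
  ext k l
  have h1 : ∀ z : ℂ, z.im ≠ 0 →
      LaurentPolynomial.eval₂ (Int.castRingHom ℂ) (expUnit z) (f.coeff k) = 0 := fun z hz => by
    refine LaurentPolynomial.map_coeff_eq_zero_of_infinite _ f infinite_range_expUnit ?_ k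
    rintro _ ⟨n, rfl⟩
    -- The factor `N` compensates the division of `σ` by `N` in `evalCharacter`, so the outer
    -- variable runs through the chosen infinite set.
    have := h z (N * ((n + 1 : ℕ) * Complex.I)) hz
    rwa [evalCharacter, mul_div_cancel_left₀ _ hN'] at this
  have h2 : (Int.castRingHom ℂ) ((f.coeff k).coeff l) = 0 := by
    refine LaurentPolynomial.map_coeff_eq_zero_of_infinite _ _ infinite_range_expUnit ?_ l
    rintro _ ⟨n, rfl⟩
    refine h1 _ ?_
    simp
    positivity
  simpa using h2

theorem eq_zero_of_vStar_eq_zero {L : Type*} [AddCommGroup L]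
    (d : AddMonoidAlgebra ℤ (Module.Dual ℤ L)) {v : L} (hd : vStar v d = 0)
    (hv : ∀ u ∈ d.coeff.support, ∀ u' ∈ d.coeff.support, u v = u' v → u = u') : d = 0 := by
  have h1 : Finsupp.mapDomain (fun u : Module.Dual ℤ L => u v) d.coeff = 0 :=
    congrArg AddMonoidAlgebra.coeff hd
  have h2 : d.coeff = 0 := Finsupp.mapDomain_injOn (d.coeff.support : Set (Module.Dual ℤ L))
    (f := fun u => u v) (fun u hu u' hu' => hv u hu u' hu') (Set.Subset.refl _) (by simp)
    (h1.trans Finsupp.mapDomain_zero.symm)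
  exact AddMonoidAlgebra.coeff_eq_zero.1 h2

namespace GeneratingVectors

variable {V L : Type*} [AddCommGroup L] [Module.Free ℤ L] [Module.Finite ℤ L]
  {Δ : SimplicialMultiFan V L} (𝒱 : GeneratingVectors Δ)

/-- For fixed non-real `z` the domain contains a half plane in `τ`, hence a punctured disc in `q`,
which determines the evaluated coefficients; varying `z` and `σ` determines the Laurent polynomials.
-/
theorem IsQExpansion.unique {N : ℕ} (hN : 0 < N) {v : L} (hv : 𝒱.IsGeneric v)
    {F : ℂ → ℂ → ℂ → ℂ} {P P' : PowerSeries (LaurentPolynomial (LaurentPolynomial ℤ))}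
    (h : 𝒱.IsQExpansion N v F P) (h' : 𝒱.IsQExpansion N v F P') : P = P' := by
  ext1 s
  refine sub_eq_zero.1 (eq_zero_of_evalCharacter_eq_zero hN _ fun z σ hz => ?_)
  obtain ⟨m, hm⟩ := (Set.finite_range fun j : (I : Δ.topFaces) × I.1 =>
    (N : ℝ) * |((𝒱.pairing j.1 j.2 v : ℂ) * z).im|).bddAbove
  have hdom : ∀ τ : ℂ, max 0 m < τ.im → 𝒱.ExpansionDomain N v z τ := fun τ hτ =>
    ⟨(le_max_left _ _).trans_lt hτ, fun I i =>
      ⟨((hm ⟨⟨I, i⟩, rfl⟩).trans (le_max_right _ _)).trans_lt hτ,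
        𝒱.isRegular_of_im_ne_zero hv hz I i⟩⟩
  -- The same logarithm `τ q` is used for both expansions, so no periodicity of `F` in `τ` has to be
  -- known.
  choose! τ hτ using fun q : ℂ => exists_expTwoPiI_eq (q := q)
  have hτm : ∀ q, q ≠ 0 → ‖q‖ < Real.exp (-(2 * Real.pi * max 0 m)) → max 0 m < (τ q).im := by
    intro q hq hqm
    rw [← hτ q hq, norm_expTwoPiI, Real.exp_lt_exp, neg_lt_neg_iff] at hqm
    exact lt_of_mul_lt_mul_left hqm Real.two_pi_pos.le
  have key : ∀ P : PowerSeries (LaurentPolynomial (LaurentPolynomial ℤ)),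
      𝒱.IsQExpansion N v F P → ∀ q, q ≠ 0 → ‖q‖ < Real.exp (-(2 * Real.pi * max 0 m)) →
      HasSum (fun s => PowerSeries.coeff s (PowerSeries.map (evalCharacter N z σ) P) * q ^ s)
        (expTwoPiI ((Module.finrank ℤ L : ℂ) * σ / 2) * F z (τ q) σ) := fun P hP q hq hqm => by
    have h1 := hP z (τ q) σ (hdom _ (hτm q hq hqm))
    rw [hτ q hq] at h1
    simpa only [PowerSeries.coeff_map] using h1
  have h2 := congrArg (PowerSeries.coeff s)
    (PowerSeries.eq_of_hasSum (Real.exp_pos _) (key P h) (key P' h'))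
  rw [PowerSeries.coeff_map, PowerSeries.coeff_map] at h2
  rw [map_sub, h2, sub_self]

/-- A coefficient of the difference involves finitely many characters, and some generic `v` in
$L_{\mathcal V}$ takes distinct values on them; for this `v` the map `vStar v` merges no two terms.
-/
theorem eq_of_forall_vStarSeries_eq
    {X X' : PowerSeries (LaurentPolynomial (AddMonoidAlgebra ℤ (Module.Dual ℤ L)))}
    (h : ∀ v ∈ 𝒱.commonSublattice, 𝒱.IsGeneric v → vStarSeries v X = vStarSeries v X') :
    X = X' := by
  ext1 s
  refine sub_eq_zero.1 ?_
  set D := PowerSeries.coeff s X - PowerSeries.coeff s X' with hD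
  have hv : ∀ v ∈ 𝒱.commonSublattice, 𝒱.IsGeneric v → ∀ k, vStar v (D.coeff k) = 0 := by
    intro v hv hv' k
    have h1 : PowerSeries.coeff s (vStarSeries v X) = PowerSeries.coeff s (vStarSeries v X') := by
      rw [h v hv hv']
    rw [vStarSeries, PowerSeries.coeff_map, PowerSeries.coeff_map, ← sub_eq_zero, ← map_sub] at h1
    rw [← AddMonoidAlgebra.coeff_mapRingHom, h1]
    rfl
  refine AddMonoidAlgebra.coeff_eq_zero.1 (Finsupp.ext fun k => ?_)
  let S := (D.coeff k).coeff.support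
  obtain ⟨v, hvc, hvg, hvs⟩ := 𝒱.exists_isGeneric_separating
    (fun p : {p : S × S // p.1 ≠ p.2} => (p.1.1.1 - p.1.2.1 : Module.Dual ℤ L))
    fun p hp => p.2 (Subtype.ext (sub_eq_zero.1 hp))
  refine eq_zero_of_vStar_eq_zero _ (hv v hvc hvg k) fun u hu u' hu' huu => ?_
  by_contra hne
  refine hvs ⟨(⟨u, hu⟩, ⟨u', hu'⟩), fun he => hne (congrArg Subtype.val he)⟩ ?_
  rw [LinearMap.sub_apply, huu, sub_self]

theorem existsUnique_isQExpansion {N : ℕ} (hN : 0 < N) {F : L → ℂ → ℂ → ℂ → ℂ}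
    {X : PowerSeries (LaurentPolynomial (AddMonoidAlgebra ℤ (Module.Dual ℤ L)))}
    (hX : ∀ v : L, 𝒱.IsGeneric v → 𝒱.IsQExpansion N v (F v) (vStarSeries v X)) :
    (∀ v ∈ 𝒱.commonSublattice, 𝒱.IsGeneric v →
      ∃! P : PowerSeries (LaurentPolynomial (LaurentPolynomial ℤ)),
        𝒱.IsQExpansion N v (F v) P) ∧
    ∃! X : PowerSeries (LaurentPolynomial (AddMonoidAlgebra ℤ (Module.Dual ℤ L))),
      ∀ v ∈ 𝒱.commonSublattice, 𝒱.IsGeneric v →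
        𝒱.IsQExpansion N v (F v) (vStarSeries v X) :=
  ⟨fun v _ hv => ⟨_, hX v hv, fun _ hP => IsQExpansion.unique 𝒱 hN hv hP (hX v hv)⟩,
    X, fun v _ hv => hX v hv, fun _ hX' => 𝒱.eq_of_forall_vStarSeries_eq fun v hvc hv =>
      IsQExpansion.unique 𝒱 hN hv (hX' v hvc hv) (hX v hv)⟩

end GeneratingVectors

theorem SimplicialMultiFan.finite_vertices {V L : Type*} [AddCommGroup L]
    (Δ : SimplicialMultiFan V L) : Finite V :=
  Finite.of_injective (fun i : V => (⟨{i}, Δ.singleton_mem i⟩ : Δ.faces)) fun i j h => by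
    simpa using h

end

theorem mainTheorem10 {V L : Type*} [AddCommGroup L] [Module.Free ℤ L] [Module.Finite ℤ L]
    (Δ : SimplicialMultiFan V L) (hΔ : Δ.IsComplete) (𝒱 : GeneratingVectors Δ) :
    (∀ v ∈ 𝒱.commonSublattice, 𝒱.IsGeneric v →
      ∃! P : PowerSeries (LaurentPolynomial (LaurentPolynomial ℤ)),
        𝒱.IsQExpansion 1 v (𝒱.ellipticGenus v) P) ∧
    (∀ v ∈ 𝒱.commonSublattice, 𝒱.IsGeneric v →
      ∃! P : PowerSeries (LaurentPolynomial (LaurentPolynomial ℤ)),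
        𝒱.IsQExpansion 𝒱.lcmOrder v (𝒱.orbifoldEllipticGenus v) P) ∧
    (∃! X : PowerSeries (LaurentPolynomial (AddMonoidAlgebra ℤ (Module.Dual ℤ L))),
      ∀ v ∈ 𝒱.commonSublattice, 𝒱.IsGeneric v →
        𝒱.IsQExpansion 1 v (𝒱.ellipticGenus v) (vStarSeries v X)) ∧
    (∃! X : PowerSeries (LaurentPolynomial (AddMonoidAlgebra ℤ (Module.Dual ℤ L))),
      ∀ v ∈ 𝒱.commonSublattice, 𝒱.IsGeneric v →
        𝒱.IsQExpansion 𝒱.lcmOrder v (𝒱.orbifoldEllipticGenus v) (vStarSeries v X)) := by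
  classical
  have := Δ.finite_vertices
  have := Fintype.ofFinite V
  -- The elliptic genus is the untwisted sector: `N = 1` and the only box is `0`.
  obtain ⟨X, hX⟩ := 𝒱.exists_isQExpansion hΔ one_pos 𝒱.ellipticGenus {0}
    (fun a ha => by
      rw [Finset.mem_singleton.1 ha]
      exact ⟨fun _ => one_pos, 0, by simp⟩)
    fun v z τ σ hτ => by
      rw [𝒱.expTwoPiI_mul_ellipticGenus v z hτ σ]
      simp
  obtain ⟨Y, hY⟩ := 𝒱.exists_isQExpansion hΔ 𝒱.lcmOrder_pos 𝒱.orbifoldEllipticGenus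
    (𝒱.finite_isBox 𝒱.lcmOrder).toFinset (fun a ha => by simpa using ha)
    fun v z τ σ hτ => by
      rw [𝒱.expTwoPiI_mul_orbifoldEllipticGenus v z hτ σ]
  obtain ⟨h1, h3⟩ := 𝒱.existsUnique_isQExpansion one_pos hX
  obtain ⟨h2, h4⟩ := 𝒱.existsUnique_isQExpansion 𝒱.lcmOrder_pos hY
  exact ⟨h1, h2, h3, h4⟩
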